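/- Let $\mathbb T^3=\mathbb R^3/\mathbb Z^3$, $\nu>0$, $0<T<\infty$. For a real vector field $h\in L^2(\mathbb T^3;\mathbb R^3)$ let $h=\sum_{k\in\mathbb Z^3}c^k e^{2\pi i k\cdot x}$ be its Fourier series, let $H$ be the space of such $h$ with $c^0=0$ and $k\cdot c^k=0$ for all $k$, let $V=H\cap H^1(\mathbb T^3)$ with dual $V'$, and for $s>0$ put $A^s h=\sum_k \lambda_k^s c^k e^{2\pi i k\cdot x}$, $\lambda_k=4\pi^2|k|^2$. For $N>0$ put $w_N=Q_N h=\sum_{|k_1|,|k_2|,|k_3|>N}c^k e^{2\pi i k\cdot x}$ and $v_N=h-w_N$. Let $f\in L^2(0,T;H)$, $u_0\in H$, and let $u\in L^2(0,T;V)\cap L^\infty(0,T;H)$ be a weak solution on $(0,T)$ of the Navier–Stokes equations $\partial_t u-\nu\Delta u+u\cdot\nabla u+\nabla p=f$, $\operatorname{div}u=0$, $u(0)=u_0$, that is, $\frac{du}{dt}\in L^1_{\mathrm{loc}}([0,T);V')$, $u(0)=u_0$, and for almost every $t\in(0,T)$ $$\Big(\frac{du}{dt},\varphi\Big)+\nu\int_{\mathbb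 T^3}\nabla u:\nabla\varphi\,dx+\sum_{i,j=1}^3\int_{\mathbb T^3}u_i\,\partial_iu_j\,\varphi_j\,dx=(f,\varphi)\qquad\text{for all }\varphi\in V.$$ Fix $N>0$ and let $w=Q_N u$ and $v=u-w$. Suppose that $A^{1/6}v(0)\in H$, where $v(0)=u_0-Q_Nu_0$ (this holds for instance if $u_0\in V$), and that $w\in L^\infty(0,T;L^3(\mathbb T^3))$. Then $$A^{1/6}v\in L^\infty(0,T;H)\qquad\text{and}\qquad A^{2/3}v\in L^2(0,T;H).$$ -/

import Mathlib

open MeasureTheory Set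
open scoped ENNReal

noncomputable section

namespace SpectralNS

/-- The flat torus `𝕋³ = ℝ³ / ℤ³`. -/
abbrev Torus3 : Type := UnitAddTorus (Fin 3)

/-- The normalised (total mass one) Lebesgue measure of `𝕋³`. -/
abbrev torusMeasure : Measure Torus3 := Measure.pi fun _ => AddCircle.haarAddCircle

/-- `ℝ³` with its Euclidean norm. -/
abbrev R3 : Type := EuclideanSpace ℝ (Fin 3)

/-- The real Hilbert space `L²(𝕋³; ℝ³)`. -/
abbrev L2Field : Type := Lp R3 2 torusMeasure

/-- The Fourier coefficient `c^k ∈ ℂ³` of a vector field: its `j`-th component is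
`∫ e^{-2π i k·x} h_j(x) dx`. -/
def coeff (h : L2Field) (k : Fin 3 → ℤ) (j : Fin 3) : ℂ :=
  UnitAddTorus.mFourierCoeff (fun x => ((h x j : ℝ) : ℂ)) k

lemma integrable_coeff (h : L2Field) (k : Fin 3 → ℤ) (j : Fin 3) :
    Integrable (fun x => UnitAddTorus.mFourier (-k) x • ((h x j : ℝ) : ℂ)) torusMeasure := by
  have h1 : Integrable (fun x => h x) torusMeasure :=
    (Lp.memLp h).integrable (by norm_num)
  have h2 : Integrable (fun x => ((h x j : ℝ) : ℂ)) torusMeasure :=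
    ((EuclideanSpace.proj (𝕜 := ℝ) j).integrable_comp h1).ofReal
  refine h2.bdd_smul 1 (UnitAddTorus.mFourier (-k)).continuous.aestronglyMeasurable ?_
  refine Filter.Eventually.of_forall fun x => ?_
  exact ((UnitAddTorus.mFourier (-k)).norm_coe_le_norm x).trans UnitAddTorus.mFourier_norm.le

lemma coeff_add (g h : L2Field) (k : Fin 3 → ℤ) (j : Fin 3) :
    coeff (g + h) k j = coeff g k j + coeff h k j := by
  unfold coeff UnitAddTorus.mFourierCoeff
  refine Eq.trans ?_ (integral_add (integrable_coeff g k j) (integrable_coeff h k j))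
  refine integral_congr_ae ?_
  filter_upwards [Lp.coeFn_add g h] with x hx
  rw [hx]
  simp [mul_add]

lemma coeff_smul (c : ℝ) (h : L2Field) (k : Fin 3 → ℤ) (j : Fin 3) :
    coeff (c • h) k j = c * coeff h k j := by
  unfold coeff UnitAddTorus.mFourierCoeff
  refine Eq.trans ?_ (integral_const_mul (c : ℂ) _)
  refine integral_congr_ae ?_
  filter_upwards [Lp.coeFn_smul c h] with x hx
  rw [hx]
  simp [mul_left_comm]

lemma coeff_zero (k : Fin 3 → ℤ) (j : Fin 3) : coeff 0 k j = 0 := by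
  simpa using coeff_smul 0 0 k j

/-- The space `H` of mean-zero, divergence-free fields in `L²(𝕋³; ℝ³)`:
`c^0 = 0` and `k · c^k = 0` for all `k`. -/
def H : Submodule ℝ L2Field where
  carrier := {h | (∀ j, coeff h 0 j = 0) ∧ ∀ k, ∑ j, (k j : ℂ) * coeff h k j = 0}
  zero_mem' := by simp [coeff_zero]
  add_mem' := by
    rintro g h ⟨hg, hg'⟩ ⟨hh, hh'⟩
    refine ⟨fun j => by rw [coeff_add, hg, hh, add_zero], fun k => ?_⟩
    simp only [coeff_add, mul_add, Finset.sum_add_distrib, hg', hh', add_zero]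
  smul_mem' := by
    rintro c h ⟨hh, hh'⟩
    refine ⟨fun j => by rw [coeff_smul, hh, mul_zero], fun k => ?_⟩
    simp only [coeff_smul, mul_left_comm _ (c : ℂ), ← Finset.mul_sum, hh', mul_zero]

/-- The fields `h ∈ H` that lie in `H¹(𝕋³)`. An element is the pair consisting of `h`
and its weak gradient `(∂₁ h, ∂₂ h, ∂₃ h)`, where `g = ∂ᵢ h` means that `g ∈ L²` has the Fourier
coefficients `2π i kᵢ c^k`; the gradient is determined by `h`. The norm is the `H¹` norm
`(‖h‖² + ∑ᵢ ‖∂ᵢ h‖²)^{1/2}`. -/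
def sobolevH1 : Submodule ℝ (WithLp 2 (L2Field × PiLp 2 (fun _ : Fin 3 => L2Field))) where
  carrier := {p | p.fst ∈ H ∧ ∀ i k j,
    coeff (p.snd i) k j = 2 * Real.pi * Complex.I * (k i : ℂ) * coeff p.fst k j}
  zero_mem' := by simp [coeff_zero]
  add_mem' := by
    rintro p q ⟨hp, hp'⟩ ⟨hq, hq'⟩
    refine ⟨H.add_mem hp hq, fun i k j => ?_⟩
    simp only [WithLp.add_fst, WithLp.add_snd, PiLp.add_apply, coeff_add, hp', hq', mul_add]
  smul_mem' := by
    rintro c p ⟨hp, hp'⟩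
    refine ⟨H.smul_mem c hp, fun i k j => ?_⟩
    simp only [WithLp.smul_fst, WithLp.smul_snd, PiLp.smul_apply, coeff_smul, hp']
    ring

/-- The space `V` with the `H¹` norm. -/
def V : Type := sobolevH1

instance : NormedAddCommGroup V := inferInstanceAs (NormedAddCommGroup sobolevH1)

instance : InnerProductSpace ℝ V := inferInstanceAs (InnerProductSpace ℝ sobolevH1)

/-- The inclusion `V → L²(𝕋³; ℝ³)`. -/
def V.toL2 : V →L[ℝ] L2Field := (WithLp.fstL 2 ℝ _ _).comp sobolevH1.subtypeL

/-- The weak derivative `∂ᵢ h ∈ L²(𝕋³; ℝ³)` of `h ∈ V`. -/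
def V.deriv (h : V) (i : Fin 3) : L2Field := (Subtype.val h).snd i

/-- The embedding `L² → V'`, `h ↦ (h, ·)_{L²}`. -/
def toDual (h : L2Field) : StrongDual ℝ V := (innerSL ℝ h).comp V.toL2

/-- The Stokes form `(A u, φ) = ∑ᵢ (∂ᵢ u, ∂ᵢ φ)_{L²}` on `V × V`, with `A = P(-Δ)`. -/
def stokesForm (u φ : V) : ℝ := ∑ i, inner ℝ (u.deriv i) (φ.deriv i)

/-- The trilinear form `b(u, v, φ) = ∑ᵢⱼ ∫ uᵢ ∂ᵢvⱼ φⱼ dx` on `V × V × V`. -/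
def trilinear (u v φ : V) : ℝ :=
  ∑ i, ∑ j, ∫ x, V.toL2 u x i * v.deriv i x j * V.toL2 φ x j ∂torusMeasure

/-- Lebesgue measure on the time interval `(0, T)`. -/
abbrev timeMeasure (T : ℝ) : Measure ℝ := volume.restrict (Ioo 0 T)

/-- `u` is a weak solution on `(0, T)` of the incompressible Navier–Stokes equations on `𝕋³` with
viscosity `ν`, force `F ∈ L²(0, T; V')` and initial velocity `u₀ ∈ H`:
`u ∈ L²(0, T; V) ∩ L^∞(0, T; H)`, the time derivative `u' = du/dt` lies in `L¹_loc([0, T); V')`,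
and `(u', φ) + ν (A u, φ) + b(u, u, φ) = (F, φ)` for all `φ ∈ V` and almost every `t`, `u(0) = u₀`.
That `u'` is the derivative of `u` in `V'` and that `u(0) = u₀` is expressed by
`u(t) = u₀ + ∫₀ᵗ u'(s) ds` in `V'` for almost every `t`. -/
structure IsWeakSolution (ν T : ℝ) (F : ℝ → StrongDual ℝ V) (u₀ : H) (u : ℝ → V) : Prop where
  force_memLp : MemLp F 2 (timeMeasure T)
  memLp_V : MemLp u 2 (timeMeasure T)
  memLp_H : MemLp (fun t => V.toL2 (u t)) ∞ (timeMeasure T)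
  equation : ∃ u' : ℝ → StrongDual ℝ V,
    LocallyIntegrableOn u' (Ico 0 T) ∧
    (∀ᵐ t ∂timeMeasure T,
      toDual (V.toL2 (u t)) = toDual (u₀ : L2Field) + ∫ s in (0 : ℝ)..t, u' s) ∧
    ∀ᵐ t ∂timeMeasure T, ∀ φ : V,
      u' t φ + ν * stokesForm (u t) φ + trilinear (u t) (u t) φ = F t φ

/-- The real field `x ↦ Re (c^k e^{2π i k·x})`. Since `h` is real-valued, `c^{-k}` is the conjugate
of `c^k`, so over a set of wave numbers that is symmetric under `k ↦ -k` these fields have the same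
sum as the Fourier modes `c^k e^{2π i k·x}` themselves. -/
def mode (h : L2Field) (k : Fin 3 → ℤ) : L2Field :=
  ContinuousMap.toLp 2 torusMeasure ℝ
    (⟨fun x => WithLp.toLp 2 fun j => (coeff h k j * UnitAddTorus.mFourier k x).re,
      by fun_prop⟩ : C(Torus3, R3))

/-- The genuine 3D part `w_N = Q_N(h) = ∑_{|k₁|,|k₂|,|k₃| > N} c^k e^{2π i k·x}`
(convergence in `L²`). -/
def genuinePart (N : ℝ) (h : L2Field) : L2Field :=
  ∑' k : {k : Fin 3 → ℤ // ∀ i, N < |(k i : ℝ)|}, mode h k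

/-- The complementary part `v_N = h - w_N`. -/
def lowPart (N : ℝ) (h : L2Field) : L2Field := h - genuinePart N h

/-- `λ_k = 4π² |k|²`. -/
def eigen (k : Fin 3 → ℤ) : ℝ := 4 * Real.pi ^ 2 * ∑ i, (k i : ℝ) ^ 2

/-- `h` lies in the domain of the fractional power `A^s` and `A^s h = g ∈ H`, that is,
`g = ∑ λ_k^s c^k e^{2π i k·x}`. -/
def IsStokesPow (s : ℝ) (h : L2Field) (g : H) : Prop :=
  ∀ k j, coeff (g : L2Field) k j = ((eigen k ^ s : ℝ) : ℂ) * coeff h k j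

/-- `A^s v ∈ L^p(0, T; H)`. -/
def StokesPowMemLp (s : ℝ) (p : ℝ≥0∞) (T : ℝ) (v : ℝ → L2Field) : Prop :=
  ∃ g : ℝ → H, MemLp g p (timeMeasure T) ∧ ∀ᵐ t ∂timeMeasure T, IsStokesPow s (v t) (g t)

end SpectralNS

end

noncomputable section

namespace SpectralNS

open UnitAddTorus ComplexConjugate

/-- The scalar space `L²(𝕋³; ℂ)`. -/
abbrev L2Scalar : Type := Lp ℂ 2 torusMeasure

lemma memLp_component (h : L2Field) (j : Fin 3) :
    MemLp (fun x => ((h x j : ℝ) : ℂ)) 2 torusMeasure :=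
  ((EuclideanSpace.proj (𝕜 := ℝ) j).comp_memLp' (Lp.memLp h)).ofReal

lemma hasSum_sq_mFourierCoeff_of_memLp {g : Torus3 → ℂ} (hg : MemLp g 2 torusMeasure) :
    HasSum (fun k => ‖mFourierCoeff g k‖ ^ 2) (∫ x, ‖g x‖ ^ 2 ∂torusMeasure) := by
  have h1 := hasSum_sq_mFourierCoeff (d := Fin 3) (hg.toLp g)
  have h2 : ∀ k, mFourierCoeff (hg.toLp g : Torus3 → ℂ) k = mFourierCoeff g k := by
    intro k
    refine integral_congr_ae ?_
    filter_upwards [hg.coeFn_toLp] with x hx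
    rw [hx]
  have h3 : ∫ x, ‖(hg.toLp g : Torus3 → ℂ) x‖ ^ 2 ∂torusMeasure =
      ∫ x, ‖g x‖ ^ 2 ∂torusMeasure := by
    refine integral_congr_ae ?_
    filter_upwards [hg.coeFn_toLp] with x hx
    rw [hx]
  simp only [h2] at h1
  rw [← h3]
  exact h1

/-- The `k`-th energy `|c^k|²`. -/
def energy (h : L2Field) (k : Fin 3 → ℤ) : ℝ := ∑ j, ‖coeff h k j‖ ^ 2

lemma energy_nonneg (h : L2Field) (k : Fin 3 → ℤ) : 0 ≤ energy h k :=
  Finset.sum_nonneg fun _ _ => by positivity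

lemma sq_norm_coeff_le_energy (h : L2Field) (k : Fin 3 → ℤ) (j : Fin 3) :
    ‖coeff h k j‖ ^ 2 ≤ energy h k :=
  Finset.single_le_sum (f := fun j => ‖coeff h k j‖ ^ 2) (fun _ _ => by positivity)
    (Finset.mem_univ j)

lemma norm_sq_eq_integral (h : L2Field) : ‖h‖ ^ 2 = ∫ x, ‖h x‖ ^ 2 ∂torusMeasure := by
  have h1 := L2.inner_def (𝕜 := ℝ) h h
  rw [real_inner_self_eq_norm_sq] at h1
  rw [h1]
  exact integral_congr_ae (Filter.Eventually.of_forall fun x => real_inner_self_eq_norm_sq _)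

/-- Parseval's identity for vector fields. -/
lemma hasSum_energy (h : L2Field) : HasSum (energy h) (‖h‖ ^ 2) := by
  have h1 : ∀ j, HasSum (fun k => ‖coeff h k j‖ ^ 2)
      (∫ x, ‖((h x j : ℝ) : ℂ)‖ ^ 2 ∂torusMeasure) := fun j =>
    hasSum_sq_mFourierCoeff_of_memLp (memLp_component h j)
  have h2 := hasSum_sum (s := Finset.univ) fun j _ => h1 j
  have h3 : ‖h‖ ^ 2 = ∑ j, ∫ x, ‖((h x j : ℝ) : ℂ)‖ ^ 2 ∂torusMeasure := by
    rw [norm_sq_eq_integral, ← integral_finsetSum]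
    · refine integral_congr_ae (Filter.Eventually.of_forall fun x => ?_)
      simp [EuclideanSpace.norm_sq_eq]
    · intro j _
      exact (memLp_component h j).integrable_norm_pow (by norm_num)
  rw [h3]
  exact h2

lemma summable_energy (h : L2Field) : Summable (energy h) := (hasSum_energy h).summable

lemma coeff_sub (g h : L2Field) (k : Fin 3 → ℤ) (j : Fin 3) :
    coeff (g - h) k j = coeff g k j - coeff h k j := by
  have h1 := coeff_smul (-1) h k j
  rw [sub_eq_add_neg, coeff_add, ← neg_one_smul ℝ h, h1]
  push_cast; ring

/-- Parseval's identity for inner products of vector fields. -/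
lemma hasSum_inner (g h : L2Field) :
    HasSum (fun k => ∑ j, (conj (coeff g k j) * coeff h k j).re) (inner ℝ g h) := by
  have h1 := ((hasSum_energy (g + h)).sub (hasSum_energy (g - h))).mul_left (1 / 4 : ℝ)
  have h2 : inner ℝ g h = 1 / 4 * (‖g + h‖ ^ 2 - ‖g - h‖ ^ 2) := by
    rw [norm_add_sq_real, norm_sub_sq_real]
    ring
  rw [h2]
  refine h1.congr_fun fun k => ?_
  simp only [energy, coeff_add, coeff_sub, ← Finset.sum_sub_distrib, Finset.mul_sum]
  refine Finset.sum_congr rfl fun j _ => ?_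
  simp only [← Complex.normSq_eq_norm_sq, Complex.normSq_apply, Complex.mul_re, Complex.conj_re,
    Complex.conj_im, Complex.add_re, Complex.add_im, Complex.sub_re, Complex.sub_im]
  ring

lemma ext_coeff {g h : L2Field} (H : ∀ k j, coeff g k j = coeff h k j) : g = h := by
  have h1 := hasSum_energy (g - h)
  have h2 : energy (g - h) = fun _ => 0 := by
    funext k
    simp [energy, coeff_sub, H]
  rw [h2] at h1
  have h3 : ‖g - h‖ ^ 2 = 0 := h1.unique hasSum_zero
  exact sub_eq_zero.mp (norm_eq_zero.mp (pow_eq_zero_iff (two_ne_zero)|>.mp h3))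

lemma norm_coeff_le (h : L2Field) (k : Fin 3 → ℤ) (j : Fin 3) : ‖coeff h k j‖ ≤ ‖h‖ := by
  have h1 : energy h k ≤ ‖h‖ ^ 2 :=
    le_hasSum (hasSum_energy h) k fun _ _ => energy_nonneg h _
  exact (sq_le_sq₀ (norm_nonneg _) (norm_nonneg _)).mp ((sq_norm_coeff_le_energy h k j).trans h1)

lemma continuous_coeff (k : Fin 3 → ℤ) (j : Fin 3) : Continuous fun h : L2Field => coeff h k j := by
  refine (LipschitzWith.of_dist_le_mul (K := 1) fun g h => ?_).continuous
  rw [dist_eq_norm, dist_eq_norm, ← coeff_sub, NNReal.coe_one, one_mul]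
  exact norm_coeff_le _ _ _

lemma continuous_energy (k : Fin 3 → ℤ) : Continuous fun h : L2Field => energy h k :=
  continuous_finsetSum _ fun j _ => ((continuous_coeff k j).norm.pow 2)

/-- The Fourier coefficients of a real field are conjugate-symmetric. -/
lemma coeff_neg_freq (h : L2Field) (k : Fin 3 → ℤ) (j : Fin 3) :
    coeff h (-k) j = conj (coeff h k j) := by
  unfold coeff mFourierCoeff
  rw [← integral_conj]
  refine integral_congr_ae (Filter.Eventually.of_forall fun x => ?_)
  simp only [smul_eq_mul, map_mul, Complex.conj_ofReal, mFourier_neg, neg_neg, Complex.conj_conj]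

lemma energy_neg_freq (h : L2Field) (k : Fin 3 → ℤ) : energy h (-k) = energy h k := by
  simp [energy, coeff_neg_freq]

/-- A conjugate-symmetric square-summable family is the family of Fourier coefficients of a real
vector field. -/
lemma exists_field (c : (Fin 3 → ℤ) → Fin 3 → ℂ) (hc : ∀ k j, c (-k) j = conj (c k j))
    (hs : Summable fun k => ∑ j, ‖c k j‖ ^ 2) : ∃ h : L2Field, ∀ k j, coeff h k j = c k j := by
  have hsj : ∀ j, Memℓp (fun k => c k j) 2 := by
    intro j
    refine memℓp_gen ?_
    have : Summable fun k => ‖c k j‖ ^ 2 :=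
      hs.of_nonneg_of_le (fun k => by positivity) fun k =>
        Finset.single_le_sum (f := fun j => ‖c k j‖ ^ 2) (fun _ _ => by positivity)
          (Finset.mem_univ j)
    simpa using this
  let G : Fin 3 → L2Scalar := fun j => (mFourierBasis (d := Fin 3)).repr.symm ⟨_, hsj j⟩
  have hG : ∀ k j, mFourierCoeff (G j : Torus3 → ℂ) k = c k j := by
    intro k j
    have := mFourierBasis_repr (d := Fin 3) (G j) k
    rw [← this]
    simp [G]
  have hmem : MemLp (fun x => (WithLp.toLp 2 fun j => (G j x).re : R3)) 2 torusMeasure := by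
    rw [memLp_piLp_iff]
    intro j
    exact (Lp.memLp (G j)).re
  refine ⟨hmem.toLp _, fun k j => ?_⟩
  have hI : ∀ k, Integrable (fun x => mFourier (-k) x • G j x) torusMeasure := by
    intro k
    refine ((Lp.memLp (G j)).integrable (by norm_num)).bdd_smul 1
      (mFourier (-k)).continuous.aestronglyMeasurable ?_
    exact Filter.Eventually.of_forall fun x =>
      ((mFourier (-k)).norm_coe_le_norm x).trans mFourier_norm.le
  have hconj : ∫ x, mFourier (-k) x • conj (G j x) ∂torusMeasure = c k j := by
    have h1 := hc (-k) j
    rw [neg_neg, ← hG (-k) j] at h1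
    unfold mFourierCoeff at h1
    rw [← integral_conj] at h1
    rw [h1]
    refine integral_congr_ae (Filter.Eventually.of_forall fun x => ?_)
    simp only [smul_eq_mul, map_mul, neg_neg, mFourier_neg]
  have hIc : Integrable (fun x => mFourier (-k) x • conj (G j x)) torusMeasure := by
    have := (Complex.conjCLE : ℂ →L[ℝ] ℂ).integrable_comp (hI (-k))
    refine this.congr (Filter.Eventually.of_forall fun x => ?_)
    simp [mFourier_neg]
  have h3 : coeff (hmem.toLp _) k j =
      ∫ x, (2⁻¹ : ℂ) * (mFourier (-k) x • G j x + mFourier (-k) x • conj (G j x)) ∂torusMeasure := by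
    unfold coeff mFourierCoeff
    refine integral_congr_ae ?_
    filter_upwards [hmem.coeFn_toLp] with x hx
    rw [hx]
    have h4 := Complex.add_conj (G j x)
    have h5 : (((G j x).re : ℝ) : ℂ) = 2⁻¹ * (G j x + conj (G j x)) := by
      rw [h4]; push_cast; ring
    simp only [smul_eq_mul, h5]
    ring
  rw [h3, integral_const_mul, integral_add (hI k) hIc, hconj]
  have := hG k j
  unfold mFourierCoeff at this
  erw [this]
  ring

/-- The real field with prescribed conjugate-symmetric square-summable Fourier coefficients
(zero when there is none). -/
def fieldOf (c : (Fin 3 → ℤ) → Fin 3 → ℂ) : L2Field :=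
  open Classical in if h : ∃ h : L2Field, ∀ k j, coeff h k j = c k j then h.choose else 0

lemma coeff_fieldOf {c : (Fin 3 → ℤ) → Fin 3 → ℂ} (hc : ∀ k j, c (-k) j = conj (c k j))
    (hs : Summable fun k => ∑ j, ‖c k j‖ ^ 2) (k : Fin 3 → ℤ) (j : Fin 3) :
    coeff (fieldOf c) k j = c k j := by
  have h := exists_field c hc hs
  rw [fieldOf, dif_pos h]
  exact h.choose_spec k j

/-- The Fourier multiplier with an even real symbol `a`. -/
def multiplier (a : (Fin 3 → ℤ) → ℝ) (h : L2Field) : L2Field :=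
  fieldOf fun k j => (a k : ℂ) * coeff h k j

lemma sum_norm_sq_mul (a : ℝ) (h : L2Field) (k : Fin 3 → ℤ) :
    ∑ j, ‖(a : ℂ) * coeff h k j‖ ^ 2 = a ^ 2 * energy h k := by
  simp [energy, Finset.mul_sum, mul_pow]

lemma coeff_multiplier {a : (Fin 3 → ℤ) → ℝ} (ha : ∀ k, a (-k) = a k) {h : L2Field}
    (hs : Summable fun k => a k ^ 2 * energy h k) (k : Fin 3 → ℤ) (j : Fin 3) :
    coeff (multiplier a h) k j = (a k : ℂ) * coeff h k j := by
  refine coeff_fieldOf (c := fun k j => (a k : ℂ) * coeff h k j) (fun k j => ?_) ?_ k j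
  · simp [ha, coeff_neg_freq]
  · simpa only [sum_norm_sq_mul] using hs

lemma energy_multiplier {a : (Fin 3 → ℤ) → ℝ} (ha : ∀ k, a (-k) = a k) {h : L2Field}
    (hs : Summable fun k => a k ^ 2 * energy h k) (k : Fin 3 → ℤ) :
    energy (multiplier a h) k = a k ^ 2 * energy h k := by
  rw [← sum_norm_sq_mul]
  simp only [energy, coeff_multiplier ha hs]

lemma summable_sq_mul_energy {a : (Fin 3 → ℤ) → ℝ} {C : ℝ} (ha : ∀ k, |a k| ≤ C) (h : L2Field) :
    Summable fun k => a k ^ 2 * energy h k := by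
  refine ((summable_energy h).mul_left (C ^ 2)).of_nonneg_of_le
    (fun k => mul_nonneg (sq_nonneg _) (energy_nonneg _ _)) fun k => ?_
  exact mul_le_mul_of_nonneg_right (sq_le_sq' (abs_le.mp (ha k)).1 (abs_le.mp (ha k)).2)
    (energy_nonneg _ _)

lemma multiplier_mem_H {a : (Fin 3 → ℤ) → ℝ} (ha : ∀ k, a (-k) = a k) {h : L2Field} (hh : h ∈ H)
    (hs : Summable fun k => a k ^ 2 * energy h k) : multiplier a h ∈ H := by
  refine ⟨fun j => by rw [coeff_multiplier ha hs, hh.1, mul_zero], fun k => ?_⟩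
  simp only [coeff_multiplier ha hs, mul_left_comm _ (a k : ℂ), ← Finset.mul_sum, hh.2, mul_zero]

lemma integral_mFourier_mul (q k : Fin 3 → ℤ) :
    ∫ x, mFourier (-q) x * mFourier k x ∂torusMeasure = if q = k then 1 else 0 := by
  have h := orthonormal_iff_ite.mp (orthonormal_mFourier (d := Fin 3)) q k
  rw [← h, ContinuousMap.inner_toLp]
  refine integral_congr_ae (Filter.Eventually.of_forall fun x => ?_)
  simp only [mFourier_neg, mul_comm]

lemma coeff_toLp (F : C(Torus3, R3)) (k : Fin 3 → ℤ) (j : Fin 3) :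
    coeff (ContinuousMap.toLp 2 torusMeasure ℝ F) k j =
      ∫ x, mFourier (-k) x * ((F x j : ℝ) : ℂ) ∂torusMeasure := by
  unfold coeff mFourierCoeff
  refine integral_congr_ae ?_
  filter_upwards [ContinuousMap.coeFn_toLp (p := 2) torusMeasure (𝕜 := ℝ) F] with x hx
  rw [hx, smul_eq_mul]

lemma integrable_mFourier_mul (q k : Fin 3 → ℤ) :
    Integrable (fun x => mFourier (-q) x * mFourier k x) torusMeasure :=
  ((mFourier (-q)).continuous.mul (mFourier k).continuous).integrable_of_hasCompactSupport
    (HasCompactSupport.of_compactSpace _)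

lemma coeff_mode (h : L2Field) (k q : Fin 3 → ℤ) (j : Fin 3) :
    coeff (mode h k) q j = 2⁻¹ * ((if q = k then coeff h k j else 0) +
      (if -q = k then conj (coeff h k j) else 0)) := by
  rw [mode, coeff_toLp]
  have h1 : ∀ x, mFourier (-q) x * (((coeff h k j * mFourier k x).re : ℝ) : ℂ) =
      2⁻¹ * (coeff h k j * (mFourier (-q) x * mFourier k x) +
        conj (coeff h k j) * (mFourier (-q) x * mFourier (-k) x)) := by
    intro x
    have h4 := Complex.add_conj (coeff h k j * mFourier k x)
    have h5 : (((coeff h k j * mFourier k x).re : ℝ) : ℂ) =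
        2⁻¹ * (coeff h k j * mFourier k x + conj (coeff h k j * mFourier k x)) := by
      rw [h4]; push_cast; ring
    rw [h5, map_mul, mFourier_neg (n := k)]
    ring
  have h2 : (fun x => mFourier (-q) x * (((coeff h k j * mFourier k x).re : ℝ) : ℂ)) = _ :=
    funext h1
  simp only [ContinuousMap.coe_mk]
  rw [h2, integral_const_mul, integral_add ((integrable_mFourier_mul _ _).const_mul _)
    ((integrable_mFourier_mul _ _).const_mul _), integral_const_mul, integral_const_mul,
    integral_mFourier_mul, integral_mFourier_mul]
  congr 2
  · simp
  · rw [mul_ite, mul_one, mul_zero]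
    exact if_congr (by rw [neg_eq_iff_eq_neg]) rfl rfl

/-- The Fourier coefficient as an additive map. -/
def coeffHom (k : Fin 3 → ℤ) (j : Fin 3) : L2Field →+ ℂ where
  toFun h := coeff h k j
  map_zero' := coeff_zero k j
  map_add' g h := coeff_add g h k j

lemma coeff_sum {ι : Type*} (s : Finset ι) (F : ι → L2Field) (k : Fin 3 → ℤ) (j : Fin 3) :
    coeff (∑ i ∈ s, F i) k j = ∑ i ∈ s, coeff (F i) k j :=
  map_sum (coeffHom k j) F s

lemma hasSum_coeff {ι : Type*} {F : ι → L2Field} {g : L2Field} (hF : HasSum F g)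
    (k : Fin 3 → ℤ) (j : Fin 3) : HasSum (fun i => coeff (F i) k j) (coeff g k j) :=
  hF.map (coeffHom k j) (continuous_coeff k j)

lemma coeff_sum_mode {a : (Fin 3 → ℤ) → ℝ} (ha : ∀ k, a (-k) = a k) (h : L2Field)
    (s : Finset (Fin 3 → ℤ)) (q : Fin 3 → ℤ) (j : Fin 3) :
    coeff (∑ k ∈ s, a k • mode h k) q j =
      ((((if q ∈ s then 1 else 0) + (if -q ∈ s then 1 else 0)) / 2 : ℝ) : ℂ) *
        (a q * coeff h q j) := by
  have h1 : ∀ k, coeff (a k • mode h k) q j =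
      2⁻¹ * ((if q = k then (a q * coeff h q j : ℂ) else 0) +
        (if -q = k then (a q * coeff h q j : ℂ) else 0)) := by
    intro k
    rw [coeff_smul, coeff_mode]
    by_cases h1 : q = k <;> by_cases h2 : -q = k
    · subst h1
      simp only [if_true, h2, ← coeff_neg_freq]
      ring
    · subst h1
      simp only [if_true, h2, if_false]
      ring
    · subst h2
      simp only [if_true, h1, if_false, ha, ← coeff_neg_freq, neg_neg]
      ring
    · simp [h1, h2]
  rw [coeff_sum, Finset.sum_congr rfl fun k _ => h1 k, ← Finset.mul_sum, Finset.sum_add_distrib,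
    Finset.sum_ite_eq, Finset.sum_ite_eq]
  split_ifs <;> push_cast <;> ring

lemma norm_sq_sum_mode_le {a : (Fin 3 → ℤ) → ℝ} (ha : ∀ k, a (-k) = a k) (h : L2Field)
    (s : Finset (Fin 3 → ℤ)) :
    ‖∑ k ∈ s, a k • mode h k‖ ^ 2 ≤ ∑ k ∈ s, a k ^ 2 * energy h k := by
  have h1 : HasSum (fun q => if q ∈ s then a q ^ 2 * energy h q else 0)
      (∑ k ∈ s, a k ^ 2 * energy h k) := by
    have := hasSum_sum_of_ne_finset_zero (s := s) (L := .unconditional _)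
      (f := fun q => if q ∈ s then a q ^ 2 * energy h q else 0) (fun b hb => by simp [hb])
    rwa [Finset.sum_congr rfl (fun q hq => by rw [if_pos hq])] at this
  have h2 : HasSum (fun q => if -q ∈ s then a q ^ 2 * energy h q else 0)
      (∑ k ∈ s, a k ^ 2 * energy h k) := by
    have := (Equiv.neg (Fin 3 → ℤ)).hasSum_iff.mpr h1
    refine this.congr_fun fun q => ?_
    simp [ha, energy_neg_freq]
  have h3 := ((h1.add h2).mul_left (1 / 2 : ℝ))
  have h4 := hasSum_le (fun q => ?_) (hasSum_energy (∑ k ∈ s, a k • mode h k)) h3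
  · linarith
  · have h5 : energy (∑ k ∈ s, a k • mode h k) q =
        (((if q ∈ s then 1 else 0) + (if -q ∈ s then 1 else 0)) / 2 : ℝ) ^ 2 *
          (a q ^ 2 * energy h q) := by
      rw [← sum_norm_sq_mul, Finset.mul_sum]
      simp only [energy, coeff_sum_mode ha, norm_mul, mul_pow, Complex.norm_real,
        Real.norm_eq_abs, sq_abs]
    have h6 : 0 ≤ a q ^ 2 * energy h q := mul_nonneg (sq_nonneg _) (energy_nonneg _ _)
    rw [h5]
    split_ifs <;> nlinarith

/-- A Fourier multiplier is the sum of its modes, in `L²`. -/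
lemma hasSum_mode {a : (Fin 3 → ℤ) → ℝ} (ha : ∀ k, a (-k) = a k) {h : L2Field}
    (hs : Summable fun k => a k ^ 2 * energy h k) :
    HasSum (fun k => a k • mode h k) (multiplier a h) := by
  have hsum : Summable fun k => a k • mode h k := by
    rw [summable_iff_vanishing_norm]
    intro ε hε
    obtain ⟨s, hs⟩ := summable_iff_vanishing_norm.mp hs (ε ^ 2) (by positivity)
    refine ⟨s, fun t ht => ?_⟩
    have h1 := (norm_sq_sum_mode_le ha h t).trans_lt ((le_abs_self _).trans_lt (hs t ht))
    exact lt_of_pow_lt_pow_left₀ 2 hε.le h1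
  have h0 := hsum.hasSum
  convert h0 using 1
  refine ext_coeff fun q j => ?_
  rw [coeff_multiplier ha hs]
  refine HasSum.unique ?_ (hasSum_coeff h0 q j)
  have h1 := (((hasSum_ite_eq q (a q * coeff h q j : ℂ)).add
    (hasSum_ite_eq (-q) (a q * coeff h q j : ℂ))).mul_left (2⁻¹ : ℂ))
  rw [← two_mul, inv_mul_cancel_left₀ two_ne_zero] at h1
  refine h1.congr_fun fun k => ?_
  have := coeff_sum_mode ha h {k} q j
  rw [Finset.sum_singleton] at this
  rw [this]
  simp only [Finset.mem_singleton, eq_comm (a := k)]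
  split_ifs <;> push_cast <;> ring

/-- The symbol of the projection on the genuinely three-dimensional wave numbers. -/
def genuineSymbol (N : ℝ) (k : Fin 3 → ℤ) : ℝ :=
  open Classical in if ∀ i, N < |(k i : ℝ)| then 1 else 0

/-- The symbol of the complementary projection. -/
def lowSymbol (N : ℝ) (k : Fin 3 → ℤ) : ℝ :=
  open Classical in if ∀ i, N < |(k i : ℝ)| then 0 else 1

lemma genuineSymbol_neg (N : ℝ) (k : Fin 3 → ℤ) : genuineSymbol N (-k) = genuineSymbol N k := by
  simp [genuineSymbol]

lemma lowSymbol_neg (N : ℝ) (k : Fin 3 → ℤ) : lowSymbol N (-k) = lowSymbol N k := by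
  simp [lowSymbol]

lemma lowSymbol_eq (N : ℝ) (k : Fin 3 → ℤ) : lowSymbol N k = 1 - genuineSymbol N k := by
  unfold lowSymbol genuineSymbol; split_ifs <;> simp

lemma lowSymbol_nonneg (N : ℝ) (k : Fin 3 → ℤ) : 0 ≤ lowSymbol N k := by
  unfold lowSymbol; split_ifs <;> simp

lemma lowSymbol_le_one (N : ℝ) (k : Fin 3 → ℤ) : lowSymbol N k ≤ 1 := by
  unfold lowSymbol; split_ifs <;> simp

lemma lowSymbol_sq (N : ℝ) (k : Fin 3 → ℤ) : lowSymbol N k ^ 2 = lowSymbol N k := by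
  unfold lowSymbol; split_ifs <;> simp

lemma genuinePart_eq (N : ℝ) (h : L2Field) :
    genuinePart N h = multiplier (genuineSymbol N) h := by
  have h1 := hasSum_mode (genuineSymbol_neg N) (h := h)
    (summable_sq_mul_energy (C := 1) (fun k => by unfold genuineSymbol; split_ifs <;> simp) h)
  refine HasSum.tsum_eq ?_
  change HasSum (mode h ∘ ((↑) : {k : Fin 3 → ℤ | ∀ i, N < |(k i : ℝ)|} → Fin 3 → ℤ)) _
  rw [hasSum_subtype_iff_indicator]
  refine h1.congr_fun fun k => ?_
  by_cases hk : ∀ i, N < |(k i : ℝ)|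
  · simp only [indicator, mem_ofPred_eq, genuineSymbol, hk, implies_true, if_true, one_smul]
  · simp only [indicator, mem_ofPred_eq, genuineSymbol, hk, if_false, zero_smul]

lemma coeff_genuinePart (N : ℝ) (h : L2Field) (k : Fin 3 → ℤ) (j : Fin 3) :
    coeff (genuinePart N h) k j = genuineSymbol N k * coeff h k j := by
  rw [genuinePart_eq, coeff_multiplier (genuineSymbol_neg N)
    (summable_sq_mul_energy (C := 1) (fun k => by unfold genuineSymbol; split_ifs <;> simp) h)]

lemma coeff_lowPart (N : ℝ) (h : L2Field) (k : Fin 3 → ℤ) (j : Fin 3) :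
    coeff (lowPart N h) k j = lowSymbol N k * coeff h k j := by
  rw [lowPart, coeff_sub, coeff_genuinePart, lowSymbol_eq]
  push_cast; ring

/-- `h ↦ mode h k` is continuous on `L²`. -/
lemma continuous_mode (k : Fin 3 → ℤ) : Continuous fun h : L2Field => mode h k := by
  have hsub : ∀ g h, mode g k - mode h k = mode (g - h) k := fun g h => ext_coeff fun q j => by
    rw [coeff_sub, coeff_mode, coeff_mode, coeff_mode, coeff_sub]
    (split_ifs <;> try simp only [map_sub]) <;> ring
  refine (LipschitzWith.of_dist_le_mul (K := 1) fun g h => ?_).continuous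
  rw [dist_eq_norm, dist_eq_norm, hsub, NNReal.coe_one, one_mul]
  have h1 := norm_sq_sum_mode_le (a := fun _ => 1) (fun _ => rfl) (g - h) {k}
  simp only [Finset.sum_singleton, one_smul, one_pow, one_mul] at h1
  exact (sq_le_sq₀ (norm_nonneg _) (norm_nonneg _)).mp
    (h1.trans (le_hasSum (hasSum_energy _) k fun _ _ => energy_nonneg _ _))

lemma eigen_neg (k : Fin 3 → ℤ) : eigen (-k) = eigen k := by simp [eigen]

lemma eigen_nonneg (k : Fin 3 → ℤ) : 0 ≤ eigen k := by unfold eigen; positivity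

lemma sq_le_eigen (k : Fin 3 → ℤ) (i : Fin 3) : (k i : ℝ) ^ 2 ≤ eigen k := by
  have h1 : (k i : ℝ) ^ 2 ≤ ∑ i, (k i : ℝ) ^ 2 :=
    Finset.single_le_sum (f := fun i => (k i : ℝ) ^ 2) (fun _ _ => sq_nonneg _)
      (Finset.mem_univ i)
  have h2 : (1 : ℝ) ≤ 4 * Real.pi ^ 2 := by nlinarith [Real.pi_gt_three]
  unfold eigen
  nlinarith [sq_nonneg (k i : ℝ)]

lemma one_le_eigen {k : Fin 3 → ℤ} (hk : k ≠ 0) : 1 ≤ eigen k := by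
  obtain ⟨i, hi⟩ := Function.ne_iff.mp hk
  refine le_trans ?_ (sq_le_eigen k i)
  have : (1 : ℤ) ≤ (k i) ^ 2 := by
    have := sq_pos_of_ne_zero (show k i ≠ 0 from hi)
    omega
  exact_mod_cast this

/-- The wave numbers with all components of modulus at most `n`. -/
def freqBox (n : ℕ) : Finset (Fin 3 → ℤ) := Fintype.piFinset fun _ => Finset.Icc (-n : ℤ) n

lemma mem_freqBox {n : ℕ} {k : Fin 3 → ℤ} : k ∈ freqBox n ↔ ∀ i, |k i| ≤ n := by
  simp [freqBox, abs_le]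

lemma neg_mem_freqBox {n : ℕ} {k : Fin 3 → ℤ} : -k ∈ freqBox n ↔ k ∈ freqBox n := by
  simp [mem_freqBox]

lemma freqBox_mono : Monotone freqBox := fun m n hmn k hk => by
  rw [mem_freqBox] at hk ⊢
  exact fun i => (hk i).trans (by exact_mod_cast hmn)

lemma mem_freqBox_of_eigen_le {A : ℝ} {k : Fin 3 → ℤ} (hk : eigen k ≤ A) {n : ℕ}
    (hn : √A ≤ n) : k ∈ freqBox n := by
  rw [mem_freqBox]
  intro i
  have h1 : |(k i : ℝ)| ≤ √A := Real.abs_le_sqrt ((sq_le_eigen k i).trans hk)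
  exact_mod_cast h1.trans hn

lemma lowSymbol_ne_zero {N : ℝ} {k : Fin 3 → ℤ} :
    lowSymbol N k ≠ 0 ↔ ∃ i, |(k i : ℝ)| ≤ N := by
  unfold lowSymbol
  split_ifs with h
  · simpa using h
  · simpa using h

/-- The low wave numbers have two-dimensional counting. -/
lemma exists_card_low_le (N : ℝ) : ∃ C > 0, ∀ (A : ℝ) (F : Finset (Fin 3 → ℤ)), 0 < A →
    (∀ k ∈ F, lowSymbol N k ≠ 0 ∧ k ≠ 0 ∧ eigen k ≤ A) → (F.card : ℝ) ≤ C * A := by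
  refine ⟨27 * (2 * ⌊N⌋₊ + 1), by positivity, fun A F hA0 hF => ?_⟩
  rcases F.eq_empty_or_nonempty with rfl | ⟨k₀, hk₀⟩
  · simp only [Finset.card_empty, CharP.cast_eq_zero]; positivity
  have hA : 1 ≤ A := (one_le_eigen (hF k₀ hk₀).2.1).trans (hF k₀ hk₀).2.2
  set n := ⌊√A⌋₊ with hn
  have hn1 : 1 ≤ n := Nat.one_le_floor_iff _ |>.mpr (Real.one_le_sqrt.mpr hA)
  have hnA : (n : ℝ) ^ 2 ≤ A := by
    have h1 : (n : ℝ) ≤ √A := Nat.floor_le (Real.sqrt_nonneg A)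
    calc (n : ℝ) ^ 2 ≤ √A ^ 2 := by gcongr
      _ = A := Real.sq_sqrt (by linarith)
  let slab : Fin 3 → Finset (Fin 3 → ℤ) := fun i => Fintype.piFinset fun l =>
    if l = i then Finset.Icc (-⌊N⌋₊ : ℤ) ⌊N⌋₊ else Finset.Icc (-n : ℤ) n
  have hsub : F ⊆ Finset.univ.biUnion slab := by
    intro k hk
    obtain ⟨h1, -, h3⟩ := hF k hk
    obtain ⟨i, hi⟩ := lowSymbol_ne_zero.mp h1
    simp only [Finset.mem_biUnion, Finset.mem_univ, true_and]
    refine ⟨i, ?_⟩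
    simp only [slab, Fintype.mem_piFinset]
    intro l
    split_ifs with hl
    · subst hl
      rw [Finset.mem_Icc, ← abs_le, Int.abs_eq_natAbs]
      have : (k l).natAbs ≤ ⌊N⌋₊ := Nat.le_floor (by rwa [Nat.cast_natAbs, Int.cast_abs])
      exact_mod_cast this
    · rw [Finset.mem_Icc, ← abs_le, Int.abs_eq_natAbs]
      have : (k l).natAbs ≤ n := Nat.le_floor (by
        rw [Nat.cast_natAbs, Int.cast_abs]
        exact Real.abs_le_sqrt ((sq_le_eigen k l).trans h3))
      exact_mod_cast this
  have hcard : ∀ i, (slab i).card = (2 * ⌊N⌋₊ + 1) * (2 * n + 1) ^ 2 := by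
    intro i
    simp only [slab, Fintype.card_piFinset]
    have e : ∀ m : ℕ, (Finset.Icc (-m : ℤ) m).card = 2 * m + 1 := by
      intro m
      rw [Int.card_Icc]; omega
    have e2 : ∀ l, (if l = i then Finset.Icc (-⌊N⌋₊ : ℤ) ⌊N⌋₊ else Finset.Icc (-n : ℤ) n).card =
        if l = i then 2 * ⌊N⌋₊ + 1 else 2 * n + 1 := by
      intro l; split_ifs <;> exact e _
    simp only [e2, Fin.prod_univ_three]
    fin_cases i <;> simp <;> ring
  have h1 : F.card ≤ 3 * ((2 * ⌊N⌋₊ + 1) * (2 * n + 1) ^ 2) := by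
    refine (Finset.card_le_card hsub).trans (Finset.card_biUnion_le.trans ?_)
    simp [hcard]
  have h2 : (F.card : ℝ) ≤ 3 * ((2 * ⌊N⌋₊ + 1) * (2 * n + 1) ^ 2) := by exact_mod_cast h1
  have hn1' : (1 : ℝ) ≤ n := by exact_mod_cast hn1
  have h3 : (2 * (n : ℝ) + 1) ^ 2 ≤ 9 * A := by nlinarith
  calc (F.card : ℝ) ≤ 3 * ((2 * ⌊N⌋₊ + 1) * (2 * n + 1) ^ 2) := h2
    _ ≤ 3 * ((2 * ⌊N⌋₊ + 1) * (9 * A)) := by gcongr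
    _ = _ := by ring

lemma exists_sum_eigen_rpow_le (N : ℝ) {θ : ℝ} (hθ : 0 < θ) (hθ1 : θ < 1) :
    ∃ C > 0, ∀ (A : ℝ) (F : Finset (Fin 3 → ℤ)), 0 < A →
    (∀ k ∈ F, lowSymbol N k ≠ 0 ∧ k ≠ 0 ∧ eigen k ≤ A) →
      ∑ k ∈ F, eigen k ^ (-θ) ≤ C * A ^ (1 - θ) := by
  obtain ⟨C, hC, hcard⟩ := exists_card_low_le N
  set r : ℝ := (2 : ℝ)⁻¹ ^ (1 - θ) with hr
  have hr1 : r < 1 := Real.rpow_lt_one (by norm_num) (by norm_num) (by linarith)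
  have hr0 : 0 < r := by positivity
  refine ⟨2 * C / (1 - r), by have : 0 < 1 - r := by linarith
                              positivity, ?_⟩
  have key : ∀ (n : ℕ) (A : ℝ) (F : Finset (Fin 3 → ℤ)), 0 < A → A < 2 ^ n →
      (∀ k ∈ F, lowSymbol N k ≠ 0 ∧ k ≠ 0 ∧ eigen k ≤ A) →
      ∑ k ∈ F, eigen k ^ (-θ) ≤ 2 * C / (1 - r) * A ^ (1 - θ) := by
    intro n
    induction n with
    | zero =>
      intro A F hA0 hA hF
      have : F = ∅ := Finset.eq_empty_of_forall_notMem fun k hk => by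
        have h1 := one_le_eigen (hF k hk).2.1
        have h2 := (hF k hk).2.2
        simp at hA
        linarith
      subst this
      have : 0 < 1 - r := by linarith
      simp only [Finset.sum_empty]
      positivity
    | succ n ih =>
      intro A F hA0 hA hF
      rw [← Finset.sum_filter_add_sum_filter_not F (fun k => eigen k ≤ A / 2)]
      have h1 := ih (A / 2) (F.filter fun k => eigen k ≤ A / 2) (by linarith)
        (by rw [pow_succ] at hA; linarith) (fun k hk => by
          rw [Finset.mem_filter] at hk
          exact ⟨(hF k hk.1).1, (hF k hk.1).2.1, hk.2⟩)
      have h2 : ∑ k ∈ F with ¬ eigen k ≤ A / 2, eigen k ^ (-θ) ≤ 2 * C * A ^ (1 - θ) := by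
        calc ∑ k ∈ F with ¬ eigen k ≤ A / 2, eigen k ^ (-θ)
            ≤ ∑ k ∈ F with ¬ eigen k ≤ A / 2, (A / 2) ^ (-θ) := by
              refine Finset.sum_le_sum fun k hk => ?_
              rw [Finset.mem_filter, not_le] at hk
              exact Real.rpow_le_rpow_of_nonpos (by linarith) hk.2.le (by linarith)
          _ = (F.filter fun k => ¬ eigen k ≤ A / 2).card * (A / 2) ^ (-θ) := by
              rw [Finset.sum_const, nsmul_eq_mul]
          _ ≤ (C * A) * (A / 2) ^ (-θ) := by
              gcongr
              exact hcard A _ hA0 fun k hk => hF k (Finset.mem_filter.mp hk).1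
          _ = C * 2 ^ θ * A ^ (1 - θ) := by
              rw [Real.div_rpow hA0.le (by norm_num), Real.rpow_neg (by norm_num : (0:ℝ) ≤ 2),
                Real.rpow_sub hA0, Real.rpow_neg hA0.le, Real.rpow_one]
              have : (2 : ℝ) ^ θ ≠ 0 := by positivity
              have : A ^ θ ≠ 0 := by positivity
              field_simp
          _ ≤ C * 2 * A ^ (1 - θ) := by
              gcongr
              calc (2 : ℝ) ^ θ ≤ 2 ^ (1 : ℝ) :=
                    Real.rpow_le_rpow_of_exponent_le (by norm_num) hθ1.le
                _ = 2 := Real.rpow_one 2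
          _ = _ := by ring
      have h3 : (A / 2) ^ (1 - θ) = r * A ^ (1 - θ) := by
        rw [div_eq_inv_mul, Real.mul_rpow (by norm_num) hA0.le]
      rw [h3] at h1
      have hr' : 1 - r ≠ 0 := by linarith
      calc _ ≤ 2 * C / (1 - r) * (r * A ^ (1 - θ)) + 2 * C * A ^ (1 - θ) := add_le_add h1 h2
        _ = _ := by field_simp; ring
  intro A F hA0 hF
  obtain ⟨n, hn⟩ := pow_unbounded_of_one_lt A (by norm_num : (1 : ℝ) < 2)
  exact key n A F hA0 hn hF

/-- The Fourier partial sum of `g` over the finite set `S` of wave numbers. -/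
def partialSum (g : Torus3 → ℂ) (S : Finset (Fin 3 → ℤ)) : C(Torus3, ℂ) :=
  ∑ k ∈ S, mFourierCoeff g k • mFourier k

lemma partialSum_apply (g : Torus3 → ℂ) (S : Finset (Fin 3 → ℤ)) (x : Torus3) :
    partialSum g S x = ∑ k ∈ S, mFourierCoeff g k * mFourier k x := by
  simp [partialSum, ContinuousMap.sum_apply]

lemma norm_partialSum_le (g : Torus3 → ℂ) (S : Finset (Fin 3 → ℤ)) (x : Torus3) :
    ‖partialSum g S x‖ ≤ ∑ k ∈ S, ‖mFourierCoeff g k‖ := by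
  rw [partialSum_apply]
  refine (norm_sum_le _ _).trans (Finset.sum_le_sum fun k _ => ?_)
  rw [norm_mul]
  exact mul_le_of_le_one_right (norm_nonneg _)
    (((mFourier k).norm_coe_le_norm x).trans mFourier_norm.le)

lemma memLp_continuousMap (F : C(Torus3, ℂ)) (p : ℝ≥0∞) : MemLp F p torusMeasure :=
  MemLp.of_bound F.continuous.aestronglyMeasurable ‖F‖
    (Filter.Eventually.of_forall F.norm_coe_le_norm)

lemma integrable_mFourier_smul {g : Torus3 → ℂ} (hg : MemLp g 2 torusMeasure) (k : Fin 3 → ℤ) :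
    Integrable (fun x => mFourier (-k) x • g x) torusMeasure := by
  refine (hg.integrable (by norm_num)).bdd_smul 1
    (mFourier (-k)).continuous.aestronglyMeasurable ?_
  exact Filter.Eventually.of_forall fun x =>
    ((mFourier (-k)).norm_coe_le_norm x).trans mFourier_norm.le

lemma mFourierCoeff_partialSum (g : Torus3 → ℂ) (S : Finset (Fin 3 → ℤ)) (q : Fin 3 → ℤ) :
    mFourierCoeff (partialSum g S) q = if q ∈ S then mFourierCoeff g q else 0 := by
  have h1 : mFourierCoeff (partialSum g S) q =
      ∑ k ∈ S, mFourierCoeff g k * ∫ x, mFourier (-q) x * mFourier k x ∂torusMeasure := by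
    simp only [← integral_const_mul]
    rw [← integral_finsetSum _ fun k _ => (integrable_mFourier_mul q k).const_mul _]
    refine integral_congr_ae (Filter.Eventually.of_forall fun x => ?_)
    simp only [partialSum_apply, smul_eq_mul, Finset.mul_sum]
    exact Finset.sum_congr rfl fun k _ => by ring
  rw [h1]
  simp only [integral_mFourier_mul, mul_ite, mul_one, mul_zero, Finset.sum_ite_eq]

lemma mFourierCoeff_sub_partialSum {g : Torus3 → ℂ} (hg : MemLp g 2 torusMeasure)
    (S : Finset (Fin 3 → ℤ)) (q : Fin 3 → ℤ) :
    mFourierCoeff (fun x => g x - partialSum g S x) q =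
      if q ∈ S then 0 else mFourierCoeff g q := by
  have h1 : mFourierCoeff (fun x => g x - partialSum g S x) q =
      mFourierCoeff g q - mFourierCoeff (partialSum g S) q := by
    unfold mFourierCoeff
    refine Eq.trans ?_ (integral_sub (integrable_mFourier_smul hg q)
      (integrable_mFourier_smul (memLp_continuousMap (partialSum g S) 2) q))
    exact integral_congr_ae (Filter.Eventually.of_forall fun x => by simp [mul_sub])
  rw [h1, mFourierCoeff_partialSum]
  split_ifs <;> simp

/-- The distribution function of `g` above twice the size of a partial sum is controlled by the
remaining Fourier coefficients. -/
lemma measure_lt_norm_le {g : Torus3 → ℂ} (hg : MemLp g 2 torusMeasure)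
    (S : Finset (Fin 3 → ℤ)) {t : ℝ} (ht : 0 < t)
    (hS : ∑ k ∈ S, ‖mFourierCoeff g k‖ ≤ t / 2) :
    torusMeasure {x | t < ‖g x‖} ≤
      ∑' k, ENNReal.ofReal (if k ∈ S then 0 else 4 / t ^ 2 * ‖mFourierCoeff g k‖ ^ 2) := by
  set r : Torus3 → ℂ := fun x => g x - partialSum g S x with hr
  have hrm : MemLp r 2 torusMeasure := hg.sub (memLp_continuousMap _ 2)
  have hsum := hasSum_sq_mFourierCoeff_of_memLp hrm
  simp only [hr, mFourierCoeff_sub_partialSum hg] at hsum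
  have h1 : {x | t < ‖g x‖} ⊆ {x | ENNReal.ofReal (t ^ 2 / 4) ≤ ENNReal.ofReal (‖r x‖ ^ 2)} := by
    intro x hx
    have h2 : t / 2 ≤ ‖r x‖ := by
      have h3 := norm_partialSum_le g S x
      have h4 := norm_sub_norm_le (g x) (partialSum g S x)
      have h5 : t < ‖g x‖ := hx
      simp only [hr]
      linarith
    refine ENNReal.ofReal_le_ofReal ?_
    nlinarith
  have hI : Integrable (fun x => ‖r x‖ ^ 2) torusMeasure := hrm.integrable_norm_pow (by norm_num)
  have h2 := mul_meas_ge_le_lintegral₀ (μ := torusMeasure)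
    hI.aestronglyMeasurable.aemeasurable.ennreal_ofReal (ENNReal.ofReal (t ^ 2 / 4))
  rw [← ofReal_integral_eq_lintegral_ofReal hI
    (Filter.Eventually.of_forall fun x => by positivity)] at h2
  have h3 : ENNReal.ofReal (∫ x, ‖r x‖ ^ 2 ∂torusMeasure) =
      ∑' k, ENNReal.ofReal (‖if k ∈ S then 0 else mFourierCoeff g k‖ ^ 2) := by
    simp only [hr]
    rw [← hsum.tsum_eq, ENNReal.ofReal_tsum_of_nonneg (fun k => by positivity) hsum.summable]
  have hpos : 0 < t ^ 2 / 4 := by positivity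
  have h4 : torusMeasure {x | t < ‖g x‖} ≤
      ENNReal.ofReal (4 / t ^ 2) * ENNReal.ofReal (∫ x, ‖r x‖ ^ 2 ∂torusMeasure) := by
    calc torusMeasure {x | t < ‖g x‖}
        ≤ torusMeasure {x | ENNReal.ofReal (t ^ 2 / 4) ≤ ENNReal.ofReal (‖r x‖ ^ 2)} :=
          measure_mono h1
      _ = ENNReal.ofReal (4 / t ^ 2) * (ENNReal.ofReal (t ^ 2 / 4) * torusMeasure
            {x | ENNReal.ofReal (t ^ 2 / 4) ≤ ENNReal.ofReal (‖r x‖ ^ 2)}) := by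
          rw [← mul_assoc, ← ENNReal.ofReal_mul (by positivity)]
          have : 4 / t ^ 2 * (t ^ 2 / 4) = 1 := by field_simp
          rw [this, ENNReal.ofReal_one, one_mul]
      _ ≤ _ := by gcongr
  rw [h3, ← ENNReal.tsum_mul_left] at h4
  refine h4.trans (ENNReal.tsum_le_tsum fun k => ?_)
  rw [← ENNReal.ofReal_mul (by positivity)]
  split_ifs <;> simp

lemma sum_norm_le_sqrt (N : ℝ) {θ : ℝ} {C A B : ℝ} (hC : 0 ≤ C) (hA : 0 ≤ A) (hB : 0 ≤ B)
    {c : (Fin 3 → ℤ) → ℂ} (hc : ∀ k, c k ≠ 0 → lowSymbol N k ≠ 0 ∧ k ≠ 0)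
    (hsum : ∀ F : Finset (Fin 3 → ℤ), (∀ k ∈ F, lowSymbol N k ≠ 0 ∧ k ≠ 0 ∧ eigen k ≤ A) →
      ∑ k ∈ F, eigen k ^ (-θ) ≤ C * A ^ (1 - θ))
    (hcB : ∀ F : Finset (Fin 3 → ℤ), ∑ k ∈ F, eigen k ^ θ * ‖c k‖ ^ 2 ≤ B ^ 2)
    (S : Finset (Fin 3 → ℤ)) (hS : ∀ k ∈ S, eigen k ≤ A) :
    ∑ k ∈ S, ‖c k‖ ≤ √C * A ^ ((1 - θ) / 2) * B := by
  classical
  have h0 : ∑ k ∈ S, ‖c k‖ = ∑ k ∈ S with c k ≠ 0, ‖c k‖ := by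
    rw [Finset.sum_filter]
    exact Finset.sum_congr rfl fun k _ => by by_cases h : c k = 0 <;> simp [h]
  have hpos : ∀ k ∈ S.filter (fun k => c k ≠ 0), 0 < eigen k := fun k hk =>
    zero_lt_one.trans_le (one_le_eigen (hc k (Finset.mem_filter.mp hk).2).2)
  have h1 : ∑ k ∈ S with c k ≠ 0, ‖c k‖ =
      ∑ k ∈ S with c k ≠ 0, eigen k ^ (-θ / 2) * (eigen k ^ (θ / 2) * ‖c k‖) := by
    refine Finset.sum_congr rfl fun k hk => ?_
    rw [← mul_assoc, ← Real.rpow_add (hpos k hk)]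
    have : -θ / 2 + θ / 2 = 0 := by ring
    rw [this, Real.rpow_zero, one_mul]
  have h2 := Finset.sum_mul_sq_le_sq_mul_sq (S.filter fun k => c k ≠ 0)
    (fun k => eigen k ^ (-θ / 2)) (fun k => eigen k ^ (θ / 2) * ‖c k‖)
  have h3 : ∑ k ∈ S with c k ≠ 0, (eigen k ^ (-θ / 2)) ^ 2 ≤ C * A ^ (1 - θ) := by
    refine le_trans (le_of_eq ?_) (hsum (S.filter fun k => c k ≠ 0) fun k hk => ?_)
    · refine Finset.sum_congr rfl fun k hk => ?_
      rw [← Real.rpow_natCast, ← Real.rpow_mul (hpos k hk).le]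
      congr 1; push_cast; ring
    · rw [Finset.mem_filter] at hk
      exact ⟨(hc k hk.2).1, (hc k hk.2).2, hS k hk.1⟩
  have h4 : ∑ k ∈ S with c k ≠ 0, (eigen k ^ (θ / 2) * ‖c k‖) ^ 2 ≤ B ^ 2 := by
    refine le_trans (le_of_eq ?_) (hcB (S.filter fun k => c k ≠ 0))
    refine Finset.sum_congr rfl fun k hk => ?_
    rw [mul_pow, ← Real.rpow_natCast, ← Real.rpow_mul (hpos k hk).le]
    congr 2; push_cast; ring
  rw [h0, h1]
  refine (sq_le_sq₀ (Finset.sum_nonneg fun k hk => ?_) (by positivity)).mp ?_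
  · have := hpos k hk; positivity
  · refine h2.trans ((mul_le_mul h3 h4 (Finset.sum_nonneg fun k _ => sq_nonneg _)
      (by positivity)).trans (le_of_eq ?_))
    rw [mul_pow, mul_pow, Real.sq_sqrt hC, ← Real.rpow_natCast (A ^ _), ← Real.rpow_mul hA]
    congr 3; push_cast; ring

lemma lintegral_rpow_Ioo (q : ℝ) (hq : -1 < q) {R : ℝ} (hR : 0 ≤ R) :
    ∫⁻ t in Ioo 0 R, ENNReal.ofReal (t ^ q) = ENNReal.ofReal (R ^ (q + 1) / (q + 1)) := by
  have h1 := integral_rpow (a := 0) (b := R) (r := q) (Or.inl hq)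
  rw [Real.zero_rpow (by linarith), sub_zero, intervalIntegral.integral_of_le hR] at h1
  have h2 : IntegrableOn (fun t : ℝ => t ^ q) (Ioc 0 R) :=
    (intervalIntegrable_iff_integrableOn_Ioc_of_le hR).mp
      (intervalIntegral.intervalIntegrable_rpow' hq)
  rw [← h1, restrict_Ioo_eq_restrict_Ioc, ofReal_integral_eq_lintegral_ofReal h2]
  filter_upwards [ae_restrict_mem measurableSet_Ioc] with t ht
  exact Real.rpow_nonneg ht.1.le q

/-- Two-dimensional Sobolev embedding for functions with low spectrum. -/
lemma exists_lintegral_rpow_le (N : ℝ) {p : ℝ} (hp : 2 < p) :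
    ∃ C > 0, ∀ g : Torus3 → ℂ, MemLp g 2 torusMeasure →
      (∀ k, mFourierCoeff g k ≠ 0 → lowSymbol N k ≠ 0 ∧ k ≠ 0) → ∀ B > 0,
      (∀ F : Finset (Fin 3 → ℤ),
        ∑ k ∈ F, eigen k ^ (1 - 2 / p) * ‖mFourierCoeff g k‖ ^ 2 ≤ B ^ 2) →
      ∫⁻ x, ENNReal.ofReal (‖g x‖ ^ p) ∂torusMeasure ≤ ENNReal.ofReal (C * B ^ p) := by
  have hp0 : 0 < p := by linarith
  have h2p : 2 / p < 1 := (div_lt_one hp0).mpr hp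
  have h2p0 : 0 < 2 / p := by positivity
  obtain ⟨C, hC, hsum⟩ := exists_sum_eigen_rpow_le N (θ := 1 - 2 / p) (by linarith) (by linarith)
  set D : ℝ := 2 * √C with hD
  have hD0 : 0 < D := by positivity
  refine ⟨p * (4 * (D ^ (p - 2) / (p - 2))), by
    have : 0 < p - 2 := by linarith
    positivity, fun g hg hlow B hB hgB => ?_⟩
  set c := mFourierCoeff g with hc
  have hp2 : 0 < p - 2 := by linarith
  -- the pointwise bound of the distribution function
  have hdist : ∀ t > 0, torusMeasure {x | t < ‖g x‖} * ENNReal.ofReal (t ^ (p - 1)) ≤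
      ∑' k, ENNReal.ofReal (4 * ‖c k‖ ^ 2) *
        (Ioo 0 (D * B * eigen k ^ (1 / p))).indicator (fun t => ENNReal.ofReal (t ^ (p - 3))) t := by
    intro t ht
    classical
    set A : ℝ := (t / (D * B)) ^ p with hA
    have hA0 : 0 < A := by positivity
    set S : Finset (Fin 3 → ℤ) := (freqBox ⌈√A⌉₊).filter fun k => eigen k ≤ A with hSdef
    have hS : ∀ k, k ∈ S ↔ eigen k ≤ A := fun k => by
      simp only [hSdef, Finset.mem_filter, and_iff_right_iff_imp]
      exact fun h => mem_freqBox_of_eigen_le h (Nat.le_ceil _)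
    have h1 := sum_norm_le_sqrt N hC.le hA0.le hB.le hlow (fun F hF => hsum A F hA0 hF) hgB S
      fun k hk => (hS k).mp hk
    have h2 : √C * A ^ ((1 - (1 - 2 / p)) / 2) * B = t / 2 := by
      have e1 : (1 - (1 - 2 / p)) / 2 = p⁻¹ := by field_simp; ring
      rw [e1, hA, Real.rpow_rpow_inv (by positivity) hp0.ne', hD]
      have : √C ≠ 0 := by positivity
      field_simp
    rw [h2] at h1
    refine (mul_le_mul_left (measure_lt_norm_le hg S ht h1) _).trans ?_
    rw [← ENNReal.tsum_mul_right]
    refine ENNReal.tsum_le_tsum fun k => ?_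
    by_cases hk : k ∈ S
    · simp [hk]
    · rw [if_neg hk]
      rw [hS, not_le] at hk
      have hmem : t ∈ Ioo 0 (D * B * eigen k ^ (1 / p)) := by
        refine ⟨ht, ?_⟩
        have h3 : t / (D * B) < eigen k ^ (1 / p) := by
          have := Real.rpow_lt_rpow hA0.le hk (show 0 < 1 / p by positivity)
          rwa [hA, one_div, Real.rpow_rpow_inv (by positivity) hp0.ne', ← one_div] at this
        rw [div_lt_iff₀ (by positivity)] at h3
        linarith
      rw [indicator_of_mem hmem, ← ENNReal.ofReal_mul (by positivity),
        ← ENNReal.ofReal_mul (by positivity)]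
      refine ENNReal.ofReal_le_ofReal (le_of_eq ?_)
      have e2 : t ^ (p - 1) = t ^ (p - 3) * t ^ 2 := by
        rw [← Real.rpow_natCast t 2, ← Real.rpow_add ht]
        congr 1; push_cast; ring
      rw [e2, hc]
      field_simp
  rw [lintegral_rpow_eq_lintegral_meas_lt_mul _ (Filter.Eventually.of_forall fun x => norm_nonneg _)
    hg.aestronglyMeasurable.norm.aemeasurable hp0]
  have h1 : ∫⁻ t in Ioi 0, torusMeasure {x | t < ‖g x‖} * ENNReal.ofReal (t ^ (p - 1)) ≤
      ∑' k, ENNReal.ofReal (4 * ‖c k‖ ^ 2 * ((D * B * eigen k ^ (1 / p)) ^ (p - 2) / (p - 2))) := by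
    refine (setLIntegral_mono' measurableSet_Ioi fun t ht => hdist t ht).trans ?_
    rw [lintegral_tsum]
    · refine ENNReal.tsum_le_tsum fun k => ?_
      rw [lintegral_const_mul _ (Measurable.indicator (by fun_prop) measurableSet_Ioo),
        setLIntegral_indicator measurableSet_Ioo]
      have e3 : Ioo 0 (D * B * eigen k ^ (1 / p)) ∩ Ioi 0 = Ioo 0 (D * B * eigen k ^ (1 / p)) :=
        inter_eq_left.mpr fun x hx => hx.1
      have hR : 0 ≤ D * B * eigen k ^ (1 / p) := by
        have := eigen_nonneg k; positivity
      rw [e3, lintegral_rpow_Ioo _ (by linarith) hR, ← ENNReal.ofReal_mul (by positivity)]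
      have e4 : p - 3 + 1 = p - 2 := by ring
      rw [e4]
    · intro k
      exact (Measurable.const_mul (Measurable.indicator (by fun_prop) measurableSet_Ioo)
        _).aemeasurable
  have h2 : ∑' k, ENNReal.ofReal (4 * ‖c k‖ ^ 2 *
      ((D * B * eigen k ^ (1 / p)) ^ (p - 2) / (p - 2))) ≤
      ENNReal.ofReal (4 * (D ^ (p - 2) / (p - 2)) * B ^ p) := by
    refine ENNReal.summable.tsum_le_of_sum_le fun F => ?_
    have hnn : ∀ k ∈ F, 0 ≤ 4 * ‖c k‖ ^ 2 *
        ((D * B * eigen k ^ (1 / p)) ^ (p - 2) / (p - 2)) := fun k _ => by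
      have := eigen_nonneg k; positivity
    rw [← ENNReal.ofReal_sum_of_nonneg hnn]
    refine ENNReal.ofReal_le_ofReal ?_
    have e5 : ∀ k, 4 * ‖c k‖ ^ 2 * ((D * B * eigen k ^ (1 / p)) ^ (p - 2) / (p - 2)) =
        4 * (D ^ (p - 2) / (p - 2)) * B ^ (p - 2) * (eigen k ^ (1 - 2 / p) * ‖c k‖ ^ 2) := by
      intro k
      have h0 := eigen_nonneg k
      rw [Real.mul_rpow (by positivity) (by positivity), Real.mul_rpow hD0.le hB.le,
        ← Real.rpow_mul h0]
      have : 1 / p * (p - 2) = 1 - 2 / p := by field_simp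
      rw [this]
      ring
    rw [Finset.sum_congr rfl fun k _ => e5 k, ← Finset.mul_sum]
    calc _ ≤ 4 * (D ^ (p - 2) / (p - 2)) * B ^ (p - 2) * B ^ 2 := by
          gcongr
          exact hgB F
      _ = _ := by
          rw [mul_assoc, ← Real.rpow_natCast B 2, ← Real.rpow_add hB]
          congr 2; push_cast; ring
  refine (mul_le_mul_right (h1.trans h2) _).trans (le_of_eq ?_)
  rw [← ENNReal.ofReal_mul hp0.le]
  congr 1; ring

/-- Two-dimensional Sobolev embedding for functions with low spectrum, in terms of norms. -/
lemma exists_eLpNorm_le (N : ℝ) {p : ℝ} (hp : 2 < p) :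
    ∃ C > 0, ∀ g : Torus3 → ℂ, MemLp g 2 torusMeasure →
      (∀ k, mFourierCoeff g k ≠ 0 → lowSymbol N k ≠ 0 ∧ k ≠ 0) → ∀ B ≥ 0,
      (∀ F : Finset (Fin 3 → ℤ),
        ∑ k ∈ F, eigen k ^ (1 - 2 / p) * ‖mFourierCoeff g k‖ ^ 2 ≤ B ^ 2) →
      eLpNorm g (ENNReal.ofReal p) torusMeasure ≤ ENNReal.ofReal (C * B) := by
  have hp0 : 0 < p := by linarith
  obtain ⟨C, hC, h⟩ := exists_lintegral_rpow_le N hp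
  refine ⟨C ^ (1 / p), by positivity, fun g hg hlow B hB hgB => ?_⟩
  have key : ∀ B' > B, eLpNorm g (ENNReal.ofReal p) torusMeasure ≤
      ENNReal.ofReal (C ^ (1 / p) * B') := by
    intro B' hB'
    have hB'0 : 0 < B' := hB.trans_lt hB'
    have h1 := h g hg hlow B' hB'0 fun F => (hgB F).trans (by gcongr)
    rw [eLpNorm_eq_lintegral_rpow_enorm_toReal (by simpa using hp0) ENNReal.ofReal_ne_top,
      ENNReal.toReal_ofReal hp0.le]
    have e : ∀ x, ‖g x‖ₑ ^ p = ENNReal.ofReal (‖g x‖ ^ p) := fun x => by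
      rw [← ofReal_norm, ENNReal.ofReal_rpow_of_nonneg (norm_nonneg _) hp0.le]
    simp only [e]
    calc _ ≤ (ENNReal.ofReal (C * B' ^ p)) ^ (1 / p) := by gcongr
      _ = _ := by
        rw [ENNReal.ofReal_rpow_of_nonneg (by positivity) (by positivity),
          Real.mul_rpow hC.le (by positivity), one_div, Real.rpow_rpow_inv hB'0.le hp0.ne']
  have hlim : Filter.Tendsto (fun B' => ENNReal.ofReal (C ^ (1 / p) * B')) (nhdsWithin B (Ioi B))
      (nhds (ENNReal.ofReal (C ^ (1 / p) * B))) :=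
    ((ENNReal.continuous_ofReal.comp (continuous_const.mul continuous_id)).tendsto B).mono_left
      nhdsWithin_le_nhds
  refine ge_of_tendsto hlim ?_
  filter_upwards [self_mem_nhdsWithin] with B' hB'
  exact key B' hB'

lemma V.toL2_mem_H (u : V) : V.toL2 u ∈ H := (Subtype.prop u).1

lemma V.coeff_deriv (u : V) (i : Fin 3) (k : Fin 3 → ℤ) (j : Fin 3) :
    coeff (u.deriv i) k j = 2 * Real.pi * Complex.I * (k i : ℂ) * coeff (V.toL2 u) k j :=
  (Subtype.prop u).2 i k j

lemma V.norm_sq_eq (u : V) : ‖u‖ ^ 2 = ‖V.toL2 u‖ ^ 2 + ∑ i, ‖u.deriv i‖ ^ 2 := by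
  have h1 : ‖u‖ = ‖Subtype.val u‖ := rfl
  rw [h1, WithLp.prod_norm_sq_eq_of_L2, PiLp.norm_sq_eq_of_L2]
  rfl

lemma V.norm_toL2_le (u : V) : ‖V.toL2 u‖ ≤ ‖u‖ := by
  refine (sq_le_sq₀ (norm_nonneg _) (norm_nonneg _)).mp ?_
  rw [V.norm_sq_eq u]
  have : 0 ≤ ∑ i, ‖u.deriv i‖ ^ 2 := by positivity
  linarith

lemma V.norm_deriv_le (u : V) (i : Fin 3) : ‖u.deriv i‖ ≤ ‖u‖ := by
  refine (sq_le_sq₀ (norm_nonneg _) (norm_nonneg _)).mp ?_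
  rw [V.norm_sq_eq u]
  have : ‖u.deriv i‖ ^ 2 ≤ ∑ i, ‖u.deriv i‖ ^ 2 :=
    Finset.single_le_sum (f := fun i => ‖u.deriv i‖ ^ 2) (fun _ _ => by positivity)
      (Finset.mem_univ i)
  have : 0 ≤ ‖V.toL2 u‖ ^ 2 := by positivity
  linarith

lemma hasSum_stokesForm (u φ : V) :
    HasSum (fun k => eigen k * ∑ j, (conj (coeff (V.toL2 u) k j) * coeff (V.toL2 φ) k j).re)
      (stokesForm u φ) := by
  have h1 := hasSum_sum (s := Finset.univ) fun i _ => hasSum_inner (u.deriv i) (φ.deriv i)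
  refine h1.congr_fun fun k => ?_
  simp only [eigen, Finset.mul_sum, Finset.sum_mul]
  rw [Finset.sum_comm]
  refine Finset.sum_congr rfl fun i _ => Finset.sum_congr rfl fun j _ => ?_
  rw [V.coeff_deriv, V.coeff_deriv]
  simp only [map_mul, Complex.conj_I, Complex.conj_ofReal, map_ofNat, map_intCast]
  have : 2 * (Real.pi : ℂ) * -Complex.I * (k i : ℂ) * conj (coeff (V.toL2 u) k j) *
      (2 * Real.pi * Complex.I * (k i : ℂ) * coeff (V.toL2 φ) k j) =
      ((4 * Real.pi ^ 2 * (k i : ℝ) ^ 2 : ℝ) : ℂ) *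
        (conj (coeff (V.toL2 u) k j) * coeff (V.toL2 φ) k j) := by
    push_cast
    linear_combination (-4 * (Real.pi : ℂ) ^ 2 * (k i : ℂ) ^ 2 * conj (coeff (V.toL2 u) k j) *
      coeff (V.toL2 φ) k j) * Complex.I_sq
  rw [this, Complex.re_ofReal_mul]

lemma sum_re_conj_mul_smul (a : ℝ) (h : L2Field) (k : Fin 3 → ℤ) :
    ∑ j, (conj (coeff h k j) * ((a : ℂ) * coeff h k j)).re = a * energy h k := by
  rw [energy, Finset.mul_sum]
  refine Finset.sum_congr rfl fun j _ => ?_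
  rw [mul_left_comm, Complex.re_ofReal_mul, mul_comm (conj _), Complex.mul_conj,
    Complex.normSq_eq_norm_sq, Complex.ofReal_re]

lemma hasSum_eigen_mul_energy (u : V) :
    HasSum (fun k => eigen k * energy (V.toL2 u) k) (stokesForm u u) := by
  refine (hasSum_stokesForm u u).congr_fun fun k => ?_
  have := sum_re_conj_mul_smul 1 (V.toL2 u) k
  simp only [Complex.ofReal_one, one_mul] at this
  rw [this]

lemma stokesForm_self_le (u : V) : stokesForm u u ≤ ‖u‖ ^ 2 := by
  rw [V.norm_sq_eq u]
  have : stokesForm u u = ∑ i, ‖u.deriv i‖ ^ 2 :=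
    Finset.sum_congr rfl fun i _ => real_inner_self_eq_norm_sq _
  rw [this]
  have : 0 ≤ ‖V.toL2 u‖ ^ 2 := by positivity
  linarith

lemma sum_eigen_mul_energy_le (u : V) (F : Finset (Fin 3 → ℤ)) :
    ∑ k ∈ F, eigen k * energy (V.toL2 u) k ≤ ‖u‖ ^ 2 :=
  (sum_le_hasSum F (fun k _ => mul_nonneg (eigen_nonneg k) (energy_nonneg _ k))
    (hasSum_eigen_mul_energy u)).trans (stokesForm_self_le u)

lemma sum_energy_le (h : L2Field) (F : Finset (Fin 3 → ℤ)) :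
    ∑ k ∈ F, energy h k ≤ ‖h‖ ^ 2 :=
  sum_le_hasSum F (fun k _ => energy_nonneg _ k) (hasSum_energy h)

/-- The part of the `L²` norm carried by the wave numbers outside `freqBox n`. -/
def tailNorm (n : ℕ) (h : L2Field) : ℝ := √(‖h‖ ^ 2 - ∑ k ∈ freqBox n, energy h k)

lemma tailNorm_nonneg (n : ℕ) (h : L2Field) : 0 ≤ tailNorm n h := Real.sqrt_nonneg _

lemma sum_energy_le_tailNorm (n : ℕ) (h : L2Field) (F : Finset (Fin 3 → ℤ))
    (hF : Disjoint F (freqBox n)) : ∑ k ∈ F, energy h k ≤ tailNorm n h ^ 2 := by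
  have h1 := sum_energy_le h (freqBox n ∪ F)
  rw [Finset.sum_union hF.symm] at h1
  rw [tailNorm, Real.sq_sqrt]
  · linarith
  · linarith [sum_energy_le h (freqBox n)]

lemma tailNorm_le (n : ℕ) (h : L2Field) : tailNorm n h ≤ ‖h‖ := by
  refine Real.sqrt_le_iff.mpr ⟨norm_nonneg _, ?_⟩
  have : 0 ≤ ∑ k ∈ freqBox n, energy h k := Finset.sum_nonneg fun k _ => energy_nonneg h k
  linarith

lemma continuous_tailNorm (n : ℕ) : Continuous (tailNorm n) :=
  Real.continuous_sqrt.comp ((continuous_norm.pow 2).sub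
    (continuous_finsetSum _ fun k _ => continuous_energy k))

lemma tendsto_freqBox_atTop : Filter.Tendsto freqBox Filter.atTop Filter.atTop := by
  refine Filter.tendsto_atTop_finset_of_monotone freqBox_mono fun k => ?_
  refine ⟨(|k 0| + |k 1| + |k 2|).toNat, ?_⟩
  rw [mem_freqBox]
  intro i
  have h0 := abs_nonneg (k 0)
  have h1 := abs_nonneg (k 1)
  have h2 := abs_nonneg (k 2)
  rw [Int.toNat_of_nonneg (by positivity)]
  fin_cases i <;> simp <;> linarith

lemma tendsto_tailNorm (h : L2Field) :
    Filter.Tendsto (fun n => tailNorm n h) Filter.atTop (nhds 0) := by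
  have h1 := (hasSum_energy h).comp tendsto_freqBox_atTop
  have h2 := (Real.continuous_sqrt.tendsto _).comp (h1.const_sub (‖h‖ ^ 2))
  simpa [tailNorm, Function.comp_def] using h2

/-- Two-dimensional Sobolev embedding for the components of a low-spectrum multiplier of a field in
`H`. -/
lemma exists_eLpNorm_component_le (N : ℝ) {p : ℝ} (hp : 2 < p) :
    ∃ C > 0, ∀ h ∈ H, ∀ (a : (Fin 3 → ℤ) → ℝ) (g : L2Field),
      (∀ k j, coeff g k j = (a k : ℂ) * coeff h k j) → (∀ k, a k ≠ 0 → lowSymbol N k ≠ 0) →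
      ∀ B ≥ 0, (∀ F : Finset (Fin 3 → ℤ),
        ∑ k ∈ F, eigen k ^ (1 - 2 / p) * (a k ^ 2 * energy h k) ≤ B) →
      ∀ j, eLpNorm (fun x => g x j) (ENNReal.ofReal p) torusMeasure ≤ ENNReal.ofReal (C * √B) := by
  obtain ⟨C, hC, hS⟩ := exists_eLpNorm_le N hp
  refine ⟨C, hC, fun h hh a g hg ha B hB hF j => ?_⟩
  have h1 := hS (fun x => ((g x j : ℝ) : ℂ)) (memLp_component g j) (fun k hk => ?_) (√B)
    (Real.sqrt_nonneg B) fun F => ?_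
  · refine le_trans (le_of_eq (eLpNorm_congr_norm_ae ?_)) h1
    exact Filter.Eventually.of_forall fun x => by simp
  · have h2 : coeff g k j ≠ 0 := hk
    rw [hg] at h2
    refine ⟨ha k fun h0 => h2 (by simp [h0]), fun h0 => h2 ?_⟩
    subst h0
    rw [hh.1, mul_zero]
  · rw [Real.sq_sqrt hB]
    refine le_trans (Finset.sum_le_sum fun k _ => ?_) (hF F)
    refine mul_le_mul_of_nonneg_left ?_ (Real.rpow_nonneg (eigen_nonneg k) _)
    have h3 : energy g k = a k ^ 2 * energy h k := by
      rw [← sum_norm_sq_mul]; simp only [energy, hg]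
    rw [← h3]
    exact sq_norm_coeff_le_energy g k j

instance holderTriple_three_six_two : ENNReal.HolderTriple 3 6 2 where
  inv_add_inv_eq_inv := by
    rw [← ENNReal.toReal_eq_toReal_iff' (by simp) (by simp), ENNReal.toReal_add (by simp) (by simp)]
    simp only [ENNReal.toReal_inv, ENNReal.toReal_ofNat]; norm_num

instance holderTriple_four_four_two : ENNReal.HolderTriple 4 4 2 where
  inv_add_inv_eq_inv := by
    rw [← ENNReal.toReal_eq_toReal_iff' (by simp) (by simp), ENNReal.toReal_add (by simp) (by simp)]
    simp only [ENNReal.toReal_inv, ENNReal.toReal_ofNat]; norm_num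

/-- Hölder's inequality with exponents `p`, `2`, `q`. -/
lemma lintegral_enorm_mul_mul_le {α : Type*} [MeasurableSpace α] {μ : Measure α} {p q : ℝ≥0∞}
    [ENNReal.HolderTriple p q 2] {f g e : α → ℝ}
    (hf : AEStronglyMeasurable f μ) (hg : AEStronglyMeasurable g μ)
    (he : AEStronglyMeasurable e μ) :
    ∫⁻ x, ‖f x * g x * e x‖ₑ ∂μ ≤ eLpNorm f p μ * eLpNorm e q μ * eLpNorm g 2 μ := by
  have h1 : ∫⁻ x, ‖f x * g x * e x‖ₑ ∂μ = eLpNorm ((f • e) • g) 1 μ := by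
    rw [eLpNorm_one_eq_lintegral_enorm]
    refine lintegral_congr fun x => ?_
    simp only [Pi.smul_apply', smul_eq_mul, Pi.mul_apply]
    congr 1; ring
  rw [h1]
  refine (eLpNorm_smul_le_mul_eLpNorm (p := 2) (q := 2) hg (hf.smul he)).trans ?_
  gcongr
  exact eLpNorm_smul_le_mul_eLpNorm he hf

lemma aestronglyMeasurable_component (h : L2Field) (j : Fin 3) :
    AEStronglyMeasurable (fun x => h x j) torusMeasure :=
  ((EuclideanSpace.proj (𝕜 := ℝ) j).comp_memLp' (Lp.memLp h)).aestronglyMeasurable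

lemma eLpNorm_component_le (h : L2Field) (j : Fin 3) (p : ℝ≥0∞) :
    eLpNorm (fun x => h x j) p torusMeasure ≤ eLpNorm h p torusMeasure :=
  eLpNorm_mono fun x => by
    simpa using PiLp.norm_apply_le (h x) j

lemma eLpNorm_two_component_le (h : L2Field) (j : Fin 3) :
    eLpNorm (fun x => h x j) 2 torusMeasure ≤ ENNReal.ofReal ‖h‖ := by
  refine (eLpNorm_component_le h j 2).trans (le_of_eq ?_)
  rw [Lp.norm_def, ENNReal.ofReal_toReal (Lp.eLpNorm_ne_top h)]

/-- The weight `min(λ_k, Λ)^{1/3}`, which saturates at the level `Λ`. -/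
def weight (Λ : ℝ) (k : Fin 3 → ℤ) : ℝ := min (eigen k) Λ ^ (1 / 3 : ℝ)

/-- The indicator of `freqBox n`. -/
def boxSymbol (n : ℕ) (k : Fin 3 → ℤ) : ℝ := if k ∈ freqBox n then 1 else 0

/-- The symbol of the test field: the saturated weight on the low wave numbers in a box. -/
def testSymbol (N : ℝ) (n : ℕ) (Λ : ℝ) (k : Fin 3 → ℤ) : ℝ :=
  boxSymbol n k * (lowSymbol N k * weight Λ k)

lemma boxSymbol_neg (n : ℕ) (k : Fin 3 → ℤ) : boxSymbol n (-k) = boxSymbol n k := by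
  simp [boxSymbol, neg_mem_freqBox]

lemma weight_neg (Λ : ℝ) (k : Fin 3 → ℤ) : weight Λ (-k) = weight Λ k := by
  simp [weight, eigen_neg]

lemma weight_nonneg {Λ : ℝ} (hΛ : 0 < Λ) (k : Fin 3 → ℤ) : 0 ≤ weight Λ k :=
  Real.rpow_nonneg (le_min (eigen_nonneg k) hΛ.le) _

lemma weight_le_eigen {Λ : ℝ} (hΛ : 0 < Λ) (k : Fin 3 → ℤ) : weight Λ k ≤ eigen k ^ (1 / 3 : ℝ) :=
  Real.rpow_le_rpow (le_min (eigen_nonneg k) hΛ.le) (min_le_left _ _) (by norm_num)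

lemma weight_le {Λ : ℝ} (hΛ : 0 < Λ) (k : Fin 3 → ℤ) : weight Λ k ≤ Λ ^ (1 / 3 : ℝ) :=
  Real.rpow_le_rpow (le_min (eigen_nonneg k) hΛ.le) (min_le_right _ _) (by norm_num)

lemma weight_eq_of_le {Λ : ℝ} {k : Fin 3 → ℤ} (hk : eigen k ≤ Λ) :
    weight Λ k = eigen k ^ (1 / 3 : ℝ) := by rw [weight, min_eq_left hk]

lemma weight_eq_of_lt {Λ : ℝ} {k : Fin 3 → ℤ} (hk : Λ < eigen k) :
    weight Λ k = Λ ^ (1 / 3 : ℝ) := by rw [weight, min_eq_right hk.le]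

/-- The weighted energy `∑ m_k |c^k|²` over the low wave numbers in a box. -/
def lowEnergy (N : ℝ) (n : ℕ) (m : (Fin 3 → ℤ) → ℝ) (h : L2Field) : ℝ :=
  ∑ k ∈ freqBox n, lowSymbol N k * (m k * energy h k)

lemma lowEnergy_nonneg (N : ℝ) (n : ℕ) {m : (Fin 3 → ℤ) → ℝ} (hm : ∀ k, 0 ≤ m k) (h : L2Field) :
    0 ≤ lowEnergy N n m h :=
  Finset.sum_nonneg fun k _ => mul_nonneg (lowSymbol_nonneg N k)
    (mul_nonneg (hm k) (energy_nonneg h k))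

lemma sum_le_lowEnergy {N : ℝ} {n : ℕ} {m f : (Fin 3 → ℤ) → ℝ} (hm : ∀ k, 0 ≤ m k) {h : L2Field}
    (hf : ∀ k, f k ≤ boxSymbol n k * (lowSymbol N k * (m k * energy h k)))
    (F : Finset (Fin 3 → ℤ)) : ∑ k ∈ F, f k ≤ lowEnergy N n m h := by
  classical
  have hnn : ∀ k, 0 ≤ lowSymbol N k * (m k * energy h k) := fun k =>
    mul_nonneg (lowSymbol_nonneg N k) (mul_nonneg (hm k) (energy_nonneg h k))
  calc ∑ k ∈ F, f k ≤ ∑ k ∈ F, boxSymbol n k * (lowSymbol N k * (m k * energy h k)) :=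
        Finset.sum_le_sum fun k _ => hf k
    _ = ∑ k ∈ F with k ∈ freqBox n, lowSymbol N k * (m k * energy h k) := by
        rw [Finset.sum_filter]
        exact Finset.sum_congr rfl fun k _ => by simp [boxSymbol]
    _ ≤ _ := Finset.sum_le_sum_of_subset_of_nonneg (fun k hk => (Finset.mem_filter.mp hk).2)
        fun k _ _ => hnn k

/-- Cauchy–Schwarz interpolation between two weights. -/
lemma sum_sqrt_mul_le {ι : Type*} (F : Finset ι) {a b e : ι → ℝ} (ha : ∀ k, 0 ≤ a k)
    (hb : ∀ k, 0 ≤ b k) (he : ∀ k, 0 ≤ e k) :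
    ∑ k ∈ F, √(a k * b k) * e k ≤ √(∑ k ∈ F, a k * e k) * √(∑ k ∈ F, b k * e k) := by
  have h1 := Real.sum_sqrt_mul_sqrt_le F (f := fun k => a k * e k) (g := fun k => b k * e k)
    (fun k => mul_nonneg (ha k) (he k)) (fun k => mul_nonneg (hb k) (he k))
  refine le_trans (le_of_eq (Finset.sum_congr rfl fun k _ => ?_)) h1
  rw [← Real.sqrt_mul (mul_nonneg (ha k) (he k)), mul_mul_mul_comm,
    Real.sqrt_mul (mul_nonneg (ha k) (hb k)), Real.sqrt_mul_self (he k)]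

lemma eigen_rpow_half (k : Fin 3 → ℤ) : eigen k ^ (1 / 2 : ℝ) = √(eigen k) :=
  (Real.sqrt_eq_rpow _).symm

lemma sum_rpow_half_energy_le (u : V) (F : Finset (Fin 3 → ℤ)) :
    ∑ k ∈ F, eigen k ^ (1 / 2 : ℝ) * energy (V.toL2 u) k ≤
      √(∑ k ∈ F, energy (V.toL2 u) k) * ‖u‖ := by
  have h1 := sum_sqrt_mul_le F (a := fun _ => 1) (b := eigen) (fun _ => zero_le_one) eigen_nonneg
    (energy_nonneg (V.toL2 u))
  simp only [one_mul] at h1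
  simp only [eigen_rpow_half]
  refine h1.trans ?_
  gcongr
  exact Real.sqrt_le_iff.mpr ⟨norm_nonneg _, sum_eigen_mul_energy_le u F⟩

lemma lowEnergy_half_le (N : ℝ) (n : ℕ) {Λ : ℝ} (hΛ : 0 < Λ) (h : L2Field) :
    lowEnergy N n (fun k => eigen k ^ (1 / 2 : ℝ) * weight Λ k) h ≤
      √(lowEnergy N n (weight Λ) h) * √(lowEnergy N n (fun k => eigen k * weight Λ k) h) := by
  have h1 := sum_sqrt_mul_le (freqBox n) (a := weight Λ) (b := fun k => eigen k * weight Λ k)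
    (e := fun k => lowSymbol N k * energy h k) (weight_nonneg hΛ)
    (fun k => mul_nonneg (eigen_nonneg k) (weight_nonneg hΛ k))
    (fun k => mul_nonneg (lowSymbol_nonneg N k) (energy_nonneg h k))
  have e1 : ∀ k, √(weight Λ k * (eigen k * weight Λ k)) = eigen k ^ (1 / 2 : ℝ) * weight Λ k := by
    intro k
    rw [eigen_rpow_half, mul_left_comm, Real.sqrt_mul (eigen_nonneg k),
      Real.sqrt_mul_self (weight_nonneg hΛ k)]
  simp only [e1] at h1
  convert! h1 using 3 <;> exact Finset.sum_congr rfl fun k _ => by ring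

/-- Bound of the part of the convection term transported by one component. -/
lemma lintegral_four_terms_le {f₁ f₂ f₃ f₄ g e : Torus3 → ℝ}
    (h₁ : AEStronglyMeasurable f₁ torusMeasure) (h₂ : AEStronglyMeasurable f₂ torusMeasure)
    (h₃ : AEStronglyMeasurable f₃ torusMeasure) (h₄ : AEStronglyMeasurable f₄ torusMeasure)
    (hg : AEStronglyMeasurable g torusMeasure) (he : AEStronglyMeasurable e torusMeasure)
    {a₁ a₂ a₃ a₄ b₁ b₂ b₃ G : ℝ} (ha₁ : 0 ≤ a₁) (ha₂ : 0 ≤ a₂) (ha₃ : 0 ≤ a₃) (ha₄ : 0 ≤ a₄)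
    (hb₁ : 0 ≤ b₁) (hb₂ : 0 ≤ b₂) (hb₃ : 0 ≤ b₃)
    (i₁ : eLpNorm f₁ 3 torusMeasure ≤ ENNReal.ofReal a₁)
    (i₂ : eLpNorm f₂ 4 torusMeasure ≤ ENNReal.ofReal a₂)
    (i₃ : eLpNorm f₃ 4 torusMeasure ≤ ENNReal.ofReal a₃)
    (i₄ : eLpNorm f₄ 3 torusMeasure ≤ ENNReal.ofReal a₄)
    (j₁ : eLpNorm e 6 torusMeasure ≤ ENNReal.ofReal b₁)
    (j₂ : eLpNorm e 4 torusMeasure ≤ ENNReal.ofReal b₂)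
    (j₃ : eLpNorm e 4 torusMeasure ≤ ENNReal.ofReal b₃)
    (hG0 : 0 ≤ G) (hG : eLpNorm g 2 torusMeasure ≤ ENNReal.ofReal G) :
    |∫ x, (f₁ x + f₂ x + f₃ x + f₄ x) * g x * e x ∂torusMeasure| ≤
      (a₁ * b₁ + a₂ * b₂ + a₃ * b₃ + a₄ * b₁) * G := by
  have key : ∀ {p q : ℝ≥0∞} [ENNReal.HolderTriple p q 2] {f : Torus3 → ℝ} {a b : ℝ},
      AEStronglyMeasurable f torusMeasure → 0 ≤ a → 0 ≤ b →
      eLpNorm f p torusMeasure ≤ ENNReal.ofReal a → eLpNorm e q torusMeasure ≤ ENNReal.ofReal b →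
      ∫⁻ x, ‖f x * g x * e x‖ₑ ∂torusMeasure ≤ ENNReal.ofReal (a * b * G) := by
    intro p q _ f a b hf ha hb hfa heb
    refine (lintegral_enorm_mul_mul_le (p := p) (q := q) hf hg he).trans ?_
    rw [ENNReal.ofReal_mul (by positivity), ENNReal.ofReal_mul ha]
    gcongr
  have hm : ∀ {f : Torus3 → ℝ}, AEStronglyMeasurable f torusMeasure →
      AEMeasurable (fun x => ‖f x * g x * e x‖ₑ) torusMeasure := fun hf =>
    ((hf.mul hg).mul he).enorm
  have k₁ := key (p := 3) (q := 6) h₁ ha₁ hb₁ i₁ j₁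
  have k₂ := key (p := 4) (q := 4) h₂ ha₂ hb₂ i₂ j₂
  have k₃ := key (p := 4) (q := 4) h₃ ha₃ hb₃ i₃ j₃
  have k₄ := key (p := 3) (q := 6) h₄ ha₄ hb₁ i₄ j₁
  have h5 : ‖∫ x, (f₁ x + f₂ x + f₃ x + f₄ x) * g x * e x ∂torusMeasure‖ₑ ≤
      ENNReal.ofReal ((a₁ * b₁ + a₂ * b₂ + a₃ * b₃ + a₄ * b₁) * G) := by
    calc _ ≤ ∫⁻ x, ‖(f₁ x + f₂ x + f₃ x + f₄ x) * g x * e x‖ₑ ∂torusMeasure :=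
          enorm_integral_le_lintegral_enorm _
      _ ≤ ∫⁻ x, (‖f₁ x * g x * e x‖ₑ + ‖f₂ x * g x * e x‖ₑ + ‖f₃ x * g x * e x‖ₑ +
            ‖f₄ x * g x * e x‖ₑ) ∂torusMeasure := by
          refine lintegral_mono fun x => ?_
          simp only [add_mul]
          exact (enorm_add_le _ _).trans (add_le_add_left ((enorm_add_le _ _).trans
            (add_le_add_left (enorm_add_le _ _) _)) _)
      _ = ∫⁻ x, ‖f₁ x * g x * e x‖ₑ ∂torusMeasure + ∫⁻ x, ‖f₂ x * g x * e x‖ₑ ∂torusMeasure +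
            ∫⁻ x, ‖f₃ x * g x * e x‖ₑ ∂torusMeasure + ∫⁻ x, ‖f₄ x * g x * e x‖ₑ ∂torusMeasure := by
          rw [lintegral_add_right' _ (hm h₄), lintegral_add_right' _ (hm h₃),
            lintegral_add_right' _ (hm h₂)]
      _ ≤ ENNReal.ofReal (a₁ * b₁ * G) + ENNReal.ofReal (a₂ * b₂ * G) +
            ENNReal.ofReal (a₃ * b₃ * G) + ENNReal.ofReal (a₄ * b₁ * G) := by gcongr
      _ = _ := by
          rw [← ENNReal.ofReal_add (by positivity) (by positivity),
            ← ENNReal.ofReal_add (by positivity) (by positivity),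
            ← ENNReal.ofReal_add (by positivity) (by positivity)]
          congr 1; ring
  rw [← Real.norm_eq_abs, ← ENNReal.ofReal_le_ofReal_iff (by positivity), ofReal_norm]
  exact h5

lemma boxSymbol_eq_zero_or_one (n : ℕ) (k : Fin 3 → ℤ) : boxSymbol n k = 0 ∨ boxSymbol n k = 1 := by
  unfold boxSymbol; split_ifs <;> simp

lemma lowSymbol_eq_zero_or_one (N : ℝ) (k : Fin 3 → ℤ) : lowSymbol N k = 0 ∨ lowSymbol N k = 1 := by
  unfold lowSymbol; split_ifs <;> simp

/-- The symbol of the wave numbers below the saturation level. -/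
def belowSymbol (N : ℝ) (n : ℕ) (Λ : ℝ) (k : Fin 3 → ℤ) : ℝ :=
  boxSymbol n k * (lowSymbol N k * if eigen k ≤ Λ then 1 else 0)

/-- The symbol of the wave numbers above the saturation level. -/
def aboveSymbol (N : ℝ) (n : ℕ) (Λ : ℝ) (k : Fin 3 → ℤ) : ℝ :=
  boxSymbol n k * (lowSymbol N k * if eigen k ≤ Λ then 0 else 1)

/-- The symbol of the low wave numbers outside a box. -/
def tailSymbol (N : ℝ) (n : ℕ) (k : Fin 3 → ℤ) : ℝ := (1 - boxSymbol n k) * lowSymbol N k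

lemma sum_belowSymbol_le (N : ℝ) (n : ℕ) {Λ : ℝ} (hΛ : 0 < Λ) (h : L2Field)
    (F : Finset (Fin 3 → ℤ)) :
    ∑ k ∈ F, eigen k ^ (1 - 2 / 3 : ℝ) * (belowSymbol N n Λ k ^ 2 * energy h k) ≤
      lowEnergy N n (weight Λ) h := by
  refine sum_le_lowEnergy (weight_nonneg hΛ) (fun k => ?_) F
  have hw := weight_nonneg hΛ k
  have hE := energy_nonneg h k
  unfold belowSymbol
  rcases boxSymbol_eq_zero_or_one n k with hb | hb <;>
  rcases lowSymbol_eq_zero_or_one N k with hl | hl <;> rw [hb, hl]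
  · simp
  · simp
  · simp
  · split_ifs with hk
    · rw [weight_eq_of_le hk]; norm_num
    · simp only [mul_zero, one_mul]; norm_num; positivity

lemma sum_aboveSymbol_le (N : ℝ) (n : ℕ) {Λ : ℝ} (hΛ : 0 < Λ) (h : L2Field)
    (F : Finset (Fin 3 → ℤ)) :
    ∑ k ∈ F, eigen k ^ (1 - 2 / 4 : ℝ) * (aboveSymbol N n Λ k ^ 2 * energy h k) ≤
      (Λ ^ (1 / 3 : ℝ))⁻¹ * lowEnergy N n (fun k => eigen k ^ (1 / 2 : ℝ) * weight Λ k) h := by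
  have hL : 0 < Λ ^ (1 / 3 : ℝ) := by positivity
  have e : (1 - 2 / 4 : ℝ) = 1 / 2 := by norm_num
  rw [e, ← div_eq_inv_mul, le_div_iff₀ hL, Finset.sum_mul]
  refine sum_le_lowEnergy (fun k => mul_nonneg (Real.rpow_nonneg (eigen_nonneg k) _)
    (weight_nonneg hΛ k)) (fun k => ?_) F
  have hw := weight_nonneg hΛ k
  have hE := energy_nonneg h k
  have he : 0 ≤ eigen k ^ (1 / 2 : ℝ) := Real.rpow_nonneg (eigen_nonneg k) _
  unfold aboveSymbol
  rcases boxSymbol_eq_zero_or_one n k with hb | hb <;>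
  rcases lowSymbol_eq_zero_or_one N k with hl | hl <;> rw [hb, hl]
  · simp
  · simp
  · simp
  · split_ifs with hk
    · simp only [mul_zero, one_mul]
      rw [zero_pow two_ne_zero, zero_mul, mul_zero, zero_mul]; positivity
    · rw [weight_eq_of_lt (not_le.mp hk)]
      refine le_of_eq ?_
      ring

lemma sum_tailSymbol_le (N : ℝ) (n : ℕ) (u : V) (F : Finset (Fin 3 → ℤ)) :
    ∑ k ∈ F, eigen k ^ (1 - 2 / 4 : ℝ) * (tailSymbol N n k ^ 2 * energy (V.toL2 u) k) ≤
      tailNorm n (V.toL2 u) * ‖u‖ := by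
  classical
  have e : (1 - 2 / 4 : ℝ) = 1 / 2 := by norm_num
  rw [e]
  have h1 : ∑ k ∈ F, eigen k ^ (1 / 2 : ℝ) * (tailSymbol N n k ^ 2 * energy (V.toL2 u) k) ≤
      ∑ k ∈ F with k ∉ freqBox n, eigen k ^ (1 / 2 : ℝ) * energy (V.toL2 u) k := by
    rw [Finset.sum_filter]
    refine Finset.sum_le_sum fun k _ => ?_
    have hE := energy_nonneg (V.toL2 u) k
    have he : 0 ≤ eigen k ^ (1 / 2 : ℝ) := Real.rpow_nonneg (eigen_nonneg k) _
    unfold tailSymbol boxSymbol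
    rcases lowSymbol_eq_zero_or_one N k with hl | hl <;> rw [hl] <;> split_ifs <;> simp
    · exact mul_nonneg (Real.rpow_nonneg (eigen_nonneg k) _) hE
  refine h1.trans ((sum_rpow_half_energy_le u _).trans ?_)
  gcongr
  refine Real.sqrt_le_iff.mpr ⟨tailNorm_nonneg _ _, sum_energy_le_tailNorm n _ _ ?_⟩
  exact Finset.disjoint_left.mpr fun k hk => (Finset.mem_filter.mp hk).2

lemma sum_testSymbol_six_le (N : ℝ) (n : ℕ) {Λ : ℝ} (hΛ : 0 < Λ) (h : L2Field)
    (F : Finset (Fin 3 → ℤ)) :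
    ∑ k ∈ F, eigen k ^ (1 - 2 / 6 : ℝ) * (testSymbol N n Λ k ^ 2 * energy h k) ≤
      lowEnergy N n (fun k => eigen k * weight Λ k) h := by
  refine sum_le_lowEnergy (fun k => mul_nonneg (eigen_nonneg k) (weight_nonneg hΛ k))
    (fun k => ?_) F
  have hw := weight_nonneg hΛ k
  have hE := energy_nonneg h k
  unfold testSymbol
  rcases boxSymbol_eq_zero_or_one n k with hb | hb <;>
  rcases lowSymbol_eq_zero_or_one N k with hl | hl <;> rw [hb, hl]
  · simp
  · simp
  · simp
  · simp only [one_mul]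
    have h1 : eigen k ^ (1 - 2 / 6 : ℝ) * weight Λ k ≤ eigen k := by
      calc _ ≤ eigen k ^ (1 - 2 / 6 : ℝ) * eigen k ^ (1 / 3 : ℝ) :=
            mul_le_mul_of_nonneg_left (weight_le_eigen hΛ k)
              (Real.rpow_nonneg (eigen_nonneg k) _)
        _ = eigen k := by
            rw [← Real.rpow_add' (eigen_nonneg k) (by norm_num)]
            norm_num
    calc eigen k ^ (1 - 2 / 6 : ℝ) * (weight Λ k ^ 2 * energy h k) =
        (eigen k ^ (1 - 2 / 6 : ℝ) * weight Λ k) * (weight Λ k * energy h k) := by ring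
      _ ≤ eigen k * (weight Λ k * energy h k) := by gcongr
      _ = _ := by ring

lemma sum_testSymbol_four_le (N : ℝ) (n : ℕ) {Λ : ℝ} (hΛ : 0 < Λ) (h : L2Field)
    (F : Finset (Fin 3 → ℤ)) :
    ∑ k ∈ F, eigen k ^ (1 - 2 / 4 : ℝ) * (testSymbol N n Λ k ^ 2 * energy h k) ≤
      Λ ^ (1 / 3 : ℝ) * lowEnergy N n (fun k => eigen k ^ (1 / 2 : ℝ) * weight Λ k) h := by
  have hL : 0 < Λ ^ (1 / 3 : ℝ) := by positivity
  have e : (1 - 2 / 4 : ℝ) = 1 / 2 := by norm_num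
  rw [e, mul_comm (Λ ^ (1 / 3 : ℝ)), ← div_le_iff₀ hL, Finset.sum_div]
  refine sum_le_lowEnergy (fun k => mul_nonneg (Real.rpow_nonneg (eigen_nonneg k) _)
    (weight_nonneg hΛ k)) (fun k => ?_) F
  have hw := weight_nonneg hΛ k
  have hE := energy_nonneg h k
  have he : 0 ≤ eigen k ^ (1 / 2 : ℝ) := Real.rpow_nonneg (eigen_nonneg k) _
  unfold testSymbol
  rcases boxSymbol_eq_zero_or_one n k with hb | hb <;>
  rcases lowSymbol_eq_zero_or_one N k with hl | hl <;> rw [hb, hl]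
  · simp
  · simp
  · simp
  · simp only [one_mul]
    rw [div_le_iff₀ hL]
    calc eigen k ^ (1 / 2 : ℝ) * (weight Λ k ^ 2 * energy h k) =
        eigen k ^ (1 / 2 : ℝ) * weight Λ k * energy h k * weight Λ k := by ring
      _ ≤ eigen k ^ (1 / 2 : ℝ) * weight Λ k * energy h k * Λ ^ (1 / 3 : ℝ) :=
        mul_le_mul_of_nonneg_left (weight_le hΛ k) (by positivity)

lemma testSymbol_sq_le (N : ℝ) (n : ℕ) {Λ : ℝ} (hΛ : 0 < Λ) (k : Fin 3 → ℤ) :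
    testSymbol N n Λ k ^ 2 ≤ (Λ ^ (1 / 3 : ℝ)) ^ 2 := by
  have hw := weight_nonneg hΛ k
  have hw' := weight_le hΛ k
  unfold testSymbol
  rcases boxSymbol_eq_zero_or_one n k with hb | hb <;>
  rcases lowSymbol_eq_zero_or_one N k with hl | hl <;> rw [hb, hl]
  · simp; positivity
  · simp; positivity
  · simp; positivity
  · simp only [one_mul]
    gcongr

lemma sum_testSymbol_four_le' (N : ℝ) (n : ℕ) {Λ : ℝ} (hΛ : 0 < Λ) (u : V)
    (F : Finset (Fin 3 → ℤ)) :
    ∑ k ∈ F, eigen k ^ (1 - 2 / 4 : ℝ) * (testSymbol N n Λ k ^ 2 * energy (V.toL2 u) k) ≤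
      (Λ ^ (1 / 3 : ℝ)) ^ 2 * (‖V.toL2 u‖ * ‖u‖) := by
  have e : (1 - 2 / 4 : ℝ) = 1 / 2 := by norm_num
  rw [e]
  calc _ ≤ ∑ k ∈ F, (Λ ^ (1 / 3 : ℝ)) ^ 2 * (eigen k ^ (1 / 2 : ℝ) * energy (V.toL2 u) k) := by
        refine Finset.sum_le_sum fun k _ => ?_
        have hE := energy_nonneg (V.toL2 u) k
        have he : 0 ≤ eigen k ^ (1 / 2 : ℝ) := Real.rpow_nonneg (eigen_nonneg k) _
        rw [mul_left_comm]
        exact mul_le_mul_of_nonneg_right (testSymbol_sq_le N n hΛ k) (by positivity)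
    _ = (Λ ^ (1 / 3 : ℝ)) ^ 2 * ∑ k ∈ F, eigen k ^ (1 / 2 : ℝ) * energy (V.toL2 u) k :=
        (Finset.mul_sum _ _ _).symm
    _ ≤ _ := by
        gcongr
        refine (sum_rpow_half_energy_le u F).trans ?_
        gcongr
        exact Real.sqrt_le_iff.mpr ⟨norm_nonneg _, sum_energy_le _ F⟩

lemma coeff_multiplier_of_bounded {a : (Fin 3 → ℤ) → ℝ} {C : ℝ} (ha : ∀ k, a (-k) = a k)
    (hC : ∀ k, |a k| ≤ C) (h : L2Field) (k : Fin 3 → ℤ) (j : Fin 3) :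
    coeff (multiplier a h) k j = (a k : ℂ) * coeff h k j :=
  coeff_multiplier ha (summable_sq_mul_energy hC h) k j

lemma convection_constants_le {C₃ C₄ C₆ X Y Z T M : ℝ} (h₃ : 0 ≤ C₃) (h₄ : 0 ≤ C₄) (h₆ : 0 ≤ C₆)
    (hX : 0 ≤ X) (hY : 0 ≤ Y) (hT : 0 ≤ T) (hM : 0 ≤ M) (hZ : Z ≤ X * Y) :
    C₃ * X * (C₆ * Y) + C₄ * C₄ * Z + C₄ * C₄ * T + M * (C₆ * Y) ≤
      (C₃ * C₆ + C₄ * C₄ + C₆) * (X * Y + T + M * Y) := by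
  have s₁ : C₄ * C₄ * Z ≤ C₄ * C₄ * (X * Y) := by gcongr
  have s₂ : 0 ≤ C₃ * C₆ * (T + M * Y) := by positivity
  have s₃ : 0 ≤ C₄ * C₄ * (M * Y) := by positivity
  have s₄ : 0 ≤ C₆ * (X * Y + T) := by positivity
  linear_combination s₁ + s₂ + s₃ + s₄

set_option maxHeartbeats 1000000 in
/-- The convection term tested with the saturated low field. -/
lemma exists_trilinear_le (N : ℝ) : ∃ C > 0, ∀ (n : ℕ) (Λ M : ℝ) (u φ : V), 0 < Λ → 0 ≤ M →
    (∀ k j, coeff (V.toL2 φ) k j = (testSymbol N n Λ k : ℂ) * coeff (V.toL2 u) k j) →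
    eLpNorm (genuinePart N (V.toL2 u)) 3 torusMeasure ≤ ENNReal.ofReal M →
    |trilinear u u φ| ≤ C * ‖u‖ *
      (√(lowEnergy N n (weight Λ) (V.toL2 u)) *
          √(lowEnergy N n (fun k => eigen k * weight Λ k) (V.toL2 u)) +
        Λ ^ (1 / 3 : ℝ) * √(tailNorm n (V.toL2 u) * ‖V.toL2 u‖) * ‖u‖ +
        M * √(lowEnergy N n (fun k => eigen k * weight Λ k) (V.toL2 u))) := by
  obtain ⟨C₃, hC₃, S₃⟩ := exists_eLpNorm_component_le N (p := 3) (by norm_num)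
  obtain ⟨C₄, hC₄, S₄⟩ := exists_eLpNorm_component_le N (p := 4) (by norm_num)
  obtain ⟨C₆, hC₆, S₆⟩ := exists_eLpNorm_component_le N (p := 6) (by norm_num)
  simp only [ENNReal.ofReal_ofNat] at S₃ S₄ S₆
  refine ⟨9 * (C₃ * C₆ + C₄ * C₄ + C₆), by positivity, fun n Λ M u φ hΛ hM hφ hw => ?_⟩
  have huH := V.toL2_mem_H u
  set h := V.toL2 u with hh
  set X := √(lowEnergy N n (weight Λ) h) with hX
  set Y := √(lowEnergy N n (fun k => eigen k * weight Λ k) h) with hY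
  set Z := lowEnergy N n (fun k => eigen k ^ (1 / 2 : ℝ) * weight Λ k) h with hZ
  set L := Λ ^ (1 / 3 : ℝ) with hL
  set τ := tailNorm n h with hτ
  have hL0 : 0 < L := by positivity
  have hτ0 : 0 ≤ τ := tailNorm_nonneg n h
  have hZ0 : 0 ≤ Z := lowEnergy_nonneg N n (fun k => mul_nonneg
    (Real.rpow_nonneg (eigen_nonneg k) _) (weight_nonneg hΛ k)) h
  have hZXY : Z ≤ X * Y := lowEnergy_half_le N n hΛ h
  have ba : ∀ k, |belowSymbol N n Λ k| ≤ 1 := fun k => by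
    unfold belowSymbol
    rcases boxSymbol_eq_zero_or_one n k with hb | hb <;>
    rcases lowSymbol_eq_zero_or_one N k with hl | hl <;> rw [hb, hl] <;> split_ifs <;> simp
  have aa : ∀ k, |aboveSymbol N n Λ k| ≤ 1 := fun k => by
    unfold aboveSymbol
    rcases boxSymbol_eq_zero_or_one n k with hb | hb <;>
    rcases lowSymbol_eq_zero_or_one N k with hl | hl <;> rw [hb, hl] <;> split_ifs <;> simp
  have ta : ∀ k, |tailSymbol N n k| ≤ 1 := fun k => by
    unfold tailSymbol
    rcases boxSymbol_eq_zero_or_one n k with hb | hb <;>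
    rcases lowSymbol_eq_zero_or_one N k with hl | hl <;> rw [hb, hl] <;> simp
  have c₁ := coeff_multiplier_of_bounded (a := belowSymbol N n Λ) (fun k => by
    simp [belowSymbol, boxSymbol_neg, lowSymbol_neg, eigen_neg]) ba h
  have c₂ := coeff_multiplier_of_bounded (a := aboveSymbol N n Λ) (fun k => by
    simp [aboveSymbol, boxSymbol_neg, lowSymbol_neg, eigen_neg]) aa h
  have c₃ := coeff_multiplier_of_bounded (a := tailSymbol N n) (fun k => by
    simp [tailSymbol, boxSymbol_neg, lowSymbol_neg]) ta h
  set v₁ := multiplier (belowSymbol N n Λ) h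
  set v₂ := multiplier (aboveSymbol N n Λ) h
  set v₃ := multiplier (tailSymbol N n) h
  set w := genuinePart N h with hwdef
  have hsplit : h = v₁ + v₂ + v₃ + w := by
    refine ext_coeff fun k j => ?_
    rw [coeff_add, coeff_add, coeff_add, c₁, c₂, c₃, coeff_genuinePart, ← add_mul, ← add_mul,
      ← add_mul, ← Complex.ofReal_add, ← Complex.ofReal_add, ← Complex.ofReal_add]
    have : belowSymbol N n Λ k + aboveSymbol N n Λ k + tailSymbol N n k + genuineSymbol N k = 1 := by
      have := lowSymbol_eq N k
      unfold belowSymbol aboveSymbol tailSymbol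
      split_ifs <;> linear_combination this
    rw [this]; simp
  have hae : ∀ᵐ x ∂torusMeasure, ∀ i, h x i = v₁ x i + v₂ x i + v₃ x i + w x i := by
    have e0 : ∀ᵐ x ∂torusMeasure, h x = (v₁ + v₂ + v₃ + w : L2Field) x := by
      rw [← hsplit]; exact Filter.Eventually.of_forall fun _ => rfl
    filter_upwards [e0, Lp.coeFn_add (v₁ + v₂ + v₃) w, Lp.coeFn_add (v₁ + v₂) v₃,
      Lp.coeFn_add v₁ v₂] with x e0 e1 e2 e3 i
    rw [e0, e1, Pi.add_apply, e2, Pi.add_apply, e3]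
    simp
  have n₁ : ∀ i, eLpNorm (fun x => v₁ x i) 3 torusMeasure ≤ ENNReal.ofReal (C₃ * X) :=
    S₃ h huH _ v₁ c₁ (fun k hk h0 => hk (by simp [belowSymbol, h0])) _
      (lowEnergy_nonneg N n (weight_nonneg hΛ) h) (sum_belowSymbol_le N n hΛ h)
  have n₂ : ∀ i, eLpNorm (fun x => v₂ x i) 4 torusMeasure ≤ ENNReal.ofReal (C₄ * √(L⁻¹ * Z)) :=
    S₄ h huH _ v₂ c₂ (fun k hk h0 => hk (by simp [aboveSymbol, h0])) _ (by positivity)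
      (sum_aboveSymbol_le N n hΛ h)
  have n₃ : ∀ i, eLpNorm (fun x => v₃ x i) 4 torusMeasure ≤ ENNReal.ofReal (C₄ * √(τ * ‖u‖)) :=
    S₄ h huH _ v₃ c₃ (fun k hk h0 => hk (by simp [tailSymbol, h0])) _ (by positivity)
      (sum_tailSymbol_le N n u)
  have n₄ : ∀ i, eLpNorm (fun x => w x i) 3 torusMeasure ≤ ENNReal.ofReal M := fun i =>
    (eLpNorm_component_le w i 3).trans hw
  have hlow : ∀ k, testSymbol N n Λ k ≠ 0 → lowSymbol N k ≠ 0 := fun k hk h0 =>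
    hk (by simp [testSymbol, h0])
  have m₁ : ∀ j, eLpNorm (fun x => V.toL2 φ x j) 6 torusMeasure ≤ ENNReal.ofReal (C₆ * Y) :=
    S₆ h huH _ (V.toL2 φ) hφ hlow _ (lowEnergy_nonneg N n
      (fun k => mul_nonneg (eigen_nonneg k) (weight_nonneg hΛ k)) h)
      (sum_testSymbol_six_le N n hΛ h)
  have m₂ : ∀ j, eLpNorm (fun x => V.toL2 φ x j) 4 torusMeasure ≤ ENNReal.ofReal (C₄ * √(L * Z)) :=
    S₄ h huH _ (V.toL2 φ) hφ hlow _ (by positivity) (sum_testSymbol_four_le N n hΛ h)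
  have m₃ : ∀ j, eLpNorm (fun x => V.toL2 φ x j) 4 torusMeasure ≤
      ENNReal.ofReal (C₄ * √(L ^ 2 * (‖h‖ * ‖u‖))) :=
    S₄ h huH _ (V.toL2 φ) hφ hlow _ (by positivity) (sum_testSymbol_four_le' N n hΛ u)
  have hterm : ∀ i j, |∫ x, h x i * u.deriv i x j * V.toL2 φ x j ∂torusMeasure| ≤
      (C₃ * X * (C₆ * Y) + C₄ * √(L⁻¹ * Z) * (C₄ * √(L * Z)) +
        C₄ * √(τ * ‖u‖) * (C₄ * √(L ^ 2 * (‖h‖ * ‖u‖))) + M * (C₆ * Y)) * ‖u‖ := by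
    intro i j
    have e1 : ∫ x, h x i * u.deriv i x j * V.toL2 φ x j ∂torusMeasure =
        ∫ x, (v₁ x i + v₂ x i + v₃ x i + w x i) * u.deriv i x j * V.toL2 φ x j ∂torusMeasure := by
      refine integral_congr_ae ?_
      filter_upwards [hae] with x hx
      rw [hx i]
    rw [e1]
    exact lintegral_four_terms_le (aestronglyMeasurable_component v₁ i)
      (aestronglyMeasurable_component v₂ i) (aestronglyMeasurable_component v₃ i)
      (aestronglyMeasurable_component w i) (aestronglyMeasurable_component (u.deriv i) j)
      (aestronglyMeasurable_component (V.toL2 φ) j)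
      (by positivity) (by positivity) (by positivity) hM (by positivity) (by positivity)
      (by positivity) (n₁ i) (n₂ i) (n₃ i) (n₄ i) (m₁ j) (m₂ j) (m₃ j) (norm_nonneg u)
      ((eLpNorm_two_component_le (u.deriv i) j).trans
        (ENNReal.ofReal_le_ofReal (u.norm_deriv_le i)))
  have r₁ : √(L⁻¹ * Z) * √(L * Z) = Z := by
    rw [← Real.sqrt_mul (by positivity)]
    have : L⁻¹ * Z * (L * Z) = Z * Z := by field_simp
    rw [this, Real.sqrt_mul_self hZ0]
  have r₂ : √(τ * ‖u‖) * √(L ^ 2 * (‖h‖ * ‖u‖)) = L * √(τ * ‖h‖) * ‖u‖ := by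
    rw [← Real.sqrt_mul (by positivity)]
    have : τ * ‖u‖ * (L ^ 2 * (‖h‖ * ‖u‖)) = (L * ‖u‖) ^ 2 * (τ * ‖h‖) := by ring
    rw [this, Real.sqrt_mul (by positivity), Real.sqrt_sq (by positivity)]
    ring
  have hX0 : 0 ≤ X := Real.sqrt_nonneg _
  have hY0 : 0 ≤ Y := Real.sqrt_nonneg _
  set T := L * √(τ * ‖h‖) * ‖u‖ with hT
  have hT0 : 0 ≤ T := by positivity
  have hbound : ∀ i j, |∫ x, h x i * u.deriv i x j * V.toL2 φ x j ∂torusMeasure| ≤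
      (C₃ * C₆ + C₄ * C₄ + C₆) * (X * Y + T + M * Y) * ‖u‖ := by
    intro i j
    refine (hterm i j).trans (mul_le_mul_of_nonneg_right ?_ (norm_nonneg u))
    have q₁ : C₄ * √(L⁻¹ * Z) * (C₄ * √(L * Z)) = C₄ * C₄ * Z := by
      rw [mul_mul_mul_comm, r₁]
    have q₂ : C₄ * √(τ * ‖u‖) * (C₄ * √(L ^ 2 * (‖h‖ * ‖u‖))) = C₄ * C₄ * T := by
      rw [mul_mul_mul_comm, r₂]
    rw [q₁, q₂]
    exact convection_constants_le hC₃.le hC₄.le hC₆.le hX0 hY0 hT0 hM hZXY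
  unfold trilinear
  calc _ ≤ ∑ i, ∑ j, |∫ x, h x i * u.deriv i x j * V.toL2 φ x j ∂torusMeasure| :=
        (Finset.abs_sum_le_sum_abs _ _).trans
          (Finset.sum_le_sum fun i _ => Finset.abs_sum_le_sum_abs _ _)
    _ ≤ ∑ _i : Fin 3, ∑ _j : Fin 3, (C₃ * C₆ + C₄ * C₄ + C₆) * (X * Y + T + M * Y) * ‖u‖ :=
        Finset.sum_le_sum fun i _ => Finset.sum_le_sum fun j _ => hbound i j
    _ = _ := by
        simp only [Finset.sum_const, Finset.card_univ, Fintype.card_fin, nsmul_eq_mul]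
        push_cast; ring

lemma absolutelyContinuousOnInterval_lipschitz_comp {f g : ℝ → ℝ} {a b : ℝ} {K : NNReal}
    {s : Set ℝ} (hf : AbsolutelyContinuousOnInterval f a b) (hg : LipschitzOnWith K g s)
    (hs : MapsTo f (uIcc a b) s) : AbsolutelyContinuousOnInterval (fun x => g (f x)) a b := by
  rw [absolutelyContinuousOnInterval_iff] at hf ⊢
  intro ε hε
  obtain ⟨δ, hδ, h⟩ := hf (ε / (K + 1)) (by positivity)
  refine ⟨δ, hδ, fun E hE hE' => ?_⟩
  have h1 := h E hE hE'
  calc ∑ i ∈ Finset.range E.1, dist (g (f (E.2 i).1)) (g (f (E.2 i).2))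
      ≤ ∑ i ∈ Finset.range E.1, K * dist (f (E.2 i).1) (f (E.2 i).2) := by
        refine Finset.sum_le_sum fun i hi => ?_
        obtain ⟨m1, m2⟩ := hE.1 i hi
        exact hg.dist_le_mul _ (hs m1) _ (hs m2)
    _ = K * ∑ i ∈ Finset.range E.1, dist (f (E.2 i).1) (f (E.2 i).2) :=
        (Finset.mul_sum _ _ _).symm
    _ ≤ K * (ε / (K + 1)) := by gcongr
    _ < ε := by
        rw [mul_div_assoc', div_lt_iff₀ (by positivity)]
        nlinarith

lemma ae_deriv_integral_eq {g : ℝ → ℝ} {t : ℝ} (hg : IntervalIntegrable g volume 0 t) :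
    ∀ᵐ x, x ∈ uIcc 0 t → HasDerivAt (fun x => ∫ s in (0 : ℝ)..x, g s) (g x) x := by
  filter_upwards [hg.ae_hasDerivAt_integral] with x hx hx'
  exact hx hx' 0 left_mem_uIcc

/-- The square of a primitive. -/
lemma sq_primitive_eq {g : ℝ → ℝ} {c t : ℝ} (hg : IntervalIntegrable g volume 0 t) :
    (c + ∫ s in (0 : ℝ)..t, g s) ^ 2 =
      c ^ 2 + 2 * ∫ s in (0 : ℝ)..t, (c + ∫ r in (0 : ℝ)..s, g r) * g s := by
  have hac : AbsolutelyContinuousOnInterval (fun x => c + ∫ s in (0 : ℝ)..x, g s) 0 t := by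
    have h1 := hg.absolutelyContinuousOnInterval_intervalIntegral (c := 0) left_mem_uIcc
    exact absolutelyContinuousOnInterval_lipschitz_comp (K := 1) (g := fun x => c + x)
      (s := univ) h1 (LipschitzOnWith.of_dist_le_mul fun x _ y _ => by simp) (mapsTo_univ _ _)
  have h1 := hac.integral_deriv_mul_eq_sub hac
  have h2 : ∫ x in (0 : ℝ)..t, (deriv (fun x => c + ∫ s in (0 : ℝ)..x, g s) x *
      (c + ∫ s in (0 : ℝ)..x, g s) + (c + ∫ s in (0 : ℝ)..x, g s) *
        deriv (fun x => c + ∫ s in (0 : ℝ)..x, g s) x) =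
      ∫ x in (0 : ℝ)..t, 2 * ((c + ∫ r in (0 : ℝ)..x, g r) * g x) := by
    refine intervalIntegral.integral_congr_ae ?_
    filter_upwards [ae_deriv_integral_eq hg] with x hx hx'
    rw [((hx (uIoc_subset_uIcc hx')).const_add c).deriv]
    ring
  rw [h2, intervalIntegral.integral_const_mul] at h1
  simp only [intervalIntegral.integral_same, add_zero] at h1
  linear_combination -h1

/-- Grönwall's inequality in integral form with an integrable kernel. -/
lemma gronwall_of_integrable {a E : ℝ → ℝ} {B t : ℝ} (ht : 0 ≤ t)
    (ha : IntervalIntegrable a volume 0 t) (ha0 : ∀ s, 0 ≤ a s) (hE : ContinuousOn E (Icc 0 t))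
    (h : ∀ s ∈ Icc 0 t, E s ≤ B + ∫ r in (0 : ℝ)..s, a r * E r) :
    E t ≤ B * Real.exp (∫ s in (0 : ℝ)..t, a s) := by
  have huIcc : uIcc 0 t = Icc 0 t := uIcc_of_le ht
  have haE : IntervalIntegrable (fun s => a s * E s) volume 0 t :=
    ha.mul_continuousOn (huIcc ▸ hE)
  set A : ℝ → ℝ := fun x => ∫ s in (0 : ℝ)..x, a s with hA
  set P : ℝ → ℝ := fun x => B + ∫ s in (0 : ℝ)..x, a s * E s with hP
  have hAac := ha.absolutelyContinuousOnInterval_intervalIntegral (c := 0) left_mem_uIcc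
  have hA0 : MapsTo A (uIcc 0 t) (Ici 0) := fun x hx => by
    rw [huIcc] at hx
    exact intervalIntegral.integral_nonneg hx.1 fun s _ => ha0 s
  have hQac : AbsolutelyContinuousOnInterval (fun x => Real.exp (-A x)) 0 t := by
    refine absolutelyContinuousOnInterval_lipschitz_comp (K := 1) (g := fun x => Real.exp (-x))
      hAac ?_ hA0
    refine Convex.lipschitzOnWith_of_nnnorm_hasDerivWithin_le (f' := fun x => -Real.exp (-x))
      (convex_Ici 0) (fun x _ => ?_) fun x hx => ?_
    · have := ((hasDerivAt_id x).neg.exp).hasDerivWithinAt (s := Ici 0)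
      simpa using this
    · rw [← NNReal.coe_le_coe, coe_nnnorm, norm_neg, Real.norm_eq_abs, Real.abs_exp,
        NNReal.coe_one, Real.exp_le_one_iff]
      simpa using hx
  have hPac : AbsolutelyContinuousOnInterval P 0 t :=
    absolutelyContinuousOnInterval_lipschitz_comp (K := 1) (g := fun x => B + x) (s := univ)
      (haE.absolutelyContinuousOnInterval_intervalIntegral (c := 0) left_mem_uIcc)
      (LipschitzOnWith.of_dist_le_mul fun x _ y _ => by simp) (mapsTo_univ _ _)
  have h1 := hQac.integral_deriv_mul_eq_sub hPac
  have h2 : ∫ x in (0 : ℝ)..t, (deriv (fun x => Real.exp (-A x)) x * P x +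
      Real.exp (-A x) * deriv P x) ≤ 0 := by
    rw [intervalIntegral.integral_of_le ht]
    refine integral_nonpos_of_ae ((ae_restrict_iff' measurableSet_Ioc).mpr ?_)
    filter_upwards [ae_deriv_integral_eq ha, ae_deriv_integral_eq haE] with x hx1 hx2 hx'
    have hx : x ∈ Icc 0 t := Ioc_subset_Icc_self hx'
    have d1 : deriv (fun x => Real.exp (-A x)) x = Real.exp (-A x) * -a x :=
      (hx1 (huIcc ▸ hx)).fun_neg.exp.deriv
    have d2 : deriv P x = a x * E x := ((hx2 (huIcc ▸ hx)).const_add B).deriv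
    rw [d1, d2, Pi.zero_apply]
    have h5 := mul_nonneg (mul_nonneg (Real.exp_pos (-A x)).le (ha0 x))
      (sub_nonneg.mpr (show E x ≤ P x from h x hx))
    linear_combination h5
  rw [h1] at h2
  have h3 : Real.exp (-A t) * P t ≤ B := by
    have e1 : A 0 = 0 := intervalIntegral.integral_same
    have e2 : P 0 = B := by simp [hP]
    rw [e1, e2, neg_zero, Real.exp_zero, one_mul] at h2
    linarith
  calc E t ≤ P t := h t (right_mem_Icc.mpr ht)
    _ = Real.exp (-A t) * P t * Real.exp (A t) := by
        rw [mul_right_comm, ← Real.exp_add, neg_add_cancel, Real.exp_zero, one_mul]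
    _ ≤ B * Real.exp (A t) := by gcongr

lemma exists_V_of_mem_H {h : L2Field} (hh : h ∈ H)
    (hs : Summable fun k => eigen k * energy h k) : ∃ φ : V, V.toL2 φ = h := by
  have hc : ∀ i k j, coeff (fieldOf fun k j => 2 * Real.pi * Complex.I * (k i : ℂ) * coeff h k j) k j
      = 2 * Real.pi * Complex.I * (k i : ℂ) * coeff h k j := by
    intro i k j
    refine coeff_fieldOf (c := fun k j => 2 * Real.pi * Complex.I * (k i : ℂ) * coeff h k j)
      (fun k j => ?_) ?_ k j
    · simp only [coeff_neg_freq, Pi.neg_apply, Int.cast_neg, map_mul, Complex.conj_I,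
        Complex.conj_ofReal, map_ofNat, map_intCast]
      ring
    · refine hs.of_nonneg_of_le (fun k => by positivity) fun k => ?_
      have e1 : ∑ j, ‖2 * (Real.pi : ℂ) * Complex.I * (k i : ℂ) * coeff h k j‖ ^ 2 =
          4 * Real.pi ^ 2 * (k i : ℝ) ^ 2 * energy h k := by
        rw [energy, Finset.mul_sum]
        refine Finset.sum_congr rfl fun j _ => ?_
        simp only [norm_mul, Complex.norm_I, mul_one, Complex.norm_ofNat, Complex.norm_real,
          Real.norm_eq_abs, mul_pow, sq_abs, Complex.norm_intCast]
        ring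
      rw [e1]
      refine mul_le_mul_of_nonneg_right ?_ (energy_nonneg h k)
      unfold eigen
      gcongr
      exact Finset.single_le_sum (f := fun i => (k i : ℝ) ^ 2) (fun _ _ => sq_nonneg _)
        (Finset.mem_univ i)
  exact ⟨(⟨WithLp.toLp 2 (h, WithLp.toLp 2 fun i =>
    fieldOf fun k j => 2 * Real.pi * Complex.I * (k i : ℂ) * coeff h k j), hh, hc⟩ : sobolevH1), rfl⟩

/-- The matrix of the Leray projection at the wave number `k`. -/
def leray (k : Fin 3 → ℤ) (j l : Fin 3) : ℝ :=
  (if j = l then 1 else 0) - k j * k l / ∑ i, (k i : ℝ) ^ 2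

lemma sum_sq_ne_zero {k : Fin 3 → ℤ} (hk : k ≠ 0) : ∑ i, (k i : ℝ) ^ 2 ≠ 0 := by
  have := one_le_eigen hk
  intro h0
  rw [eigen, h0] at this
  norm_num at this

lemma leray_neg (k : Fin 3 → ℤ) (j l : Fin 3) : leray (-k) j l = leray k j l := by
  simp [leray]

lemma leray_symm (k : Fin 3 → ℤ) (j l : Fin 3) : leray k j l = leray k l j := by
  simp [leray, eq_comm, mul_comm]

lemma sum_mul_leray {k : Fin 3 → ℤ} (hk : k ≠ 0) (j : Fin 3) :
    ∑ l, (k l : ℂ) * (leray k j l : ℂ) = 0 := by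
  have h0 := sum_sq_ne_zero hk
  have : ∑ l, (k l : ℝ) * leray k j l = 0 := by
    simp only [leray, mul_sub, Finset.sum_sub_distrib, mul_ite, mul_one, mul_zero,
      Finset.sum_ite_eq, Finset.mem_univ, if_true]
    have : ∑ l, (k l : ℝ) * (k j * k l / ∑ i, (k i : ℝ) ^ 2) =
        k j * (∑ l, (k l : ℝ) ^ 2) / ∑ i, (k i : ℝ) ^ 2 := by
      rw [Finset.mul_sum, Finset.sum_div]
      exact Finset.sum_congr rfl fun l _ => by ring
    rw [this, mul_div_assoc, div_self h0, mul_one, sub_self]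
  exact_mod_cast congrArg ((↑) : ℝ → ℂ) this

lemma sum_leray_mul {k : Fin 3 → ℤ} {c : Fin 3 → ℂ} (hc : ∑ l, (k l : ℂ) * c l = 0) (j : Fin 3) :
    ∑ l, (leray k j l : ℂ) * c l = c j := by
  have h1 : ∀ l, (leray k j l : ℂ) * c l =
      (if j = l then c l else 0) - (k j : ℂ) / (∑ i, (k i : ℂ) ^ 2) * ((k l : ℂ) * c l) := by
    intro l
    rw [leray]
    split_ifs <;> push_cast <;> ring
  simp only [h1, Finset.sum_sub_distrib, ← Finset.mul_sum, hc, mul_zero, sub_zero,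
    Finset.sum_ite_eq, Finset.mem_univ, if_true]

/-- Fourier coefficients of the Leray projection of `x ↦ Re(α e^{2π i k·x}) e_j`. -/
def testCoeff (k : Fin 3 → ℤ) (j : Fin 3) (α : ℂ) (q : Fin 3 → ℤ) (l : Fin 3) : ℂ :=
  2⁻¹ * ((leray k j l : ℂ) * ((if q = k then α else 0) + (if -q = k then conj α else 0)))

lemma exists_testField {k : Fin 3 → ℤ} (hk : k ≠ 0) (j : Fin 3) (α : ℂ) :
    ∃ φ : V, ∀ q l, coeff (V.toL2 φ) q l = testCoeff k j α q l := by
  classical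
  have hsupp : ∀ q ∉ ({k, -k} : Finset (Fin 3 → ℤ)), ∀ l, testCoeff k j α q l = 0 := by
    intro q hq l
    simp only [Finset.mem_insert, Finset.mem_singleton, not_or] at hq
    have h2 : ¬ -q = k := fun h => hq.2 (by rw [← h, neg_neg])
    simp [testCoeff, hq.1, h2]
  have hc := coeff_fieldOf (c := testCoeff k j α) (fun q l => by
    simp only [testCoeff, neg_neg, map_mul, map_add, Complex.conj_ofReal, map_inv₀, map_ofNat,
      apply_ite (conj : ℂ → ℂ), map_zero, Complex.conj_conj]
    ring) (summable_of_ne_finset_zero (s := {k, -k}) fun q hq => by simp [hsupp q hq])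
  have hH : fieldOf (testCoeff k j α) ∈ H := by
    refine ⟨fun l => ?_, fun q => ?_⟩
    · have h1 : ¬ (0 : Fin 3 → ℤ) = k := fun h => hk h.symm
      rw [hc]; simp [testCoeff, h1]
    · simp only [hc]
      have e : ∀ (a : ℂ), ∑ l, (q l : ℂ) * (2⁻¹ * ((leray k j l : ℂ) * a)) =
          2⁻¹ * a * ∑ l, (q l : ℂ) * (leray k j l : ℂ) := fun a => by
        rw [Finset.mul_sum]; exact Finset.sum_congr rfl fun l _ => by ring
      simp only [testCoeff, e]
      by_cases h1 : q = k
      · rw [h1, sum_mul_leray hk, mul_zero]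
      by_cases h2 : -q = k
      · have := sum_mul_leray hk j
        rw [← h2] at this
        simp only [Pi.neg_apply, Int.cast_neg, neg_mul, Finset.sum_neg_distrib, neg_eq_zero,
          leray_neg] at this
        rw [← h2]
        simp only [leray_neg, this, mul_zero]
      · simp [h1, h2]
  obtain ⟨φ, hφ⟩ := exists_V_of_mem_H hH
    (summable_of_ne_finset_zero (s := {k, -k}) fun q hq => by simp [energy, hc, hsupp q hq])
  exact ⟨φ, fun q l => by rw [hφ, hc]⟩

/-- The divergence-free trigonometric test field at the wave number `k`. -/
def testField (k : Fin 3 → ℤ) (j : Fin 3) (α : ℂ) : V :=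
  open Classical in if hk : k ≠ 0 then (exists_testField hk j α).choose else 0

lemma coeff_testField {k : Fin 3 → ℤ} (hk : k ≠ 0) (j : Fin 3) (α : ℂ) (q : Fin 3 → ℤ)
    (l : Fin 3) : coeff (V.toL2 (testField k j α)) q l = testCoeff k j α q l := by
  rw [testField, dif_pos hk]
  exact (exists_testField hk j α).choose_spec q l

lemma testField_zero (j : Fin 3) (α : ℂ) : testField 0 j α = 0 := by
  simp [testField]

/-- Testing a field in `H` with the trigonometric fields gives its Fourier coefficients. -/
lemma inner_testField {h : L2Field} (hh : h ∈ H) (k : Fin 3 → ℤ) (j : Fin 3) (α : ℂ) :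
    inner ℝ h (V.toL2 (testField k j α)) = (conj α * coeff h k j).re := by
  by_cases hk : k = 0
  · subst hk
    rw [testField_zero, map_zero, inner_zero_right, hh.1, mul_zero, Complex.zero_re]
  refine (hasSum_inner h _).unique ?_
  set b : ℝ := (conj α * coeff h k j).re with hb
  have h1 := ((hasSum_ite_eq k b).add (hasSum_ite_eq (-k) b)).mul_left (2⁻¹ : ℝ)
  have e : 2⁻¹ * (b + b) = b := by ring
  rw [e] at h1
  refine h1.congr_fun fun q => ?_
  simp only [coeff_testField hk]
  have key : ∀ β : ℂ, ∑ l, (conj (coeff h q l) * (2⁻¹ * ((leray q j l : ℂ) * β))).re =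
      2⁻¹ * (conj β * coeff h q j).re := by
    intro β
    rw [← Complex.re_sum]
    have e2 : ∑ l, conj (coeff h q l) * (2⁻¹ * ((leray q j l : ℂ) * β)) =
        ((2⁻¹ : ℝ) : ℂ) * (β * conj (∑ l, (leray q j l : ℂ) * coeff h q l)) := by
      rw [map_sum, Finset.mul_sum, Finset.mul_sum]
      refine Finset.sum_congr rfl fun l _ => ?_
      simp only [map_mul, Complex.conj_ofReal]
      push_cast
      ring
    rw [e2, sum_leray_mul (hh.2 q), Complex.re_ofReal_mul, ← Complex.conj_re]
    simp
  by_cases h1 : q = k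
  · subst h1
    have h2 : ¬ -q = q := fun h => hk (by
      funext i; have := congrFun h i; simp only [Pi.neg_apply] at this
      simp only [Pi.zero_apply]; omega)
    have h3 : ¬ q = -q := fun h => h2 h.symm
    simp only [testCoeff, if_true, h2, h3, if_false, add_zero, key, hb]
  · by_cases h2 : -q = k
    · have h3 : q = -k := by rw [← h2, neg_neg]
      have h4 : leray k = leray q := by
        funext j l; rw [← h2, leray_neg]
      simp only [testCoeff, h1, h2, if_true, if_false, zero_add, h4, key, Complex.conj_conj]
      rw [if_pos h3, hb, h3, coeff_neg_freq, ← Complex.conj_re]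
      simp
    · have h3 : ¬ q = -k := fun h => h2 (by rw [h, neg_neg])
      simp [testCoeff, h1, h2, h3]

/-- The two directions in `ℂ` used to test real and imaginary parts. -/
def direction (b : Bool) : ℂ := if b then 1 else Complex.I

lemma sum_direction (z : ℂ) :
    ∑ b, (((conj (direction b) * z).re : ℝ) : ℂ) * direction b = z := by
  have := Complex.re_add_im z
  simp [direction, this]

lemma sum_direction_sq (z : ℂ) : ∑ b, (conj (direction b) * z).re ^ 2 = ‖z‖ ^ 2 := by
  rw [← Complex.normSq_eq_norm_sq, Complex.normSq_apply]
  simp [direction]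
  ring

lemma sum_inner_testField_sq {h : L2Field} (hh : h ∈ H) (k : Fin 3 → ℤ) :
    ∑ j, ∑ b, inner ℝ h (V.toL2 (testField k j (direction b))) ^ 2 = energy h k := by
  simp only [inner_testField hh, sum_direction_sq]
  rfl

/-- A mode of a field in `H` is reconstructed from the trigonometric test fields. -/
lemma sum_inner_smul_testField {h : L2Field} (hh : h ∈ H) (k : Fin 3 → ℤ) :
    ∑ j, ∑ b, inner ℝ h (V.toL2 (testField k j (direction b))) •
      V.toL2 (testField k j (direction b)) = mode h k := by
  by_cases hk : k = 0
  · subst hk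
    have : mode h 0 = 0 := ext_coeff fun q j => by
      rw [coeff_mode, hh.1, coeff_zero]; simp
    rw [this]
    simp [testField_zero]
  refine ext_coeff fun q l => ?_
  rw [coeff_sum, coeff_mode]
  simp only [coeff_sum, coeff_smul, coeff_testField hk, inner_testField hh]
  have e : ∀ j, ∑ b, (((conj (direction b) * coeff h k j).re : ℝ) : ℂ) *
      testCoeff k j (direction b) q l =
      2⁻¹ * (leray k l j * ((if q = k then coeff h k j else 0) +
        (if -q = k then conj (coeff h k j) else 0))) := by
    intro j
    have s1 := sum_direction (coeff h k j)
    have s2 := congrArg (conj : ℂ → ℂ) s1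
    simp only [map_sum, map_mul, Complex.conj_ofReal] at s2
    have : ∀ b, (((conj (direction b) * coeff h k j).re : ℝ) : ℂ) *
        testCoeff k j (direction b) q l = 2⁻¹ * leray k l j *
        ((if q = k then (((conj (direction b) * coeff h k j).re : ℝ) : ℂ) * direction b else 0) +
         (if -q = k then (((conj (direction b) * coeff h k j).re : ℝ) : ℂ) * conj (direction b)
          else 0)) := by
      intro b
      rw [testCoeff, leray_symm k j l]
      split_ifs <;> ring
    rw [Finset.sum_congr rfl fun b _ => this b, ← Finset.mul_sum, Finset.sum_add_distrib]
    split_ifs <;> simp only [s1, s2, Finset.sum_const_zero] <;> ring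
  rw [Finset.sum_congr rfl fun j _ => e j, ← Finset.mul_sum]
  congr 1
  have t1 := sum_leray_mul (hh.2 k) l
  have t2 := congrArg (conj : ℂ → ℂ) t1
  simp only [map_sum, map_mul, Complex.conj_ofReal] at t2
  simp only [mul_add, mul_ite, mul_zero, Finset.sum_add_distrib]
  split_ifs <;> simp only [t1, t2, Finset.sum_const_zero]

lemma energy_zero_freq {h : L2Field} (hh : h ∈ H) : energy h 0 = 0 := by
  simp [energy, hh.1]

lemma norm_sq_le_lowEnergy (N : ℝ) (n : ℕ) {Λ : ℝ} (hΛ : 0 < Λ) {h g : L2Field} (hh : h ∈ H)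
    (hg : ∀ k j, coeff g k j = (testSymbol N n Λ k : ℂ) * coeff h k j) :
    ‖g‖ ^ 2 ≤ lowEnergy N n (fun k => eigen k * weight Λ k) h := by
  have he : ∀ k, energy g k = testSymbol N n Λ k ^ 2 * energy h k := fun k => by
    rw [← sum_norm_sq_mul]; simp only [energy, hg]
  refine le_of_tendsto' (hasSum_energy g) fun F => ?_
  refine sum_le_lowEnergy (fun k => mul_nonneg (eigen_nonneg k) (weight_nonneg hΛ k))
    (fun k => ?_) F
  rw [he]
  have hw := weight_nonneg hΛ k
  have hE := energy_nonneg h k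
  by_cases hk : k = 0
  · subst hk
    rw [energy_zero_freq hh]; simp
  have h1 := one_le_eigen hk
  have h2 : weight Λ k ≤ eigen k := by
    refine (weight_le_eigen hΛ k).trans ?_
    calc eigen k ^ (1 / 3 : ℝ) ≤ eigen k ^ (1 : ℝ) :=
          Real.rpow_le_rpow_of_exponent_le h1 (by norm_num)
      _ = eigen k := Real.rpow_one _
  unfold testSymbol
  rcases boxSymbol_eq_zero_or_one n k with hb | hb <;>
  rcases lowSymbol_eq_zero_or_one N k with hl | hl <;> rw [hb, hl]
  · simp
  · simp
  · simp
  · simp only [one_mul]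
    refine mul_le_mul_of_nonneg_right ?_ hE
    nlinarith

lemma stokesForm_eq_lowEnergy (N : ℝ) (n : ℕ) (Λ : ℝ) {u φ : V}
    (hφ : ∀ k j, coeff (V.toL2 φ) k j = (testSymbol N n Λ k : ℂ) * coeff (V.toL2 u) k j) :
    stokesForm u φ = lowEnergy N n (fun k => eigen k * weight Λ k) (V.toL2 u) := by
  refine (hasSum_stokesForm u φ).unique ?_
  simp only [hφ, sum_re_conj_mul_smul]
  have h1 := hasSum_sum_of_ne_finset_zero (s := freqBox n) (L := .unconditional _)
    (f := fun k => eigen k * (testSymbol N n Λ k * energy (V.toL2 u) k)) fun k hk => by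
      simp [testSymbol, boxSymbol, hk]
  convert h1 using 1
  refine Finset.sum_congr rfl fun k hk => ?_
  simp only [testSymbol, boxSymbol, hk, if_true]
  ring

lemma two_mul_le_absorb {ν x y : ℝ} (hν : 0 < ν) : 2 * (x * y) ≤ ν / 4 * y ^ 2 + 4 / ν * x ^ 2 := by
  have h := sq_nonneg (ν / 4 * y - x)
  have : ν / 4 * y ^ 2 + 4 / ν * x ^ 2 - 2 * (x * y) = 4 / ν * (ν / 4 * y - x) ^ 2 := by
    field_simp; ring
  have h2 : 0 ≤ 4 / ν * (ν / 4 * y - x) ^ 2 := by positivity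
  linarith

/-- The bound of the convection term by `C`, as provided by `exists_trilinear_le`. -/
def TrilinearBound (N C : ℝ) : Prop := ∀ (n : ℕ) (Λ M : ℝ) (u φ : V), 0 < Λ → 0 ≤ M →
    (∀ k j, coeff (V.toL2 φ) k j = (testSymbol N n Λ k : ℂ) * coeff (V.toL2 u) k j) →
    eLpNorm (genuinePart N (V.toL2 u)) 3 torusMeasure ≤ ENNReal.ofReal M →
    |trilinear u u φ| ≤ C * ‖u‖ *
      (√(lowEnergy N n (weight Λ) (V.toL2 u)) *
          √(lowEnergy N n (fun k => eigen k * weight Λ k) (V.toL2 u)) +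
        Λ ^ (1 / 3 : ℝ) * √(tailNorm n (V.toL2 u) * ‖V.toL2 u‖) * ‖u‖ +
        M * √(lowEnergy N n (fun k => eigen k * weight Λ k) (V.toL2 u)))

/-- The pointwise in time energy inequality. -/
lemma two_mul_rhs_le {ν N C M Λ : ℝ} {n : ℕ} (hν : 0 < ν) (hC : TrilinearBound N C)
    (hM : 0 ≤ M) (hΛ : 0 < Λ) {u φ : V} (f : L2Field)
    (hφ : ∀ k j, coeff (V.toL2 φ) k j = (testSymbol N n Λ k : ℂ) * coeff (V.toL2 u) k j)
    (hw : eLpNorm (genuinePart N (V.toL2 u)) 3 torusMeasure ≤ ENNReal.ofReal M) :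
    2 * (inner ℝ f (V.toL2 φ) - ν * stokesForm u φ - trilinear u u φ) ≤
      -(ν * lowEnergy N n (fun k => eigen k * weight Λ k) (V.toL2 u)) +
      (4 / ν * ‖f‖ ^ 2 + 4 * C ^ 2 / ν * ‖u‖ ^ 2 * M ^ 2 +
        2 * C * Λ ^ (1 / 3 : ℝ) * (√(tailNorm n (V.toL2 u) * ‖V.toL2 u‖) * ‖u‖ ^ 2)) +
      4 * C ^ 2 / ν * ‖u‖ ^ 2 * lowEnergy N n (weight Λ) (V.toL2 u) := by
  have hb := (abs_le.mp (hC n Λ M u φ hΛ hM hφ hw)).1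
  have hst := stokesForm_eq_lowEnergy N n Λ hφ
  have hnorm := norm_sq_le_lowEnergy N n hΛ (V.toL2_mem_H u) hφ
  have hX2 := lowEnergy_nonneg N n (weight_nonneg hΛ) (V.toL2 u)
  have hY2 := lowEnergy_nonneg N n
    (fun k => mul_nonneg (eigen_nonneg k) (weight_nonneg hΛ k)) (V.toL2 u)
  set X2 := lowEnergy N n (weight Λ) (V.toL2 u)
  set Y2 := lowEnergy N n (fun k => eigen k * weight Λ k) (V.toL2 u)
  have hX := Real.sq_sqrt hX2
  have hY := Real.sq_sqrt hY2
  have hY0 := Real.sqrt_nonneg Y2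
  have hf : inner ℝ f (V.toL2 φ) ≤ ‖f‖ * √Y2 :=
    (real_inner_le_norm _ _).trans (mul_le_mul_of_nonneg_left (Real.le_sqrt_of_sq_le hnorm)
      (norm_nonneg f))
  have a1 := two_mul_le_absorb (x := ‖f‖) (y := √Y2) hν
  have a2 := two_mul_le_absorb (x := C * ‖u‖ * √X2) (y := √Y2) hν
  have a3 := two_mul_le_absorb (x := C * ‖u‖ * M) (y := √Y2) hν
  have e2 : 4 / ν * (C * ‖u‖ * √X2) ^ 2 = 4 * C ^ 2 / ν * ‖u‖ ^ 2 * X2 := by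
    rw [mul_pow, hX]; ring
  have e3 : 4 / ν * (C * ‖u‖ * M) ^ 2 = 4 * C ^ 2 / ν * ‖u‖ ^ 2 * M ^ 2 := by ring
  rw [e2, hY] at a2
  rw [e3, hY] at a3
  rw [hY] at a1
  rw [hst]
  have hνY : 0 ≤ ν * Y2 := by positivity
  linear_combination 2 * hf + 2 * hb + a1 + a2 + a3 + (1 / 4) * hνY

lemma intervalIntegrable_mono_right {E : Type*} [NormedAddCommGroup E] {g : ℝ → E} {s t : ℝ}
    (hg : IntervalIntegrable g volume 0 t) (hs : s ∈ Icc 0 t) : IntervalIntegrable g volume 0 s :=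
  hg.mono_set (uIcc_subset_uIcc left_mem_uIcc (by rw [uIcc_of_le (hs.1.trans hs.2)]; exact hs))

/-- The energy identity for finitely many test fields. -/
lemma sum_sq_primitive_eq {ι : Type*} (S : Finset ι) (a : ι → ℝ) (φ : ι → V)
    (ξ : StrongDual ℝ V) {u' : ℝ → StrongDual ℝ V} {t : ℝ} (ht : 0 ≤ t)
    (hu' : IntervalIntegrable u' volume 0 t) :
    ∑ i ∈ S, a i * ((ξ + ∫ s in (0 : ℝ)..t, u' s) (φ i)) ^ 2 = ∑ i ∈ S, a i * (ξ (φ i)) ^ 2 +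
      ∫ s in (0 : ℝ)..t,
        2 * u' s (∑ i ∈ S, (a i * (ξ + ∫ r in (0 : ℝ)..s, u' r) (φ i)) • φ i) ∧
    IntervalIntegrable (fun s =>
      2 * u' s (∑ i ∈ S, (a i * (ξ + ∫ r in (0 : ℝ)..s, u' r) (φ i)) • φ i)) volume 0 t ∧
    ContinuousOn (fun s => ∑ i ∈ S, a i * ((ξ + ∫ r in (0 : ℝ)..s, u' r) (φ i)) ^ 2) (Icc 0 t) := by
  have happ : ∀ s ∈ Icc 0 t, ∀ i, (ξ + ∫ r in (0 : ℝ)..s, u' r) (φ i) =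
      ξ (φ i) + ∫ r in (0 : ℝ)..s, u' r (φ i) := fun s hs i => by
    rw [add_apply,
      ContinuousLinearMap.intervalIntegral_apply (intervalIntegrable_mono_right hu' hs)]
  have hu_int : ∀ i, IntervalIntegrable (fun s => u' s (φ i)) volume 0 t := fun i =>
    ⟨((ContinuousLinearMap.apply ℝ ℝ (φ i)).integrable_comp hu'.1),
      ((ContinuousLinearMap.apply ℝ ℝ (φ i)).integrable_comp hu'.2)⟩
  have hcont : ∀ i, ContinuousOn (fun s => (ξ + ∫ r in (0 : ℝ)..s, u' r) (φ i)) (uIcc 0 t) := by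
    intro i
    have h1 : ContinuousOn (fun s => ∫ r in (0 : ℝ)..s, u' r) (uIcc 0 t) :=
      intervalIntegral.continuousOn_primitive_interval'
        hu' left_mem_uIcc
    exact (ContinuousLinearMap.apply ℝ ℝ (φ i)).continuous.comp_continuousOn
      (continuousOn_const.add h1)
  have hprod : ∀ i, IntervalIntegrable
      (fun s => (ξ + ∫ r in (0 : ℝ)..s, u' r) (φ i) * u' s (φ i)) volume 0 t := fun i =>
    (hu_int i).continuousOn_mul (hcont i)
  have hexp : (fun s => 2 * u' s (∑ i ∈ S, (a i * (ξ + ∫ r in (0 : ℝ)..s, u' r) (φ i)) • φ i)) =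
      fun s => ∑ i ∈ S, 2 * a i * ((ξ + ∫ r in (0 : ℝ)..s, u' r) (φ i) * u' s (φ i)) := by
    funext s
    rw [map_sum, Finset.mul_sum]
    refine Finset.sum_congr rfl fun i _ => ?_
    rw [map_smul, smul_eq_mul]
    ring
  refine ⟨?_, ?_, ?_⟩
  · rw [hexp, intervalIntegral.integral_finsetSum fun i _ => (hprod i).const_mul _,
      ← Finset.sum_add_distrib]
    refine Finset.sum_congr rfl fun i _ => ?_
    rw [intervalIntegral.integral_const_mul, happ t (right_mem_Icc.mpr ht), sq_primitive_eq (hu_int i)]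
    have : ∫ s in (0 : ℝ)..t, (ξ + ∫ r in (0 : ℝ)..s, u' r) (φ i) * u' s (φ i) =
        ∫ s in (0 : ℝ)..t, (ξ (φ i) + ∫ r in (0 : ℝ)..s, u' r (φ i)) * u' s (φ i) := by
      refine intervalIntegral.integral_congr fun s hs => ?_
      rw [uIcc_of_le ht] at hs
      simp only [happ s hs]
    rw [this]
    ring
  · rw [hexp]
    have := IntervalIntegrable.sum S fun i _ => (hprod i).const_mul (2 * a i)
    simpa only [Finset.sum_fn] using this
  · rw [← uIcc_of_le ht]
    exact continuousOn_finsetSum _ fun i _ => continuousOn_const.mul ((hcont i).pow 2)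

/-- The indices of the test fields with wave number in a box. -/
def testIndex (n : ℕ) : Finset ((Fin 3 → ℤ) × Fin 3 × Bool) :=
  freqBox n ×ˢ (Finset.univ ×ˢ Finset.univ)

/-- The weights of the test fields. -/
def testWeight (N Λ : ℝ) (i : (Fin 3 → ℤ) × Fin 3 × Bool) : ℝ := lowSymbol N i.1 * weight Λ i.1

/-- The test fields. -/
def indexedField (i : (Fin 3 → ℤ) × Fin 3 × Bool) : V := testField i.1 i.2.1 (direction i.2.2)

lemma sum_testWeight_sq (N Λ : ℝ) (n : ℕ) {h : L2Field} (hh : h ∈ H) :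
    ∑ i ∈ testIndex n, testWeight N Λ i * (toDual h (indexedField i)) ^ 2 =
      lowEnergy N n (weight Λ) h := by
  rw [testIndex, Finset.sum_product, lowEnergy]
  refine Finset.sum_congr rfl fun k _ => ?_
  rw [Finset.sum_product, ← sum_inner_testField_sq hh k, ← mul_assoc, Finset.mul_sum]
  refine Finset.sum_congr rfl fun j _ => ?_
  rw [Finset.mul_sum]
  rfl

lemma coeff_sum_testWeight (N Λ : ℝ) (n : ℕ) {h : L2Field} (hh : h ∈ H) (q : Fin 3 → ℤ)
    (l : Fin 3) :
    coeff (V.toL2 (∑ i ∈ testIndex n,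
      (testWeight N Λ i * toDual h (indexedField i)) • indexedField i)) q l =
        (testSymbol N n Λ q : ℂ) * coeff h q l := by
  have h1 : V.toL2 (∑ i ∈ testIndex n,
      (testWeight N Λ i * toDual h (indexedField i)) • indexedField i) =
      ∑ k ∈ freqBox n, (lowSymbol N k * weight Λ k) • mode h k := by
    rw [map_sum, testIndex, Finset.sum_product]
    refine Finset.sum_congr rfl fun k _ => ?_
    rw [Finset.sum_product, ← sum_inner_smul_testField hh k, Finset.smul_sum]
    refine Finset.sum_congr rfl fun j _ => ?_
    rw [Finset.smul_sum]
    refine Finset.sum_congr rfl fun b _ => ?_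
    rw [map_smul, mul_smul]
    rfl
  rw [h1, coeff_sum_mode fun k => by rw [lowSymbol_neg, weight_neg]]
  simp only [neg_mem_freqBox, testSymbol, boxSymbol]
  split_ifs <;> push_cast <;> ring

lemma intervalIntegrable_of_timeMeasure {g : ℝ → ℝ} {T s : ℝ} (hg : Integrable g (timeMeasure T))
    (hs : s ∈ Icc 0 T) : IntervalIntegrable g volume 0 s := by
  rw [intervalIntegrable_iff_integrableOn_Ioo_of_le hs.1]
  exact IntegrableOn.mono_set hg (Ioo_subset_Ioo_right hs.2)

lemma intervalIntegral_le_of_timeMeasure {g : ℝ → ℝ} {T s : ℝ}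
    (hg : Integrable g (timeMeasure T)) (hg0 : ∀ r, 0 ≤ g r) (hs : s ∈ Icc 0 T) :
    ∫ r in (0 : ℝ)..s, g r ≤ ∫ r, g r ∂timeMeasure T := by
  rw [intervalIntegral.integral_of_le hs.1, integral_Ioc_eq_integral_Ioo]
  exact setIntegral_mono_set hg (Filter.Eventually.of_forall hg0)
    (Ioo_subset_Ioo_right hs.2).eventuallyLE

lemma continuous_lowEnergy (N : ℝ) (n : ℕ) (m : (Fin 3 → ℤ) → ℝ) :
    Continuous (lowEnergy N n m) :=
  continuous_finsetSum _ fun k _ => continuous_const.mul (continuous_const.mul (continuous_energy k))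

lemma lowEnergy_le (N : ℝ) (n : ℕ) {m : (Fin 3 → ℤ) → ℝ} (hm : ∀ k, 0 ≤ m k) (h : L2Field) :
    lowEnergy N n m h ≤ (∑ k ∈ freqBox n, m k) * ‖h‖ ^ 2 := by
  rw [Finset.sum_mul]
  refine Finset.sum_le_sum fun k _ => ?_
  have h1 : energy h k ≤ ‖h‖ ^ 2 := le_hasSum (hasSum_energy h) k fun _ _ => energy_nonneg h _
  have hE := energy_nonneg h k
  calc lowSymbol N k * (m k * energy h k) ≤ 1 * (m k * energy h k) :=
        mul_le_mul_of_nonneg_right (lowSymbol_le_one N k) (mul_nonneg (hm k) hE)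
    _ ≤ m k * ‖h‖ ^ 2 := by rw [one_mul]; exact mul_le_mul_of_nonneg_left h1 (hm k)

lemma aestronglyMeasurable_toL2 {T : ℝ} {u : ℝ → V} (hu : MemLp u 2 (timeMeasure T)) :
    AEStronglyMeasurable (fun t => V.toL2 (u t)) (timeMeasure T) :=
  V.toL2.continuous.comp_aestronglyMeasurable hu.aestronglyMeasurable

lemma integrable_norm_sq {T : ℝ} {E : Type*} [NormedAddCommGroup E] {u : ℝ → E}
    (hu : MemLp u 2 (timeMeasure T)) : Integrable (fun t => ‖u t‖ ^ 2) (timeMeasure T) :=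
  hu.integrable_norm_pow (by norm_num)

lemma integrable_lowEnergy (N : ℝ) (n : ℕ) {m : (Fin 3 → ℤ) → ℝ} (hm : ∀ k, 0 ≤ m k) {T : ℝ}
    {u : ℝ → V} (hu : MemLp u 2 (timeMeasure T)) :
    Integrable (fun t => lowEnergy N n m (V.toL2 (u t))) (timeMeasure T) := by
  refine ((integrable_norm_sq hu).const_mul (∑ k ∈ freqBox n, m k)).mono'
    ((continuous_lowEnergy N n m).comp_aestronglyMeasurable (aestronglyMeasurable_toL2 hu))
    (Filter.Eventually.of_forall fun t => ?_)
  rw [Real.norm_eq_abs, abs_of_nonneg (lowEnergy_nonneg N n hm _)]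
  refine (lowEnergy_le N n hm _).trans (mul_le_mul_of_nonneg_left ?_
    (Finset.sum_nonneg fun k _ => hm k))
  have := V.norm_toL2_le (u t)
  gcongr

/-- The part of the error in the energy inequality caused by the truncation to a box. -/
def truncationError (C Λ : ℝ) (n : ℕ) (u : V) : ℝ :=
  2 * C * Λ ^ (1 / 3 : ℝ) * (√(tailNorm n (V.toL2 u) * ‖V.toL2 u‖) * ‖u‖ ^ 2)

lemma truncationError_nonneg {C Λ : ℝ} (hC : 0 ≤ C) (hΛ : 0 < Λ) (n : ℕ) (u : V) :
    0 ≤ truncationError C Λ n u := by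
  unfold truncationError; positivity

lemma aestronglyMeasurable_truncationError (C Λ : ℝ) (n : ℕ) {T : ℝ} {u : ℝ → V}
    (hu : MemLp u 2 (timeMeasure T)) :
    AEStronglyMeasurable (fun t => truncationError C Λ n (u t)) (timeMeasure T) := by
  have : Continuous (truncationError C Λ n) := by
    have h1 := (continuous_tailNorm n).comp V.toL2.continuous
    exact continuous_const.mul ((Real.continuous_sqrt.comp
      (h1.mul V.toL2.continuous.norm)).mul (continuous_norm.pow 2))
  exact this.comp_aestronglyMeasurable hu.aestronglyMeasurable

lemma truncationError_le {C Λ B : ℝ} (hC : 0 ≤ C) (hΛ : 0 < Λ) (n : ℕ) {u : V}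
    (hB : ‖V.toL2 u‖ ≤ B) :
    truncationError C Λ n u ≤ 2 * C * Λ ^ (1 / 3 : ℝ) * B * ‖u‖ ^ 2 := by
  have hB0 : 0 ≤ B := (norm_nonneg _).trans hB
  have h1 : √(tailNorm n (V.toL2 u) * ‖V.toL2 u‖) ≤ B := by
    refine Real.sqrt_le_iff.mpr ⟨hB0, ?_⟩
    rw [sq]
    exact mul_le_mul ((tailNorm_le n _).trans hB) hB (norm_nonneg _) hB0
  rw [truncationError, mul_assoc _ B]
  gcongr

lemma tendsto_truncationError (C Λ : ℝ) (u : V) :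
    Filter.Tendsto (fun n => truncationError C Λ n u) Filter.atTop (nhds 0) := by
  have h1 := (Real.continuous_sqrt.tendsto _).comp
    ((tendsto_tailNorm (V.toL2 u)).mul_const ‖V.toL2 u‖)
  have h2 := (h1.mul_const (‖u‖ ^ 2)).const_mul (2 * C * Λ ^ (1 / 3 : ℝ))
  simpa [truncationError, Function.comp_def] using h2

lemma exists_ae_norm_toL2_le {T : ℝ} {u : ℝ → V}
    (hu : MemLp (fun t => V.toL2 (u t)) ∞ (timeMeasure T)) :
    ∃ B : ℝ, ∀ᵐ t ∂timeMeasure T, ‖V.toL2 (u t)‖ ≤ B := by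
  refine ⟨(eLpNorm (fun t => V.toL2 (u t)) ∞ (timeMeasure T)).toReal, ?_⟩
  have h := hu.eLpNorm_lt_top
  rw [eLpNorm_exponent_top] at h ⊢
  filter_upwards [enorm_ae_le_eLpNormEssSup (fun t => V.toL2 (u t)) (timeMeasure T)] with t ht
  rw [← toReal_enorm]
  exact ENNReal.toReal_mono h.ne ht

lemma integrable_truncationError {C Λ : ℝ} (hC : 0 ≤ C) (hΛ : 0 < Λ) (n : ℕ) {T : ℝ} {u : ℝ → V}
    (hu : MemLp u 2 (timeMeasure T)) (hu' : MemLp (fun t => V.toL2 (u t)) ∞ (timeMeasure T)) :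
    Integrable (fun t => truncationError C Λ n (u t)) (timeMeasure T) := by
  obtain ⟨B, hB⟩ := exists_ae_norm_toL2_le hu'
  refine ((integrable_norm_sq hu).const_mul (2 * C * Λ ^ (1 / 3 : ℝ) * B)).mono'
    (aestronglyMeasurable_truncationError C Λ n hu) ?_
  filter_upwards [hB] with t ht
  rw [Real.norm_eq_abs, abs_of_nonneg (truncationError_nonneg hC hΛ n _)]
  exact truncationError_le hC hΛ n ht

lemma tendsto_integral_truncationError {C Λ : ℝ} (hC : 0 ≤ C) (hΛ : 0 < Λ) {T : ℝ} {u : ℝ → V}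
    (hu : MemLp u 2 (timeMeasure T)) (hu' : MemLp (fun t => V.toL2 (u t)) ∞ (timeMeasure T)) :
    Filter.Tendsto (fun n => ∫ t, truncationError C Λ n (u t) ∂timeMeasure T) Filter.atTop
      (nhds 0) := by
  obtain ⟨B, hB⟩ := exists_ae_norm_toL2_le hu'
  have h := tendsto_integral_of_dominated_convergence (μ := timeMeasure T)
    (F := fun n t => truncationError C Λ n (u t)) (f := fun _ => (0 : ℝ))
    (fun t => 2 * C * Λ ^ (1 / 3 : ℝ) * B * ‖u t‖ ^ 2)
    (fun n => aestronglyMeasurable_truncationError C Λ n hu)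
    ((integrable_norm_sq hu).const_mul _) (fun n => ?_)
    (Filter.Eventually.of_forall fun t => tendsto_truncationError C Λ (u t))
  · simpa using h
  · filter_upwards [hB] with t ht
    rw [Real.norm_eq_abs, abs_of_nonneg (truncationError_nonneg hC hΛ n _)]
    exact truncationError_le hC hΛ n ht

/-- The integral energy inequality, closed by Grönwall's inequality, in abstract form. -/
lemma gronwall_energy {ν T R t : ℝ} (hν : 0 ≤ ν) {a D Y E W : ℝ → ℝ}
    (ha : Integrable a (timeMeasure T)) (ha0 : ∀ s, 0 ≤ a s)
    (hD : Integrable D (timeMeasure T)) (hD0 : ∀ s, 0 ≤ D s)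
    (hY : Integrable Y (timeMeasure T)) (hY0 : ∀ s, 0 ≤ Y s) (ht : t ∈ Ico 0 T)
    (hE : ContinuousOn E (Icc 0 t)) (hR : 0 ≤ R)
    (hW : IntervalIntegrable W volume 0 t)
    (hEW : ∀ s ∈ Icc 0 t, E s ≤ R + ∫ r in (0 : ℝ)..s, W r)
    (hWle : ∀ᵐ s ∂timeMeasure T, s ≤ t → W s ≤ -(ν * Y s) + D s + a s * E s) :
    E t + ν * ∫ s in (0 : ℝ)..t, Y s ≤
      (R + ∫ s, D s ∂timeMeasure T) * Real.exp (∫ s, a s ∂timeMeasure T) := by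
  have htT : t ∈ Icc 0 T := ⟨ht.1, ht.2.le⟩
  have hsT : ∀ s ∈ Icc 0 t, s ∈ Icc 0 T := fun s hs => ⟨hs.1, hs.2.trans ht.2.le⟩
  have huIcc : uIcc 0 t = Icc 0 t := uIcc_of_le ht.1
  have hYi := intervalIntegrable_of_timeMeasure hY htT
  set P : ℝ → ℝ := fun s => E s + ν * ∫ r in (0 : ℝ)..s, Y r with hP
  have hPc : ContinuousOn P (Icc 0 t) := by
    refine hE.add (continuousOn_const.mul ?_)
    rw [← huIcc]
    exact intervalIntegral.continuousOn_primitive_interval' hYi left_mem_uIcc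
  have hai := intervalIntegrable_of_timeMeasure ha htT
  have haE : IntervalIntegrable (fun s => a s * E s) volume 0 t :=
    hai.mul_continuousOn (huIcc ▸ hE)
  have haP : IntervalIntegrable (fun s => a s * P s) volume 0 t :=
    hai.mul_continuousOn (huIcc ▸ hPc)
  have hDtot : 0 ≤ ∫ s, D s ∂timeMeasure T := integral_nonneg hD0
  have key : ∀ s ∈ Icc 0 t, P s ≤ (R + ∫ s, D s ∂timeMeasure T) +
      ∫ r in (0 : ℝ)..s, a r * P r := by
    intro s hs
    have hYs := intervalIntegrable_mono_right hYi hs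
    have hDs := intervalIntegrable_of_timeMeasure hD (hsT s hs)
    have haEs := intervalIntegrable_mono_right haE hs
    have hνY : IntervalIntegrable (fun r => -(ν * Y r)) volume 0 s := (hYs.const_mul ν).neg
    have h1 : ∫ r in (0 : ℝ)..s, W r ≤
        ∫ r in (0 : ℝ)..s, (-(ν * Y r) + D r + a r * E r) := by
      rw [intervalIntegral.integral_of_le hs.1, intervalIntegral.integral_of_le hs.1]
      have hWs := intervalIntegrable_mono_right hW hs
      refine setIntegral_mono_ae_restrict
        ((intervalIntegrable_iff_integrableOn_Ioc_of_le hs.1).mp hWs)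
        ((intervalIntegrable_iff_integrableOn_Ioc_of_le hs.1).mp
          ((hνY.add hDs).add haEs)) ?_
      have h2 := ae_restrict_of_ae_restrict_of_subset
        (show Ioc 0 s ⊆ Ioo 0 T from fun r hr => ⟨hr.1, (hr.2.trans hs.2).trans_lt ht.2⟩) hWle
      filter_upwards [h2, ae_restrict_mem measurableSet_Ioc] with r hr hrs
      exact hr (hrs.2.trans hs.2)
    rw [intervalIntegral.integral_add (hνY.add hDs) haEs,
      intervalIntegral.integral_add hνY hDs, intervalIntegral.integral_neg,
      intervalIntegral.integral_const_mul] at h1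
    have h3 := intervalIntegral_le_of_timeMeasure hD hD0 (hsT s hs)
    have h4 : ∫ r in (0 : ℝ)..s, a r * E r ≤ ∫ r in (0 : ℝ)..s, a r * P r := by
      refine intervalIntegral.integral_mono_on hs.1 haEs (intervalIntegrable_mono_right haP hs)
        fun r hr => mul_le_mul_of_nonneg_left ?_ (ha0 r)
      have : 0 ≤ ∫ r in (0 : ℝ)..r, Y r := intervalIntegral.integral_nonneg hr.1 fun _ _ => hY0 _
      simp only [hP]
      nlinarith
    have h5 := hEW s hs
    simp only [hP] at h4 ⊢
    linarith
  refine (gronwall_of_integrable ht.1 hai ha0 hPc key).trans ?_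
  gcongr
  exact intervalIntegral_le_of_timeMeasure ha ha0 htT

/-- The energy bound for the low part in a box with a saturated weight. -/
lemma energy_bound {ν T N C M R Λ : ℝ} (hν : 0 < ν) (hC0 : 0 ≤ C)
    (hC : TrilinearBound N C) (hM : 0 ≤ M) (hΛ : 0 < Λ) {f : ℝ → H}
    (hf : MemLp f 2 (timeMeasure T)) {u₀ : H} {u : ℝ → V}
    (hu : IsWeakSolution ν T (fun t => toDual (f t : L2Field)) u₀ u)
    (hw : ∀ᵐ t ∂timeMeasure T,
      eLpNorm (genuinePart N (V.toL2 (u t))) 3 torusMeasure ≤ ENNReal.ofReal M) (n : ℕ)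
    (hR : lowEnergy N n (weight Λ) (u₀ : L2Field) ≤ R) :
    let B := (R + ∫ s, (4 / ν * ‖f s‖ ^ 2 + 4 * C ^ 2 / ν * ‖u s‖ ^ 2 * M ^ 2 +
        truncationError C Λ n (u s)) ∂timeMeasure T) *
      Real.exp (∫ s, 4 * C ^ 2 / ν * ‖u s‖ ^ 2 ∂timeMeasure T)
    (∀ t ∈ Ico 0 T, ν * ∫ s in (0 : ℝ)..t,
      lowEnergy N n (fun k => eigen k * weight Λ k) (V.toL2 (u s)) ≤ B) ∧
    ∀ᵐ t ∂timeMeasure T, lowEnergy N n (weight Λ) (V.toL2 (u t)) ≤ B := by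
  intro B
  obtain ⟨u', hloc, hprim, heq⟩ := hu.equation
  have hYw : ∀ k, 0 ≤ eigen k * weight Λ k := fun k =>
    mul_nonneg (eigen_nonneg k) (weight_nonneg hΛ k)
  have hR0 : 0 ≤ R := (lowEnergy_nonneg N n (weight_nonneg hΛ) _).trans hR
  have hwt : ∀ i, 0 ≤ testWeight N Λ i := fun i =>
    mul_nonneg (lowSymbol_nonneg N _) (weight_nonneg hΛ _)
  have ha := (integrable_norm_sq hu.memLp_V).const_mul (4 * C ^ 2 / ν)
  have hD : Integrable (fun s => 4 / ν * ‖f s‖ ^ 2 + 4 * C ^ 2 / ν * ‖u s‖ ^ 2 * M ^ 2 +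
        truncationError C Λ n (u s)) (timeMeasure T) :=
    (((integrable_norm_sq hf).const_mul _).add (ha.mul_const _)).add
      (integrable_truncationError hC0 hΛ n hu.memLp_V hu.memLp_H)
  set E : ℝ → ℝ := fun s => ∑ i ∈ testIndex n, testWeight N Λ i *
    ((toDual (u₀ : L2Field) + ∫ r in (0 : ℝ)..s, u' r) (indexedField i)) ^ 2 with hE
  have hE0 : ∀ s, 0 ≤ E s := fun s =>
    Finset.sum_nonneg fun i _ => mul_nonneg (hwt i) (sq_nonneg _)
  have hmain : ∀ t ∈ Ico 0 T, E t + ν * ∫ s in (0 : ℝ)..t,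
      lowEnergy N n (fun k => eigen k * weight Λ k) (V.toL2 (u s)) ≤ B := by
    intro t ht
    have hu_int : IntervalIntegrable u' volume 0 t := by
      rw [intervalIntegrable_iff_integrableOn_Icc_of_le ht.1]
      exact hloc.integrableOn_compact_subset (Icc_subset_Ico_right ht.2) isCompact_Icc
    obtain ⟨-, hWi, hEc⟩ := sum_sq_primitive_eq (testIndex n) (testWeight N Λ) indexedField
      (toDual (u₀ : L2Field)) ht.1 hu_int
    refine gronwall_energy hν.le ha (fun s => by positivity) hD
      (fun s => add_nonneg (by positivity) (truncationError_nonneg hC0 hΛ n _))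
      (integrable_lowEnergy N n hYw hu.memLp_V) (fun s => lowEnergy_nonneg N n hYw _) ht hEc hR0
      hWi (fun s hs => ?_) ?_
    · have h1 := (sum_sq_primitive_eq (testIndex n) (testWeight N Λ) indexedField
        (toDual (u₀ : L2Field)) hs.1 (intervalIntegrable_mono_right hu_int hs)).1
      rw [sum_testWeight_sq N Λ n u₀.2] at h1
      simp only [hE]
      rw [h1]
      linarith
    · filter_upwards [hprim, heq, hw] with s hs1 hs2 hs3 _
      have e1 := sum_testWeight_sq N Λ n (V.toL2_mem_H (u s))
      have e2 := coeff_sum_testWeight N Λ n (V.toL2_mem_H (u s))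
      simp only [hE]
      rw [← hs1, e1]
      set φ := ∑ i ∈ testIndex n,
        (testWeight N Λ i * toDual (V.toL2 (u s)) (indexedField i)) • indexedField i with hφ
      have h2 := hs2 φ
      have h3 := two_mul_rhs_le hν hC hM hΛ (f s : L2Field) e2 hs3
      have h4 : u' s φ = inner ℝ (f s : L2Field) (V.toL2 φ) - ν * stokesForm (u s) φ -
          trilinear (u s) (u s) φ := by
        have : toDual (f s : L2Field) φ = inner ℝ (f s : L2Field) (V.toL2 φ) := rfl
        linarith
      rw [h4]
      exact h3
  refine ⟨fun t ht => ?_, ?_⟩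
  · have := hmain t ht
    have := hE0 t
    linarith
  · filter_upwards [hprim, ae_restrict_mem measurableSet_Ioo] with t ht htT
    have h1 := hmain t ⟨htT.1.le, htT.2⟩
    have h2 := sum_testWeight_sq N Λ n (V.toL2_mem_H (u t))
    rw [ht] at h2
    have h3 : 0 ≤ ∫ s in (0 : ℝ)..t,
        lowEnergy N n (fun k => eigen k * weight Λ k) (V.toL2 (u s)) :=
      intervalIntegral.integral_nonneg htT.1.le fun s _ => lowEnergy_nonneg N n hYw _
    simp only [hE, h2] at h1
    nlinarith

lemma lowEnergy_mono_box (N : ℝ) {m n : ℕ} (hmn : m ≤ n) {w w' : (Fin 3 → ℤ) → ℝ}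
    (hw : ∀ k ∈ freqBox m, w k = w' k) (hw' : ∀ k, 0 ≤ w' k) (h : L2Field) :
    lowEnergy N m w h ≤ lowEnergy N n w' h := by
  have h1 : lowEnergy N m w h = lowEnergy N m w' h :=
    Finset.sum_congr rfl fun k hk => by rw [hw k hk]
  rw [h1]
  exact Finset.sum_le_sum_of_subset_of_nonneg (freqBox_mono hmn) fun k _ _ =>
    mul_nonneg (lowSymbol_nonneg N k) (mul_nonneg (hw' k) (energy_nonneg h k))

lemma integral_timeMeasure_le {T R : ℝ} (hT : 0 < T) {Y : ℝ → ℝ}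
    (hY : Integrable Y (timeMeasure T)) (h : ∀ t ∈ Ico 0 T, ∫ s in (0 : ℝ)..t, Y s ≤ R) :
    ∫ s, Y s ∂timeMeasure T ≤ R := by
  have hYi := intervalIntegrable_of_timeMeasure hY (right_mem_Icc.mpr hT.le)
  have h1 : ∫ s, Y s ∂timeMeasure T = ∫ s in (0 : ℝ)..T, Y s := by
    rw [intervalIntegral.integral_of_le hT.le, integral_Ioc_eq_integral_Ioo]
  have h2 := (intervalIntegral.continuousOn_primitive_interval' hYi left_mem_uIcc) T
    right_mem_uIcc
  have h3 : nhdsWithin T (Iio T) ≤ nhdsWithin T (uIcc 0 T) := by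
    rw [nhdsWithin_le_iff, uIcc_of_le hT.le]
    exact Filter.mem_of_superset (Ico_mem_nhdsLT hT) Ico_subset_Icc_self
  rw [h1]
  refine le_of_tendsto (h2.mono_left h3) ?_
  filter_upwards [Ico_mem_nhdsLT hT] with t ht
  exact h t ht

/-- The bounds for the low part, uniform in the truncation. -/
lemma exists_uniform_bound {ν T N M R₀ : ℝ} (hν : 0 < ν) (hT : 0 < T) (hM : 0 ≤ M) {f : ℝ → H}
    (hf : MemLp f 2 (timeMeasure T)) {u₀ : H} {u : ℝ → V}
    (hu : IsWeakSolution ν T (fun t => toDual (f t : L2Field)) u₀ u)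
    (hw : ∀ᵐ t ∂timeMeasure T,
      eLpNorm (genuinePart N (V.toL2 (u t))) 3 torusMeasure ≤ ENNReal.ofReal M)
    (hR₀ : ∀ n, ∀ Λ > 0, lowEnergy N n (weight Λ) (u₀ : L2Field) ≤ R₀) :
    ∃ R : ℝ, ∀ m : ℕ,
      (∀ᵐ t ∂timeMeasure T,
        lowEnergy N m (fun k => eigen k ^ (1 / 3 : ℝ)) (V.toL2 (u t)) ≤ R) ∧
      ∫ s, lowEnergy N m (fun k => eigen k ^ (4 / 3 : ℝ)) (V.toL2 (u s)) ∂timeMeasure T ≤ R / ν := by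
  obtain ⟨C, hC0, hC⟩ := exists_trilinear_le N
  set K := Real.exp (∫ s, 4 * C ^ 2 / ν * ‖u s‖ ^ 2 ∂timeMeasure T) with hK
  set D : ℝ → ℝ := fun s => 4 / ν * ‖f s‖ ^ 2 + 4 * C ^ 2 / ν * ‖u s‖ ^ 2 * M ^ 2 with hD
  have hDi : Integrable D (timeMeasure T) := ((integrable_norm_sq hf).const_mul _).add
    (((integrable_norm_sq hu.memLp_V).const_mul _).mul_const _)
  refine ⟨(R₀ + ∫ s, D s ∂timeMeasure T) * K, fun m => ?_⟩
  set Λ : ℝ := 1 + ∑ k ∈ freqBox m, eigen k with hΛdef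
  have hΛ : 0 < Λ := by
    have : 0 ≤ ∑ k ∈ freqBox m, eigen k := Finset.sum_nonneg fun k _ => eigen_nonneg k
    linarith
  have hle : ∀ k ∈ freqBox m, eigen k ≤ Λ := fun k hk => by
    have := Finset.single_le_sum (f := eigen) (fun k _ => eigen_nonneg k) hk
    linarith
  have hb := fun n => energy_bound hν hC0.le hC hM hΛ hf hu hw n (hR₀ n Λ hΛ)
  have hlim : Filter.Tendsto (fun n => (R₀ + ∫ s, (D s + truncationError C Λ n (u s))
      ∂timeMeasure T) * K) Filter.atTop (nhds ((R₀ + ∫ s, D s ∂timeMeasure T) * K)) := by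
    have h1 := tendsto_integral_truncationError hC0.le hΛ hu.memLp_V hu.memLp_H
    have h2 := ((h1.const_add (∫ s, D s ∂timeMeasure T)).const_add R₀).mul_const K
    rw [add_zero] at h2
    refine h2.congr fun n => ?_
    rw [integral_add hDi (integrable_truncationError hC0.le hΛ n hu.memLp_V hu.memLp_H)]
  have hw3 : ∀ k, 0 ≤ eigen k ^ (4 / 3 : ℝ) := fun k => Real.rpow_nonneg (eigen_nonneg k) _
  have hYw : ∀ k, 0 ≤ eigen k * weight Λ k := fun k =>
    mul_nonneg (eigen_nonneg k) (weight_nonneg hΛ k)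
  refine ⟨?_, ?_⟩
  · have h1 := ae_all_iff.mpr fun n => (hb n).2
    filter_upwards [h1] with t ht
    refine ge_of_tendsto hlim ?_
    filter_upwards [Filter.eventually_ge_atTop m] with n hn
    exact (lowEnergy_mono_box N hn (fun k hk => (weight_eq_of_le (hle k hk)).symm)
      (weight_nonneg hΛ) _).trans (ht n)
  · refine integral_timeMeasure_le hT (integrable_lowEnergy N m hw3 hu.memLp_V) fun t ht => ?_
    rw [le_div_iff₀ hν, mul_comm]
    refine ge_of_tendsto hlim ?_
    filter_upwards [Filter.eventually_ge_atTop m] with n hn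
    refine le_trans (mul_le_mul_of_nonneg_left ?_ hν.le) ((hb n).1 t ht)
    have htT : t ∈ Icc 0 T := ⟨ht.1, ht.2.le⟩
    refine intervalIntegral.integral_mono_on ht.1
      (intervalIntegrable_of_timeMeasure (integrable_lowEnergy N m hw3 hu.memLp_V) htT)
      (intervalIntegrable_of_timeMeasure (integrable_lowEnergy N n hYw hu.memLp_V) htT)
      fun s _ => lowEnergy_mono_box N hn (fun k hk => ?_) hYw _
    rw [weight_eq_of_le (hle k hk)]
    have := Real.rpow_add' (eigen_nonneg k) (y := 1) (z := 1 / 3) (by norm_num)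
    rw [Real.rpow_one] at this
    rw [← this]; norm_num

/-- The symbol of `A^s` on the low wave numbers. -/
def powSymbol (N s : ℝ) (k : Fin 3 → ℤ) : ℝ := eigen k ^ s * lowSymbol N k

lemma powSymbol_neg (N s : ℝ) (k : Fin 3 → ℤ) : powSymbol N s (-k) = powSymbol N s k := by
  simp [powSymbol, eigen_neg, lowSymbol_neg]

lemma powSymbol_sq (N s : ℝ) (k : Fin 3 → ℤ) :
    powSymbol N s k ^ 2 = lowSymbol N k * eigen k ^ (2 * s) := by
  rw [powSymbol, mul_pow, lowSymbol_sq, mul_comm, ← Real.rpow_natCast,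
    ← Real.rpow_mul (eigen_nonneg k)]
  congr 2; push_cast; ring

lemma summable_powSymbol {N s R : ℝ} {h : L2Field}
    (hR : ∀ m, lowEnergy N m (fun k => eigen k ^ (2 * s)) h ≤ R) :
    Summable (fun k => powSymbol N s k ^ 2 * energy h k) ∧
      ∑' k, powSymbol N s k ^ 2 * energy h k ≤ R := by
  have hF : ∀ F : Finset (Fin 3 → ℤ), ∑ k ∈ F, powSymbol N s k ^ 2 * energy h k ≤ R := by
    intro F
    obtain ⟨m, hm⟩ := (tendsto_freqBox_atTop.eventually_ge_atTop F).exists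
    refine le_trans (Finset.sum_le_sum_of_subset_of_nonneg hm fun k _ _ =>
      mul_nonneg (sq_nonneg _) (energy_nonneg h k)) (le_trans (le_of_eq ?_) (hR m))
    exact Finset.sum_congr rfl fun k _ => by rw [powSymbol_sq, mul_assoc]
  have hs := summable_of_sum_le (fun k => mul_nonneg (sq_nonneg _) (energy_nonneg h k)) hF
  exact ⟨hs, hs.tsum_le_of_sum_le hF⟩

/-- `A^s` of the low part of a field in `H` (zero when the field is not in the domain). -/
def stokesPowLow (N s : ℝ) (h : H) : H :=
  open Classical in
  if hs : Summable (fun k => powSymbol N s k ^ 2 * energy (h : L2Field) k) then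
    ⟨multiplier (powSymbol N s) h, multiplier_mem_H (powSymbol_neg N s) h.2 hs⟩ else 0

lemma coe_stokesPowLow {N s : ℝ} {h : H}
    (hs : Summable (fun k => powSymbol N s k ^ 2 * energy (h : L2Field) k)) :
    (stokesPowLow N s h : L2Field) = multiplier (powSymbol N s) h := by
  rw [stokesPowLow, dif_pos hs]

lemma isStokesPow_stokesPowLow {N s : ℝ} {h : H}
    (hs : Summable (fun k => powSymbol N s k ^ 2 * energy (h : L2Field) k)) :
    IsStokesPow s (lowPart N h) (stokesPowLow N s h) := by
  intro k j
  rw [coe_stokesPowLow hs, coeff_multiplier (powSymbol_neg N s) hs, coeff_lowPart, powSymbol]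
  push_cast; ring

lemma norm_sq_stokesPowLow {N s : ℝ} {h : H}
    (hs : Summable (fun k => powSymbol N s k ^ 2 * energy (h : L2Field) k)) :
    ‖stokesPowLow N s h‖ ^ 2 = ∑' k, powSymbol N s k ^ 2 * energy (h : L2Field) k := by
  rw [← Submodule.norm_coe, coe_stokesPowLow hs, ← (hasSum_energy _).tsum_eq]
  exact tsum_congr fun k => energy_multiplier (powSymbol_neg N s) hs k

lemma aestronglyMeasurable_stokesPowLow (N s : ℝ) {μ : Measure ℝ} {h : ℝ → H}
    (hh : AEStronglyMeasurable (fun t => (h t : L2Field)) μ)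
    (hs : ∀ᵐ t ∂μ, Summable (fun k => powSymbol N s k ^ 2 * energy (h t : L2Field) k)) :
    AEStronglyMeasurable (fun t => stokesPowLow N s (h t)) μ := by
  rw [← Topology.IsEmbedding.subtypeVal.aestronglyMeasurable_comp_iff]
  refine aestronglyMeasurable_of_tendsto_ae (u := Filter.atTop)
    (f := fun (F : Finset (Fin 3 → ℤ)) t => ∑ k ∈ F, powSymbol N s k • mode (h t : L2Field) k)
    (fun F => ?_) ?_
  · have : Continuous fun g : L2Field => ∑ k ∈ F, powSymbol N s k • mode g k :=
      continuous_finsetSum _ fun k _ => (continuous_mode k).fun_const_smul (powSymbol N s k)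
    exact this.comp_aestronglyMeasurable hh
  · filter_upwards [hs] with t ht
    have := hasSum_mode (powSymbol_neg N s) ht
    rw [← coe_stokesPowLow ht] at this
    exact this

/-- Uniform bounds of the truncated energies give `A^s v ∈ L^∞(0, T; H)`. -/
lemma stokesPowMemLp_top {N s T R : ℝ} {u : ℝ → V} (hu : MemLp u 2 (timeMeasure T))
    (hR : ∀ m, ∀ᵐ t ∂timeMeasure T,
      lowEnergy N m (fun k => eigen k ^ (2 * s)) (V.toL2 (u t)) ≤ R) :
    StokesPowMemLp s ∞ T (fun t => lowPart N (V.toL2 (u t))) := by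
  let h : ℝ → H := fun t => ⟨V.toL2 (u t), V.toL2_mem_H (u t)⟩
  have hs := (ae_all_iff.mpr hR).mono fun t ht => summable_powSymbol ht
  refine ⟨fun t => stokesPowLow N s (h t), ?_, ?_⟩
  · refine memLp_top_of_bound (aestronglyMeasurable_stokesPowLow N s (h := h)
      (aestronglyMeasurable_toL2 hu) (hs.mono fun t ht => ht.1)) (√R) ?_
    filter_upwards [hs] with t ht
    refine Real.le_sqrt_of_sq_le ?_
    rw [norm_sq_stokesPowLow (h := h t) ht.1]
    exact ht.2
  · filter_upwards [hs] with t ht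
    exact isStokesPow_stokesPowLow (h := h t) ht.1

/-- Uniform bounds of the integrals of the truncated energies give `A^s v ∈ L²(0, T; H)`. -/
lemma stokesPowMemLp_two {N s T R : ℝ} {u : ℝ → V} (hu : MemLp u 2 (timeMeasure T))
    (hR : ∀ m, ∫ t, lowEnergy N m (fun k => eigen k ^ (2 * s)) (V.toL2 (u t)) ∂timeMeasure T ≤ R) :
    StokesPowMemLp s 2 T (fun t => lowPart N (V.toL2 (u t))) := by
  let h : ℝ → H := fun t => ⟨V.toL2 (u t), V.toL2_mem_H (u t)⟩
  have hw : ∀ k, 0 ≤ eigen k ^ (2 * s) := fun k => Real.rpow_nonneg (eigen_nonneg k) _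
  set Y : ℕ → ℝ → ℝ := fun m t => lowEnergy N m (fun k => eigen k ^ (2 * s)) (V.toL2 (u t)) with hY
  have hYi : ∀ m, Integrable (Y m) (timeMeasure T) := fun m => integrable_lowEnergy N m hw hu
  have hY0 : ∀ m t, 0 ≤ Y m t := fun m t => lowEnergy_nonneg N m hw _
  have hYmono : ∀ t, Monotone fun m => ENNReal.ofReal (Y m t) := fun t m n hmn =>
    ENNReal.ofReal_le_ofReal (lowEnergy_mono_box N hmn (fun _ _ => rfl) hw _)
  have hmeas : ∀ m, AEMeasurable (fun t => ENNReal.ofReal (Y m t)) (timeMeasure T) := fun m =>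
    (hYi m).aestronglyMeasurable.aemeasurable.ennreal_ofReal
  have hsup : ∫⁻ t, ⨆ m, ENNReal.ofReal (Y m t) ∂timeMeasure T ≤ ENNReal.ofReal R := by
    rw [lintegral_iSup' hmeas (Filter.Eventually.of_forall hYmono)]
    refine iSup_le fun m => ?_
    rw [← ofReal_integral_eq_lintegral_ofReal (hYi m) (Filter.Eventually.of_forall (hY0 m))]
    exact ENNReal.ofReal_le_ofReal (hR m)
  have hfin : ∀ᵐ t ∂timeMeasure T, ⨆ m, ENNReal.ofReal (Y m t) < ∞ :=
    ae_lt_top' (AEMeasurable.iSup hmeas) (hsup.trans_lt ENNReal.ofReal_lt_top).ne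
  have hs : ∀ᵐ t ∂timeMeasure T,
      Summable (fun k => powSymbol N s k ^ 2 * energy (h t : L2Field) k) ∧
      ∑' k, powSymbol N s k ^ 2 * energy (h t : L2Field) k ≤
        (⨆ m, ENNReal.ofReal (Y m t)).toReal := by
    filter_upwards [hfin] with t ht
    refine summable_powSymbol fun m => ?_
    have h1 := ENNReal.toReal_mono ht.ne (le_iSup (fun m => ENNReal.ofReal (Y m t)) m)
    rwa [ENNReal.toReal_ofReal (hY0 m t)] at h1
  have hgm : AEStronglyMeasurable (fun t => stokesPowLow N s (h t)) (timeMeasure T) :=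
    aestronglyMeasurable_stokesPowLow N s (h := h)
      (aestronglyMeasurable_toL2 hu) (hs.mono fun t ht => ht.1)
  refine ⟨fun t => stokesPowLow N s (h t), ?_, ?_⟩
  · rw [memLp_two_iff_integrable_sq_norm hgm]
    refine Integrable.mono' (g := fun t => (⨆ m, ENNReal.ofReal (Y m t)).toReal)
      (integrable_toReal_of_lintegral_ne_top (AEMeasurable.iSup hmeas)
        (hsup.trans_lt ENNReal.ofReal_lt_top).ne) (hgm.norm.pow 2) ?_
    filter_upwards [hs] with t ht
    rw [Real.norm_eq_abs, abs_of_nonneg (by positivity), norm_sq_stokesPowLow (h := h t) ht.1]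
    exact ht.2
  · filter_upwards [hs] with t ht
    exact isStokesPow_stokesPowLow (h := h t) ht.1

lemma lowEnergy_le_of_isStokesPow {N : ℝ} {h : L2Field} {g : H}
    (hg : IsStokesPow (1 / 6) (lowPart N h) g) (n : ℕ) {Λ : ℝ} (hΛ : 0 < Λ) :
    lowEnergy N n (weight Λ) h ≤ ‖(g : L2Field)‖ ^ 2 := by
  refine le_trans (Finset.sum_le_sum fun k _ => ?_) (sum_energy_le (g : L2Field) (freqBox n))
  have h1 : energy (g : L2Field) k = powSymbol N (1 / 6) k ^ 2 * energy h k := by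
    rw [← sum_norm_sq_mul]
    unfold IsStokesPow at hg
    simp only [energy, hg, coeff_lowPart, powSymbol, Complex.ofReal_mul, mul_assoc]
  rw [h1, powSymbol_sq, mul_assoc]
  refine mul_le_mul_of_nonneg_left (mul_le_mul_of_nonneg_right ?_ (energy_nonneg h k))
    (lowSymbol_nonneg N k)
  have e : (2 * (1 / 6) : ℝ) = 1 / 3 := by norm_num
  rw [e]
  exact weight_le_eigen hΛ k

end SpectralNS

end

open SpectralNS in
theorem proposition3p2 (ν T N : ℝ) (hν : 0 < ν) (hT : 0 < T) (hN : 0 < N)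
    (f : ℝ → H) (hf : MemLp f 2 (timeMeasure T)) (u₀ : H) (u : ℝ → V)
    (hu : IsWeakSolution ν T (fun t => toDual (f t : L2Field)) u₀ u)
    (hv₀ : ∃ g : H, IsStokesPow (1 / 6) (lowPart N u₀) g)
    (hw : essSup (fun t => eLpNorm (genuinePart N (V.toL2 (u t))) 3 torusMeasure)
      (timeMeasure T) < ∞) :
    StokesPowMemLp (1 / 6) ∞ T (fun t => lowPart N (V.toL2 (u t))) ∧
    StokesPowMemLp (2 / 3) 2 T (fun t => lowPart N (V.toL2 (u t))) := by
  obtain ⟨g, hg⟩ := hv₀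
  have hw' : ∀ᵐ t ∂timeMeasure T, eLpNorm (genuinePart N (V.toL2 (u t))) 3 torusMeasure ≤
      ENNReal.ofReal (essSup (fun t => eLpNorm (genuinePart N (V.toL2 (u t))) 3 torusMeasure)
        (timeMeasure T)).toReal := by
    rw [ENNReal.ofReal_toReal hw.ne]
    exact ENNReal.ae_le_essSup _
  obtain ⟨R, hR⟩ := exists_uniform_bound hν hT ENNReal.toReal_nonneg hf hu hw'
    fun n Λ hΛ => lowEnergy_le_of_isStokesPow hg n hΛ
  have e₁ : (2 * (1 / 6) : ℝ) = 1 / 3 := by norm_num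
  have e₂ : (2 * (2 / 3) : ℝ) = 4 / 3 := by norm_num
  exact ⟨stokesPowMemLp_top hu.memLp_V fun m => e₁ ▸ (hR m).1,
    stokesPowMemLp_two hu.memLp_V fun m => e₂ ▸ (hR m).2⟩
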